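/- Let $M$ be a compact connected (smooth, Hausdorff) manifold with corners of dimension $n$. For $x\in M$ let $d(x)$ be the number of boundary-defining coordinates that vanish at $x$ in a chart at $x$ with values in $[0,\infty)^n$. The open faces $\Gamma_j^\circ$ of codimension $d_j$ are the connected components of $\{x : d(x)=d_j\}$; let $\Gamma_1^\circ,\dots,\Gamma_N^\circ$ be those of positive codimension. The closed face $\Gamma_j$ is the manifold with corners with interior $\Gamma_j^\circ$ whose points are the local sheets of the closure of $\Gamma_j^\circ$, i.e. the pairs of a point $p\in M$ and a set of $d_j$ germs at $p$ of local boundary hyperfaces (the germs $\{\rho_1=0\},\dots,\{\rho_{d_j}=0\}$ for local defining functions $\rho_i$) such that the points near $p$ that lie on these hyperfaces and on no others belong to $\Gamma_j^\circ$; the map $i_j:\Gamma_j\to M$, which forgets the sheet, is an immersion. The normal bundle $N_+\Gamma_j$ is the bundle over $\Gamma_j$ whose fiber is the quadrant $[0,\infty)^{d_j}$ with coordinates $\rho$ labelled by the $d_j$ local hyperfaces that cut out the sheet; changes of chart act in the fibers by permutations, so $|\rho|$ and the projections along sets of these coordinates are well defined. We write $\Gamma_j\succ\Gamma_l$ if $d_j<d_l$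 and $\Gamma_l^\circ\subset i_j(\Gamma_j)$. For all sufficiently small $\varepsilon>0$ there exist smooth maps $$f_j:\ N_+\Gamma_j\supset\{|\rho|\le\varepsilon\}\longrightarrow M,\qquad j=1,\dots,N$$ (smooth up to $|\rho|=\varepsilon$ in the sense that they extend smoothly to a neighborhood of this set), such that: 1. $f_j=i_j$ on the zero section. 2. $f_j$ is a local diffeomorphism (at every point with $|\rho|\le\varepsilon$). 3. The restriction of $f_j$ to some neighborhood, contained in $\{|\rho|\le\varepsilon\}$, of the open face $\Gamma_j^\circ$ (in the zero section of $N_+\Gamma_j$) is a diffeomorphism onto an open subset of $M$. 4. If $\Gamma_j\succ\Gamma_l$, then $f_j$ and $f_l$ are locally compatible in the following sense. Let $x\in\Gamma_l$, and let $z\in\Gamma_j$ be any point with $i_j(z)=i_l(x)$ such that the local hyperfaces that cut out the sheet $z$ are among those that cut out the sheet $x$. Let $\varphi=f_l^{-1}\circ f_j$, where $f_l^{-1}$ is the local inverse of $f_l$ near the zero vector at $x$; $\varphi$ is defined near the zero vector at $z$. Then for all $v\in N_+\Gamma_j$ in a neighborhood of the zero vector at $z$ $$\pi_2(\varphi(v))=\varphi(\pi_1(v)),$$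 where $\pi_1:N_+\Gamma_j\to\Gamma_j$ is the bundle projection ($\Gamma_j$ being identified with the zero section), and $\pi_2$ is the projection in the fibers of $N_+\Gamma_l$ that sets to zero the coordinates labelled by the hyperfaces that cut out the sheet $z$; in other words, $\pi_2$ is the projection onto the coordinate subbundle into which $\varphi$ maps $\Gamma_j$, along the complementary coordinate subbundle. -/

import Mathlib

open Set Filter Topology
open scoped Manifold ContDiff

noncomputable section

namespace Corners

/-- The model of `n`-dimensional manifolds with corners: open subsets of `[0, ∞)ⁿ`. -/
abbrev model (n : ℕ) :
    ModelWithCorners ℝ (EuclideanSpace ℝ (Fin n)) (EuclideanQuadrant n) :=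
  modelWithCornersEuclideanQuadrant n

section Defs

variable {n : ℕ} {M : Type*} [TopologicalSpace M]

section Depth

variable (n) [ChartedSpace (EuclideanQuadrant n) M]

/-- The number `d(x)` of coordinates that vanish at `x` in a chart at `x`. -/
def depth (x : M) : ℕ :=
  {i : Fin n | (chartAt (EuclideanQuadrant n) x x).1 i = 0}.ncard

variable (M) in
/-- An open face of codimension `codim`: a connected component of `{y | d(y) = codim}`. -/
structure OpenFace where
  codim : ℕ
  carrier : Set M
  isComponent : ∃ x : M, depth n x = codim ∧
    carrier = connectedComponentIn {y : M | depth n y = codim} x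

end Depth

/-- The germ at `q` of the local hyperface `{ψᵢ = 0}`. Germs at `q` of subsets of `M` are encoded
by the filters `𝓝[S] q`: one has `𝓝[S] q = 𝓝[T] q` if and only if `S` and `T` coincide near `q`. -/
def hyperGerm (ψ : OpenPartialHomeomorph M (EuclideanQuadrant n)) (q : M) (i : Fin n) :
    Filter M :=
  𝓝[{y : M | (ψ y).1 i = 0}] q

variable [ChartedSpace (EuclideanQuadrant n) M]

/-- `ψ` is a chart at `q`, the coordinates `ψᵢ`, `i ∈ J`, vanish at `q`, their number is the
codimension of `F`, and the points near `q` at which exactly these coordinates vanish lie in `F`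
(so that the `ψᵢ`, `i ∈ J`, are local defining functions of a sheet at `q` of the closure
of `F`). -/
structure IsAdapted (F : OpenFace n M) (ψ : OpenPartialHomeomorph M (EuclideanQuadrant n))
    (J : Finset (Fin n)) (q : M) : Prop where
  mem_atlas : ψ ∈ atlas (EuclideanQuadrant n) M
  mem_source : q ∈ ψ.source
  card_eq : J.card = F.codim
  vanish : ∀ i ∈ J, (ψ q).1 i = 0
  nearby : ∀ᶠ y in 𝓝 q, (∀ i ∈ J, (ψ y).1 i = 0) → depth n y = F.codim → y ∈ F.carrier

/-- The closed face of the open face `F`: its points are the sheets of the closure of `F`, that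
is, the pairs of a point of `M` and the set of germs of local hyperfaces that cut out a sheet of
the closure of `F` at that point. -/
structure ClosedFace (F : OpenFace n M) where
  /-- the immersion of the closed face in `M` -/
  immersion : M
  /-- the germs at `immersion` of the local hyperfaces whose intersection is the sheet -/
  hypers : Set (Filter M)
  exists_chart : ∃ (ψ : OpenPartialHomeomorph M (EuclideanQuadrant n)) (J : Finset (Fin n)),
    IsAdapted F ψ J immersion ∧ hypers = hyperGerm ψ immersion '' J

/-- The (total space of the) normal bundle `N₊` of the closed face of `F`. The fibre over a point
is the quadrant of nonnegative functions on the set of local hyperfaces that cut out the face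
there; so a chart with local defining functions numbers the coordinates in the fibre, and a change
of the chart permutes them. -/
structure NormalBundle (F : OpenFace n M) where
  /-- the bundle projection -/
  point : ClosedFace F
  /-- the variable in the fibre -/
  coord : Filter M → ℝ
  coord_nonneg : ∀ H, 0 ≤ coord H
  coord_eq_zero : ∀ H, H ∉ point.hypers → coord H = 0

namespace NormalBundle

variable {F : OpenFace n M}

/-- The zero section. -/
def zero (z : ClosedFace F) : NormalBundle F where
  point := z
  coord _ := 0
  coord_nonneg _ := le_rfl
  coord_eq_zero _ _ := rfl

/-- The norm `|ρ|` of the variable in the fibre. -/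
def norm (v : NormalBundle F) : ℝ := Real.sqrt (∑ᶠ H : Filter M, v.coord H ^ 2)

open Classical in
/-- The projection in the fibre along the coordinates in `S` onto the remaining coordinates. -/
def project (S : Set (Filter M)) (v : NormalBundle F) : NormalBundle F where
  point := v.point
  coord H := if H ∈ S then 0 else v.coord H
  coord_nonneg H := by split_ifs <;> simp [v.coord_nonneg]
  coord_eq_zero H hH := by simp [v.coord_eq_zero H hH]

end NormalBundle

/-- `F ≻ G`: the codimension of `G` is larger and the immersed closed face of `F` contains `G`. -/
def Adjacent (F G : OpenFace n M) : Prop :=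
  F.codim < G.codim ∧ G.carrier ⊆ range (fun z : ClosedFace F => z.immersion)

end Defs

/-! ### The smooth structure of the normal bundle -/

section Charts

variable {n : ℕ}

/-- Replace the coordinates in `J` by zero. -/
def zeroOut (J : Finset (Fin n)) (w : EuclideanQuadrant n) : EuclideanQuadrant n :=
  ⟨WithLp.toLp 2 fun i => if i ∈ J then 0 else w.1 i, fun i => by
    by_cases h : i ∈ J <;> simp [h, w.2 i]⟩

lemma zeroOut_apply (J : Finset (Fin n)) (w : EuclideanQuadrant n) (i : Fin n) :
    (zeroOut J w).1 i = if i ∈ J then 0 else w.1 i := rfl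

lemma continuous_zeroOut (J : Finset (Fin n)) : Continuous (zeroOut J) := by
  refine Continuous.subtype_mk ?_ _
  refine (PiLp.continuous_toLp 2 _).comp (continuous_pi fun i => ?_)
  by_cases h : i ∈ J
  · simpa [h] using continuous_const
  · simp only [h, if_false]
    exact (PiLp.continuous_apply 2 _ i).comp continuous_subtype_val

variable {M : Type*} [TopologicalSpace M]

lemma hyperGerm_injOn {ψ : OpenPartialHomeomorph M (EuclideanQuadrant n)} {q : M}
    (hq : q ∈ ψ.source) {i k : Fin n} (hi : (ψ q).1 i = 0) (hk : (ψ q).1 k = 0)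
    (h : hyperGerm ψ q i = hyperGerm ψ q k) : i = k := by
  by_contra hik
  have h1 : {y : M | (ψ y).1 i = 0} =ᶠ[𝓝 q] {y : M | (ψ y).1 k = 0} :=
    nhdsWithin_eq_iff_eventuallyEq.1 h
  let x : ℝ → EuclideanQuadrant n := fun t =>
    ⟨(ψ q).1 + WithLp.toLp 2 (Pi.single k (max t 0)), fun j => by
      have := (ψ q).2 j
      by_cases hj : j = k
      · subst hj; simp; positivity
      · simpa [hj] using this⟩
  have hx : Continuous x := by
    refine Continuous.subtype_mk ?_ _
    refine continuous_const.add ((PiLp.continuous_toLp 2 _).comp (continuous_pi fun j => ?_))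
    by_cases hj : j = k
    · subst hj; simpa using continuous_id.max continuous_const
    · simpa [hj] using continuous_const
  have hx0 : x 0 = ψ q := by
    apply Subtype.ext
    ext j
    simp [x]
  have hten : Tendsto x (𝓝 0) (𝓝 (ψ q)) := by
    have := hx.tendsto 0
    rwa [hx0] at this
  have hsymm : Tendsto ψ.symm (𝓝 (ψ q)) (𝓝 q) := by
    have := ψ.continuousAt_symm (ψ.map_source hq)
    simpa [ContinuousAt, ψ.left_inv hq] using this
  have h2 := (hsymm.comp hten).eventually h1.mem_iff
  have h3 := hten.eventually (ψ.open_target.mem_nhds (ψ.map_source hq))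
  have h4 : ∀ᶠ t : ℝ in 𝓝[>] 0, False := by
    filter_upwards [h2.filter_mono nhdsWithin_le_nhds, h3.filter_mono nhdsWithin_le_nhds,
      self_mem_nhdsWithin] with t ht2 ht3 ht
    simp only [Function.comp, ψ.right_inv ht3] at ht2
    have e1 : (x t).1 i = 0 := by simp [x, hi, hik]
    have e2 : (x t).1 k = t := by
      simp only [x, PiLp.add_apply, Pi.single_eq_same, hk, zero_add]
      exact max_eq_left (le_of_lt ht)
    rw [e1, e2] at ht2
    exact (ne_of_gt ht) (ht2.1 rfl)
  simpa using h4.exists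

variable [ChartedSpace (EuclideanQuadrant n) M] {F : OpenFace n M}

@[ext]
lemma NormalBundle.ext' {v w : NormalBundle F} (h1 : v.point.immersion = w.point.immersion)
    (h2 : v.point.hypers = w.point.hypers) (h3 : v.coord = w.coord) : v = w := by
  obtain ⟨⟨a, b, c⟩, d, e, f⟩ := v
  obtain ⟨⟨a', b', c'⟩, d', e', f'⟩ := w
  dsimp at h1 h2 h3
  subst h1 h2 h3
  rfl

/-- The domain of the chart of the normal bundle given by `ψ` and `J`. -/
def chartSource (F : OpenFace n M) (ψ : OpenPartialHomeomorph M (EuclideanQuadrant n))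
    (J : Finset (Fin n)) : Set (NormalBundle F) :=
  {v | IsAdapted F ψ J v.point.immersion ∧
    v.point.hypers = hyperGerm ψ v.point.immersion '' J}

/-- The image of the chart of the normal bundle given by `ψ` and `J`. -/
def chartTarget (F : OpenFace n M) (ψ : OpenPartialHomeomorph M (EuclideanQuadrant n))
    (J : Finset (Fin n)) : Set (EuclideanQuadrant n) :=
  {w | zeroOut J w ∈ ψ.target ∧ IsAdapted F ψ J (ψ.symm (zeroOut J w))}

/-- The coordinates given by `ψ` and `J`: the fibre coordinates in place of the
defining functions `ψᵢ`, `i ∈ J`, and the coordinates `ψᵢ`, `i ∉ J`, along the face. -/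
def chartFun (ψ : OpenPartialHomeomorph M (EuclideanQuadrant n))
    (J : Finset (Fin n)) (v : NormalBundle F) : EuclideanQuadrant n :=
  ⟨WithLp.toLp 2 fun i => if i ∈ J then v.coord (hyperGerm ψ v.point.immersion i)
      else (ψ v.point.immersion).1 i, fun i => by
    by_cases h : i ∈ J
    · simp [h, v.coord_nonneg]
    · simp [h, (ψ v.point.immersion).2 i]⟩

lemma chartFun_apply (ψ : OpenPartialHomeomorph M (EuclideanQuadrant n))
    (J : Finset (Fin n)) (v : NormalBundle F) (i : Fin n) :
    (chartFun ψ J v).1 i = if i ∈ J then v.coord (hyperGerm ψ v.point.immersion i)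
      else (ψ v.point.immersion).1 i := rfl

lemma zeroOut_chartFun {ψ : OpenPartialHomeomorph M (EuclideanQuadrant n)}
    {J : Finset (Fin n)} {v : NormalBundle F} (hv : v ∈ chartSource F ψ J) :
    zeroOut J (chartFun ψ J v) = ψ v.point.immersion := by
  apply Subtype.ext
  ext i
  rw [zeroOut_apply, chartFun_apply]
  by_cases h : i ∈ J
  · simp [h, hv.1.vanish i h]
  · simp [h]

lemma immersion_eq {ψ : OpenPartialHomeomorph M (EuclideanQuadrant n)}
    {J : Finset (Fin n)} {v : NormalBundle F} (hv : v ∈ chartSource F ψ J) :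
    v.point.immersion = ψ.symm (zeroOut J (chartFun ψ J v)) := by
  rw [zeroOut_chartFun hv, ψ.left_inv hv.1.mem_source]

lemma chartFun_bijOn (F : OpenFace n M) (ψ : OpenPartialHomeomorph M (EuclideanQuadrant n))
    (J : Finset (Fin n)) : BijOn (chartFun ψ J) (chartSource F ψ J) (chartTarget F ψ J) := by
  classical
  refine ⟨fun v hv => ?_, fun v hv w hw h => ?_, fun w hw => ?_⟩
  · refine ⟨?_, ?_⟩
    · rw [zeroOut_chartFun hv]; exact ψ.map_source hv.1.mem_source
    · rw [← immersion_eq hv]; exact hv.1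
  · have hb : v.point.immersion = w.point.immersion := by
      rw [immersion_eq hv, immersion_eq hw, h]
    have hs : v.point.hypers = w.point.hypers := by rw [hv.2, hw.2, hb]
    refine NormalBundle.ext' hb hs (funext fun H => ?_)
    by_cases hH : H ∈ v.point.hypers
    · have hH' := hH
      rw [hv.2] at hH'
      obtain ⟨i, hi, rfl⟩ := hH'
      have hi : i ∈ J := hi
      have := congrArg (fun x : EuclideanQuadrant n => x.1 i) h
      simp only [chartFun_apply, hi, if_true] at this
      rw [this, hb]
    · rw [v.coord_eq_zero H hH, w.coord_eq_zero H (hs ▸ hH)]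
  · set q := ψ.symm (zeroOut J w) with hq
    have hψq : ψ q = zeroOut J w := ψ.right_inv hw.1
    let z : ClosedFace F := ⟨q, hyperGerm ψ q '' J, ψ, J, hw.2, rfl⟩
    let v : NormalBundle F :=
      { point := z
        coord := fun H => if h : ∃ i ∈ J, hyperGerm ψ q i = H then w.1 h.choose else 0
        coord_nonneg := fun H => by
          split_ifs with h
          · exact w.2 _
          · exact le_rfl
        coord_eq_zero := fun H hH => dif_neg fun ⟨i, hi, h⟩ => hH ⟨i, hi, h⟩ }
    refine ⟨v, ⟨hw.2, rfl⟩, Subtype.ext ?_⟩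
    ext i
    rw [chartFun_apply]
    by_cases hi : i ∈ J
    · have hex : ∃ k ∈ J, hyperGerm ψ q k = hyperGerm ψ q i := ⟨i, hi, rfl⟩
      have hc := hex.choose_spec
      have : hex.choose = i := hyperGerm_injOn hw.2.mem_source (hw.2.vanish _ hc.1)
        (hw.2.vanish i hi) hc.2
      have e : v.coord (hyperGerm ψ q i) = w.1 hex.choose := dif_pos hex
      simp only [hi, if_true]
      rw [show v.point.immersion = q from rfl, e, this]
    · simp only [hi, if_false]
      rw [show v.point.immersion = q from rfl, hψq, zeroOut_apply]
      simp [hi]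

/-- The chart of the normal bundle given by `ψ` and `J`. (The argument `v` only witnesses that
the normal bundle is not empty.) -/
def bundleChart (ψ : OpenPartialHomeomorph M (EuclideanQuadrant n)) (J : Finset (Fin n))
    (v : NormalBundle F) : PartialEquiv (NormalBundle F) (EuclideanQuadrant n) :=
  haveI : Nonempty (NormalBundle F) := ⟨v⟩
  (chartFun_bijOn F ψ J).toPartialEquiv (chartFun ψ J) _ _

lemma chartTarget_isOpen (F : OpenFace n M) (ψ : OpenPartialHomeomorph M (EuclideanQuadrant n))
    (J : Finset (Fin n)) : IsOpen (chartTarget F ψ J) := by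
  rw [isOpen_iff_mem_nhds]
  intro w hw
  have hz := (continuous_zeroOut J).tendsto w
  have h1 := hz.eventually (ψ.open_target.mem_nhds hw.1)
  have h2 := (ψ.continuousAt_symm hw.1).tendsto.comp hz
  have h3 := h2.eventually hw.2.nearby.eventually_nhds
  filter_upwards [h1, h3] with y hy1 hy3
  refine ⟨hy1, hw.2.mem_atlas, ψ.map_target hy1, hw.2.card_eq, fun i hi => ?_, hy3⟩
  rw [ψ.right_inv hy1, zeroOut_apply, if_pos hi]

/-- Near each point, a change of coordinates on the normal bundle is given by the change of
coordinates along the face and by a permutation of the coordinates in the fibre. -/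
lemma transition_eventually {ψ ψ' : OpenPartialHomeomorph M (EuclideanQuadrant n)}
    {J J' : Finset (Fin n)} {u u' v : NormalBundle F}
    (hv : v ∈ chartSource F ψ J) (hv' : v ∈ chartSource F ψ' J') :
    ∃ σ : Fin n → Fin n, ∀ᶠ w in 𝓝 (chartFun ψ J v),
      w ∈ ((bundleChart ψ J u).symm.trans (bundleChart ψ' J' u')).source ∧
      zeroOut J w ∈ ψ.target ∧ ψ.symm (zeroOut J w) ∈ ψ'.source ∧
      ∀ k, ((bundleChart ψ J u).symm.trans (bundleChart ψ' J' u') w).1 k =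
        if k ∈ J' then w.1 (σ k) else (ψ' (ψ.symm (zeroOut J w))).1 k := by
  classical
  set q := v.point.immersion with hq
  have hJ : hyperGerm ψ q '' J = hyperGerm ψ' q '' J' := hv.2.symm.trans hv'.2
  have hex : ∀ k, ∃ i, k ∈ J' → i ∈ J ∧ hyperGerm ψ q i = hyperGerm ψ' q k := by
    intro k
    by_cases hk : k ∈ J'
    · have : hyperGerm ψ' q k ∈ hyperGerm ψ q '' J := hJ ▸ ⟨k, hk, rfl⟩
      obtain ⟨i, hi, h⟩ := this
      exact ⟨i, fun _ => ⟨hi, h⟩⟩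
    · exact ⟨k, fun h => absurd h hk⟩
  choose σ hσ using hex
  have hex' : ∀ i ∈ J, ∃ k ∈ J', σ k = i := by
    intro i hi
    have : hyperGerm ψ q i ∈ hyperGerm ψ' q '' J' := hJ ▸ ⟨i, hi, rfl⟩
    obtain ⟨k, hk, h⟩ := this
    refine ⟨k, hk, hyperGerm_injOn hv.1.mem_source (hv.1.vanish _ (hσ k hk).1)
      (hv.1.vanish i hi) ?_⟩
    rw [(hσ k hk).2, h]
  refine ⟨σ, ?_⟩
  have hz : Tendsto (zeroOut J) (𝓝 (chartFun ψ J v)) (𝓝 (ψ q)) := by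
    have := (continuous_zeroOut J).tendsto (chartFun ψ J v)
    rwa [zeroOut_chartFun hv] at this
  have hb : Tendsto (fun w => ψ.symm (zeroOut J w)) (𝓝 (chartFun ψ J v)) (𝓝 q) := by
    have := (ψ.continuousAt_symm (ψ.map_source hv.1.mem_source)).tendsto.comp hz
    rwa [ψ.left_inv hv.1.mem_source] at this
  have e1 : ∀ᶠ w in 𝓝 (chartFun ψ J v), w ∈ chartTarget F ψ J :=
    (chartTarget_isOpen F ψ J).mem_nhds ((chartFun_bijOn F ψ J).mapsTo hv)
  have e2 := hb.eventually (ψ'.open_source.mem_nhds hv'.1.mem_source)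
  have e3 := hb.eventually hv'.1.nearby.eventually_nhds
  have e4 : ∀ᶠ w in 𝓝 (chartFun ψ J v), ∀ k ∈ J',
      {y : M | (ψ y).1 (σ k) = 0} =ᶠ[𝓝 (ψ.symm (zeroOut J w))] {y : M | (ψ' y).1 k = 0} := by
    refine (Filter.eventually_all_finset J').2 fun k hk => ?_
    have : {y : M | (ψ y).1 (σ k) = 0} =ᶠ[𝓝 q] {y : M | (ψ' y).1 k = 0} :=
      nhdsWithin_eq_iff_eventuallyEq.1 (hσ k hk).2
    exact hb.eventually this.eventually_nhds
  filter_upwards [e1, e2, e3, e4] with w h1 h2 h3 h4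
  set p := ψ.symm (zeroOut J w) with hp
  set v1 := (bundleChart ψ J u).symm w with hv1
  have hmem : v1 ∈ chartSource F ψ J := (bundleChart ψ J u).map_target h1
  have hval : chartFun ψ J v1 = w := (bundleChart ψ J u).right_inv h1
  have hpt : v1.point.immersion = p := by rw [immersion_eq hmem, hval]
  have hg : ∀ k ∈ J', hyperGerm ψ p (σ k) = hyperGerm ψ' p k := fun k hk =>
    nhdsWithin_eq_iff_eventuallyEq.2 (h4 k hk)
  have had : IsAdapted F ψ' J' p := by
    refine ⟨hv'.1.mem_atlas, h2, hv'.1.card_eq, fun k hk => ?_, h3⟩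
    exact ((h4 k hk).mem_iff.self_of_nhds).1 (h1.2.vanish _ (hσ k hk).1)
  have hset : hyperGerm ψ p '' J = hyperGerm ψ' p '' J' := by
    ext H
    constructor
    · rintro ⟨i, hi, rfl⟩
      obtain ⟨k, hk, rfl⟩ := hex' i hi
      exact ⟨k, hk, (hg k hk).symm⟩
    · rintro ⟨k, hk, rfl⟩
      exact ⟨σ k, (hσ k hk).1, hg k hk⟩
  have hmem' : v1 ∈ chartSource F ψ' J' := by
    refine ⟨hpt ▸ had, ?_⟩
    rw [hmem.2, hpt, hset]
  refine ⟨⟨h1, hmem'⟩, h1.1, h2, fun k => ?_⟩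
  change (chartFun ψ' J' v1).1 k = _
  rw [chartFun_apply, hpt]
  by_cases hk : k ∈ J'
  · simp only [hk, if_true]
    rw [← hg k hk]
    have := congrArg (fun x : EuclideanQuadrant n => x.1 (σ k)) hval
    simp only [chartFun_apply, (hσ k hk).1, if_true, hpt] at this
    exact this
  · simp only [hk, if_false]

/-- Each `w` in the domain of a change of coordinates comes from a vector `v`. -/
lemma exists_of_mem_source {ψ ψ' : OpenPartialHomeomorph M (EuclideanQuadrant n)}
    {J J' : Finset (Fin n)} {u u' : NormalBundle F} {w : EuclideanQuadrant n}
    (hw : w ∈ ((bundleChart ψ J u).symm.trans (bundleChart ψ' J' u')).source) :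
    ∃ v ∈ chartSource F ψ J, v ∈ chartSource F ψ' J' ∧ chartFun ψ J v = w :=
  ⟨(bundleChart ψ J u).symm w, (bundleChart ψ J u).map_target hw.1, hw.2,
    (bundleChart ψ J u).right_inv hw.1⟩

/-- The atlas of the normal bundle. -/
def bundleCore (F : OpenFace n M) : ChartedSpaceCore (EuclideanQuadrant n) (NormalBundle F) where
  atlas := {e | ∃ (ψ : OpenPartialHomeomorph M (EuclideanQuadrant n)) (J : Finset (Fin n))
    (u : NormalBundle F), ψ ∈ atlas (EuclideanQuadrant n) M ∧ e = bundleChart ψ J u}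
  chartAt v := bundleChart v.point.exists_chart.choose v.point.exists_chart.choose_spec.choose v
  mem_chart_source v := v.point.exists_chart.choose_spec.choose_spec
  chart_mem_atlas v :=
    ⟨_, _, v, v.point.exists_chart.choose_spec.choose_spec.1.mem_atlas, rfl⟩
  open_source := by
    rintro _ _ ⟨ψ, J, u, -, rfl⟩ ⟨ψ', J', u', -, rfl⟩
    rw [isOpen_iff_mem_nhds]
    intro w hw
    obtain ⟨v, hv, hv', rfl⟩ := exists_of_mem_source hw
    obtain ⟨σ, h⟩ := transition_eventually (u := u) (u' := u') hv hv'
    exact h.mono fun _ h => h.1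
  continuousOn_toFun := by
    rintro _ _ ⟨ψ, J, u, -, rfl⟩ ⟨ψ', J', u', -, rfl⟩
    intro w hw
    obtain ⟨v, hv, hv', rfl⟩ := exists_of_mem_source hw
    obtain ⟨σ, h⟩ := transition_eventually (u := u) (u' := u') hv hv'
    refine ContinuousAt.continuousWithinAt ?_
    have h0 := h.self_of_nhds
    have hb : ContinuousAt (fun w => ψ' (ψ.symm (zeroOut J w))) (chartFun ψ J v) :=
      ContinuousAt.comp (f := fun w => ψ.symm (zeroOut J w)) (ψ'.continuousAt h0.2.2.1)
        (ContinuousAt.comp (f := zeroOut J) (ψ.continuousAt_symm h0.2.1)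
          (continuous_zeroOut J).continuousAt)
    rw [(model n).isClosedEmbedding.isInducing.continuousAt_iff]
    rw [(PiLp.homeomorph 2 (fun _ : Fin n => ℝ)).isInducing.continuousAt_iff]
    refine continuousAt_pi.2 fun k => ?_
    have hk : ContinuousAt (fun w : EuclideanQuadrant n =>
        if k ∈ J' then w.1 (σ k) else (ψ' (ψ.symm (zeroOut J w))).1 k) (chartFun ψ J v) := by
      by_cases hk : k ∈ J'
      · simp only [hk, if_true]
        exact ((PiLp.continuous_apply 2 _ _).comp continuous_subtype_val).continuousAt
      · simp only [hk, if_false]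
        exact ContinuousAt.comp (f := fun w => ψ' (ψ.symm (zeroOut J w)))
          ((PiLp.continuous_apply 2 (fun _ : Fin n => ℝ) k).comp
            continuous_subtype_val).continuousAt hb
    refine hk.congr ?_
    filter_upwards [h] with w hw
    exact (hw.2.2.2 k).symm

instance (F : OpenFace n M) : TopologicalSpace (NormalBundle F) :=
  (bundleCore F).toTopologicalSpace

instance (F : OpenFace n M) : ChartedSpace (EuclideanQuadrant n) (NormalBundle F) :=
  (bundleCore F).toChartedSpace

instance (F : OpenFace n M) [IsManifold (model n) ∞ M] :
    IsManifold (model n) ∞ (NormalBundle F) := by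
  refine isManifold_of_contDiffOn _ _ _ ?_
  intro e e' he he'
  obtain ⟨_, he⟩ := mem_iUnion.1 he
  obtain ⟨⟨ψ, J, u, hψ, rfl⟩, he⟩ := mem_iUnion.1 he
  obtain rfl := mem_singleton_iff.1 he
  obtain ⟨_, he'⟩ := mem_iUnion.1 he'
  obtain ⟨⟨ψ', J', u', hψ', rfl⟩, he'⟩ := mem_iUnion.1 he'
  obtain rfl := mem_singleton_iff.1 he'
  rintro _ ⟨hx, w, rfl⟩
  rw [mem_preimage, (model n).left_inv] at hx
  obtain ⟨v, hv, hv', rfl⟩ := exists_of_mem_source (u := u) (u' := u') hx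
  obtain ⟨σ, h⟩ := transition_eventually (u := u) (u' := u') hv hv'
  have h0 := h.self_of_nhds
  set w := chartFun ψ J v with hw
  refine ContDiffWithinAt.mono ?_ inter_subset_right
  let Z : EuclideanSpace ℝ (Fin n) → EuclideanSpace ℝ (Fin n) := fun x =>
    WithLp.toLp 2 fun i => if i ∈ J then 0 else x i
  have hZ : ContDiff ℝ ∞ Z := by
    rw [contDiff_euclidean]
    intro i
    by_cases hi : i ∈ J
    · simpa [Z, hi] using contDiff_const
    · simpa [Z, hi] using contDiff_euclidean.1 contDiff_id i
  have hZI : ∀ x : EuclideanQuadrant n, Z (model n x) = model n (zeroOut J x) := fun x => rfl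
  have hcomp : ContDiffOn ℝ ∞ (model n ∘ (ψ.symm ≫ₕ ψ') ∘ (model n).symm)
      ((model n).symm ⁻¹' (ψ.symm ≫ₕ ψ').source ∩ range (model n)) :=
    ((contDiffGroupoid ∞ (model n)).compatible hψ hψ').1
  have hG : ContDiffWithinAt ℝ ∞ (fun x => (model n ∘ (ψ.symm ≫ₕ ψ') ∘ (model n).symm) (Z x))
      (range (model n)) (model n w) := by
    have hmem : model n (zeroOut J w) ∈
        (model n).symm ⁻¹' (ψ.symm ≫ₕ ψ').source ∩ range (model n) := by
      refine ⟨?_, zeroOut J w, rfl⟩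
      rw [mem_preimage, (model n).left_inv]
      exact ⟨h0.2.1, h0.2.2.1⟩
    have h1 : ContDiffWithinAt ℝ ∞ (model n ∘ (ψ.symm ≫ₕ ψ') ∘ (model n).symm)
        (range (model n)) (Z (model n w)) := by
      rw [hZI]
      refine (hcomp _ hmem).mono_of_mem_nhdsWithin (inter_mem ?_ self_mem_nhdsWithin)
      refine mem_nhdsWithin_of_mem_nhds ((model n).continuous_symm.continuousAt.preimage_mem_nhds ?_)
      rw [(model n).left_inv]
      exact (ψ.symm ≫ₕ ψ').open_source.mem_nhds ⟨h0.2.1, h0.2.2.1⟩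
    refine h1.comp (model n w) hZ.contDiffWithinAt ?_
    rintro _ ⟨y, rfl⟩
    exact ⟨zeroOut J y, rfl⟩
  have hP : ContDiffWithinAt ℝ ∞ (fun x : EuclideanSpace ℝ (Fin n) =>
      (WithLp.toLp 2 fun k => if k ∈ J' then x (σ k)
        else (model n ∘ (ψ.symm ≫ₕ ψ') ∘ (model n).symm) (Z x) k : EuclideanSpace ℝ (Fin n)))
      (range (model n)) (model n w) := by
    rw [contDiffWithinAt_euclidean]
    intro k
    by_cases hk : k ∈ J'
    · simpa [hk] using (contDiff_euclidean.1 contDiff_id (σ k)).contDiffWithinAt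
    · simpa only [hk, if_false] using contDiffWithinAt_euclidean.1 hG k
  refine hP.congr_of_eventuallyEq_of_mem ?_ ⟨w, rfl⟩
  have hev : ∀ᶠ x in 𝓝[range (model n)] (model n w), _ :=
    (((model n).continuousAt_symm (x := model n w)).tendsto.mono_left
      nhdsWithin_le_nhds).eventually (by rw [(model n).left_inv]; exact h)
  filter_upwards [hev, self_mem_nhdsWithin] with x hx hxr
  obtain ⟨y, rfl⟩ := hxr
  rw [(model n).left_inv] at hx
  ext k
  have e1 := hx.2.2.2 k
  have e2 : (model n).symm (Z (model n y)) = zeroOut J y := by rw [hZI, (model n).left_inv]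
  simp only [Function.comp, e2, (model n).left_inv]
  exact e1

end Charts

end Corners

end

noncomputable section

namespace Corners

/-! ### Smooth maps into quadrants -/

section Quadrant

variable {n : ℕ}

section Target

variable {E' H' X : Type*} [NormedAddCommGroup E'] [NormedSpace ℝ E'] [TopologicalSpace H']
  {I' : ModelWithCorners ℝ E' H'} [TopologicalSpace X] [ChartedSpace H' X]

/-! All the maps come from one object, a collar map `E`. It takes a point `q` and nonnegative
weights on the germs of hyperfaces at `q`, and pushes `q` off these hyperfaces. Near each point some
chart `φ` has to turn `E` into a translation: a coordinate of `φ` that vanishes at `q` is replaced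
by the weight of its germ, and the other coordinates are kept (`LinAt`). The map on the normal
bundle of a face then sends a vector over `q` to `E` applied to `q` and the fibre coordinates
(`collarMap`).

The properties are read off in coordinates. If the hyperfaces of a bundle chart `ψ` are numbered
like those of `φ`, the map is `φ.symm` after `halfChange`, which keeps the normal coordinates and
changes only the coordinates along the face; hence it is a local diffeomorphism. Over the open face
the base point and the weights can both be recovered from the translated coordinates, which gives
local injectivity, and a metric argument makes it global. Two faces are compatible because both maps
are translations in the same chart `φ`, and a translation for the larger face only alters some of
the normal coordinates of the smaller one.

The main work is the existence of `E` (`exists_collar`). It is built over a finite cover by charts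
and, inside a chart, face by face with the deepest faces first (`exists_extend_chart`). At each
stage (`exists_extend`) the collar already present and the translations of the new chart both fix
the face pointwise, preserve the hyperfaces through it and have positive normal derivatives. These
conditions are convex, so a cutoff function interpolates between the two. An inverse function
theorem on quadrants (`isLocalDiffeomorphAt_of_fixes_face`) makes the interpolation a change of
chart, and translations in the new chart continue `E`.

Charts can be renumbered to match because a local diffeomorphism of quadrants permutes the
hyperfaces (`IsLocalInverse.exists_perm`): its derivative has a nonnegative block whose inverse is
nonnegative too, and such a matrix is a permutation matrix up to positive factors. -/

lemma continuous_coord (i : Fin n) : Continuous fun w : EuclideanQuadrant n => w.1 i :=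
  (PiLp.continuous_apply 2 _ i).comp continuous_subtype_val

lemma continuousAt_quadrant_iff {Y : Type*} [TopologicalSpace Y] {f : Y → EuclideanQuadrant n}
    {x : Y} : ContinuousAt f x ↔ ∀ i, ContinuousAt (fun y => (f y).1 i) x := by
  refine ⟨fun h i => (continuous_coord i).continuousAt.comp h, fun h => ?_⟩
  rw [(model n).isClosedEmbedding.isInducing.continuousAt_iff,
    (PiLp.homeomorph 2 (fun _ : Fin n => ℝ)).isInducing.continuousAt_iff]
  exact continuousAt_pi.2 h

lemma contMDiff_coord (i : Fin n) :
    ContMDiff (model n) 𝓘(ℝ, ℝ) ∞ fun w : EuclideanQuadrant n => w.1 i :=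
  (EuclideanSpace.proj (𝕜 := ℝ) (ι := Fin n) i).contDiff.contMDiff.comp (model n).contMDiff

lemma contMDiffAt_quadrant_iff {f : X → EuclideanQuadrant n} {x : X} :
    ContMDiffAt I' (model n) ∞ f x ↔
      ∀ i, ContMDiffAt I' 𝓘(ℝ, ℝ) ∞ (fun y => (f y).1 i) x := by
  refine ⟨fun h i => (contMDiff_coord i).contMDiffAt.comp x h, fun h => ?_⟩
  rw [contMDiffAt_iff_target]
  refine ⟨continuousAt_quadrant_iff.2 fun i => (h i).continuousAt, ?_⟩
  have h1 : ContMDiffAt I' 𝓘(ℝ, Fin n → ℝ) ∞ (fun y i => (f y).1 i) x :=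
    contMDiffAt_pi_space.2 h
  exact (EuclideanSpace.equiv (Fin n) ℝ).symm.contDiff.contMDiff.contMDiffAt.comp x h1

lemma contMDiff_zeroOut (J : Finset (Fin n)) :
    ContMDiff (model n) (model n) ∞ (zeroOut J) := by
  intro w
  rw [contMDiffAt_quadrant_iff]
  intro i
  by_cases hi : i ∈ J
  · simpa only [zeroOut_apply, hi, if_true] using contMDiffAt_const
  · simpa only [zeroOut_apply, hi, if_false] using (contMDiff_coord i).contMDiffAt

end Target

lemma mem_range_model {x : EuclideanSpace ℝ (Fin n)} : x ∈ range (model n) ↔ ∀ i, 0 ≤ x i :=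
  ⟨by rintro ⟨w, rfl⟩; exact w.2, fun h => ⟨⟨x, h⟩, rfl⟩⟩

lemma quadrant_ext {v w : EuclideanQuadrant n} (h : ∀ i, v.1 i = w.1 i) : v = w :=
  Subtype.ext (PiLp.ext h)

/-- A self-map of the quadrant, as a map of Euclidean spaces. -/
def lift (T : EuclideanQuadrant n → EuclideanQuadrant n) (x : EuclideanSpace ℝ (Fin n)) :
    EuclideanSpace ℝ (Fin n) := (T ((model n).symm x)).1

@[simp] lemma lift_coe (T : EuclideanQuadrant n → EuclideanQuadrant n) (w : EuclideanQuadrant n) :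
    lift T w.1 = (T w).1 := by
  have : (model n).symm w.1 = w := (model n).left_inv w
  rw [lift, this]

/-- The inclusion of the quadrant is an embedding, so continuity of `T` comes for free from
continuity of its lift within the quadrant. -/
lemma contMDiffAt_iff_lift {T : EuclideanQuadrant n → EuclideanQuadrant n}
    {w : EuclideanQuadrant n} :
    ContMDiffAt (model n) (model n) ∞ T w ↔
      ContDiffWithinAt ℝ ∞ (lift T) (range (model n)) w.1 := by
  rw [contMDiffAt_iff]
  refine ⟨fun h => h.2, fun h => ⟨?_, h⟩⟩
  have h1 := h.continuousWithinAt
  rw [(model n).isClosedEmbedding.isInducing.continuousAt_iff]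
  have h2 : Tendsto (fun v : EuclideanQuadrant n => v.1) (𝓝 w) (𝓝[range (model n)] w.1) :=
    tendsto_nhdsWithin_iff.2 ⟨continuous_subtype_val.continuousAt, Eventually.of_forall fun v => ⟨v, rfl⟩⟩
  have h3 := h1.tendsto.comp h2
  simp only [Function.comp_def, lift_coe] at h3
  exact h3

/-! ### Derivatives on the quadrant and the signs of their entries. -/

/-- The derivative of a self-map of the quadrant. -/
abbrev qderiv (T : EuclideanQuadrant n → EuclideanQuadrant n) (w : EuclideanQuadrant n) :
    EuclideanSpace ℝ (Fin n) →L[ℝ] EuclideanSpace ℝ (Fin n) :=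
  fderivWithin ℝ (lift T) (range (model n)) w.1

lemma hasFDerivWithinAt_lift {T : EuclideanQuadrant n → EuclideanQuadrant n}
    {w : EuclideanQuadrant n} (h : ContMDiffAt (model n) (model n) ∞ T w) :
    HasFDerivWithinAt (lift T) (qderiv T w) (range (model n)) w.1 :=
  ((contMDiffAt_iff_lift.1 h).differentiableWithinAt (by simp)).hasFDerivWithinAt

lemma uniqueDiffOn_quadrant : UniqueDiffOn ℝ (range (model n)) := (model n).uniqueDiffOn

lemma tendsto_val_nhdsWithin (w : EuclideanQuadrant n) :
    Tendsto (fun v : EuclideanQuadrant n => v.1) (𝓝 w) (𝓝[range (model n)] w.1) :=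
  tendsto_nhdsWithin_iff.2
    ⟨continuous_subtype_val.continuousAt, Eventually.of_forall fun v => ⟨v, rfl⟩⟩

lemma eventually_lift {p : EuclideanQuadrant n → Prop} {w : EuclideanQuadrant n}
    (h : ∀ᶠ v in 𝓝 w, p v) : ∀ᶠ x in 𝓝[range (model n)] w.1, p ((model n).symm x) := by
  have := ((model n).continuousAt_symm (x := w.1)).tendsto.mono_left
    (nhdsWithin_le_nhds (s := range (model n)))
  rw [show (model n).symm w.1 = w from (model n).left_inv w] at this
  exact this.eventually h

/-- Chain rule; derivatives within the quadrant are unique also at corners. -/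
lemma hasFDerivWithinAt_comp_id {S T : EuclideanQuadrant n → EuclideanQuadrant n}
    {w : EuclideanQuadrant n} (hT : ContMDiffAt (model n) (model n) ∞ T w)
    (hS : ContMDiffAt (model n) (model n) ∞ S (T w)) (h : ∀ᶠ v in 𝓝 w, S (T v) = v) :
    (qderiv S (T w)).comp (qderiv T w) = ContinuousLinearMap.id ℝ _ := by
  have h1 := hasFDerivWithinAt_lift hT
  have h2 := hasFDerivWithinAt_lift hS
  rw [← lift_coe T w] at h2
  have h3 := h2.comp w.1 h1 (fun x _ => ⟨_, rfl⟩)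
  have h4 : HasFDerivWithinAt (lift S ∘ lift T) (ContinuousLinearMap.id ℝ _)
      (range (model n)) w.1 := by
    refine HasFDerivWithinAt.congr_of_eventuallyEq (hasFDerivWithinAt_id w.1 _) ?_ ?_
    swap
    · change lift S (lift T w.1) = w.1
      rw [lift_coe, lift_coe, h.self_of_nhds]
    filter_upwards [eventually_lift h, self_mem_nhdsWithin] with x hx hxr
    obtain ⟨y, rfl⟩ := hxr
    have e : (model n).symm (model n y) = y := (model n).left_inv y
    rw [e] at hx
    change lift S (lift T y.1) = y.1
    rw [lift_coe, lift_coe, hx]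
  exact uniqueDiffOn_quadrant.eq ⟨w, rfl⟩ h3 h4

/-- One-sided difference quotients along directions pointing into the quadrant. They carry the sign
information: where `T w` has a zero coordinate, the quotient of that coordinate is nonnegative. -/
lemma tendsto_slope_lift {T : EuclideanQuadrant n → EuclideanQuadrant n}
    {w : EuclideanQuadrant n} (hT : ContMDiffAt (model n) (model n) ∞ T w)
    {v : EuclideanSpace ℝ (Fin n)}
    (hv : ∀ᶠ t in 𝓝[>] (0 : ℝ), w.1 + t • v ∈ range (model n)) :
    Tendsto (fun t => t⁻¹ • (lift T (w.1 + t • v) - (T w).1)) (𝓝[>] (0 : ℝ))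
      (𝓝 (qderiv T w v)) := by
  have h := (hasFDerivWithinAt_lift hT).lim (l := 𝓝[>] (0 : ℝ)) (c := fun t => t⁻¹)
    (d := fun t => t • v) (v := v) ?_ hv ?_
  · simpa only [lift_coe] using h
  · exact (Continuous.tendsto' (by fun_prop) _ _ (by simp)).mono_left nhdsWithin_le_nhds
  · refine (tendsto_const_nhds (x := v)).congr' ?_
    filter_upwards [self_mem_nhdsWithin] with t ht0
    have ht0 : 0 < t := ht0
    rw [smul_smul, inv_mul_cancel₀ ht0.ne', one_smul]

lemma eventually_add_smul_mem {w : EuclideanQuadrant n} {v : EuclideanSpace ℝ (Fin n)}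
    (hv : ∀ i, w.1 i = 0 → 0 ≤ v i) : ∀ᶠ t in 𝓝[>] (0 : ℝ), w.1 + t • v ∈ range (model n) := by
  simp only [mem_range_model, PiLp.add_apply, PiLp.smul_apply, smul_eq_mul]
  rw [eventually_all]
  intro i
  rcases (w.2 i).eq_or_lt with h | h
  · filter_upwards [self_mem_nhdsWithin] with t ht0
    rw [← h, zero_add]
    exact mul_nonneg (le_of_lt ht0) (hv i h.symm)
  · have : Tendsto (fun t : ℝ => w.1 i + t * v i) (𝓝 0) (𝓝 (w.1 i)) :=
      Continuous.tendsto' (by fun_prop) _ _ (by simp)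
    exact ((this.eventually (lt_mem_nhds h)).filter_mono nhdsWithin_le_nhds).mono
      fun t ht => ht.le

/-- In the coordinates that vanish at `T w`, the derivative of `T` is nonnegative. -/
lemma qderiv_coord_nonneg {T : EuclideanQuadrant n → EuclideanQuadrant n}
    {w : EuclideanQuadrant n} (hT : ContMDiffAt (model n) (model n) ∞ T w)
    {v : EuclideanSpace ℝ (Fin n)} (hv : ∀ i, w.1 i = 0 → 0 ≤ v i) {k : Fin n}
    (hk : (T w).1 k = 0) : 0 ≤ qderiv T w v k := by
  have h := tendsto_slope_lift hT (eventually_add_smul_mem hv)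
  refine ge_of_tendsto (((PiLp.continuous_apply 2 _ k).tendsto _).comp h) ?_
  filter_upwards [self_mem_nhdsWithin] with t ht0
  have ht0 : 0 < t := ht0
  simp only [Function.comp, PiLp.smul_apply, PiLp.sub_apply, hk, sub_zero, smul_eq_mul]
  exact mul_nonneg (inv_nonneg.2 ht0.le) ((T _).2 k)

/-- The direction is tangent to the smallest face through `w`, so both `v` and `-v` point into the
quadrant and the nonnegativity applies to both. -/
lemma qderiv_coord_eq_zero {T : EuclideanQuadrant n → EuclideanQuadrant n}
    {w : EuclideanQuadrant n} (hT : ContMDiffAt (model n) (model n) ∞ T w)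
    {v : EuclideanSpace ℝ (Fin n)} (hv : ∀ i, w.1 i = 0 → v i = 0) {k : Fin n}
    (hk : (T w).1 k = 0) : qderiv T w v k = 0 := by
  refine le_antisymm ?_ (qderiv_coord_nonneg hT (fun i hi => (hv i hi).ge) hk)
  have := qderiv_coord_nonneg hT (v := -v) (fun i hi => by simp [hv i hi]) hk
  simpa using this

/-- A coordinate of the derivative in a direction in which the coordinate is affine. -/
lemma qderiv_coord_eq {T : EuclideanQuadrant n → EuclideanQuadrant n}
    {w : EuclideanQuadrant n} (hT : ContMDiffAt (model n) (model n) ∞ T w)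
    {v : EuclideanSpace ℝ (Fin n)} (hv : ∀ i, w.1 i = 0 → 0 ≤ v i) (k : Fin n) {a : ℝ}
    (h : ∀ᶠ u in 𝓝 w, ∀ t : ℝ, u.1 = w.1 + t • v → (T u).1 k = (T w).1 k + t * a) :
    qderiv T w v k = a := by
  have h1 := tendsto_slope_lift hT (eventually_add_smul_mem hv)
  refine tendsto_nhds_unique (((PiLp.continuous_apply 2 _ k).tendsto _).comp h1) ?_
  refine (tendsto_const_nhds (x := a)).congr' ?_
  have h2 : Tendsto (fun t : ℝ => w.1 + t • v) (𝓝[>] 0) (𝓝[range (model n)] w.1) :=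
    tendsto_nhdsWithin_iff.2
      ⟨(Continuous.tendsto' (by fun_prop) _ _ (by simp)).mono_left nhdsWithin_le_nhds,
        eventually_add_smul_mem hv⟩
  filter_upwards [h2.eventually (eventually_lift h), eventually_add_smul_mem hv,
    self_mem_nhdsWithin] with t ht hr ht0
  have ht0 : 0 < t := ht0
  obtain ⟨u, hu⟩ := hr
  have hu : u.1 = w.1 + t • v := hu
  rw [← hu, show (model n).symm u.1 = u from (model n).left_inv u] at ht
  simp only [Function.comp, PiLp.smul_apply, PiLp.sub_apply, smul_eq_mul]
  rw [← hu, lift_coe, ht t hu]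
  field_simp
  ring

lemma continuousAt_qderiv {T : EuclideanQuadrant n → EuclideanQuadrant n}
    {w : EuclideanQuadrant n} (hT : ContMDiffAt (model n) (model n) ∞ T w) :
    ContinuousAt (qderiv T) w := by
  have h := (contMDiffAt_iff_lift.1 hT).fderivWithin_right (m := 0) uniqueDiffOn_quadrant
    (by simp) ⟨w, rfl⟩
  exact h.continuousWithinAt.tendsto.comp (tendsto_val_nhdsWithin w)

end Quadrant

/-! ### The inverse function theorem on quadrants -/

section InverseFunction

variable {n : ℕ}

/-- In finite dimension an injective derivative is invertible. The inverse homeomorphism is then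
differentiable, its derivative is the inverse of the derivative of `e` at the preimage, and this
formula raises the regularity one order at a time. -/
lemma contMDiffAt_symm_of_injective_qderiv
    {e : OpenPartialHomeomorph (EuclideanQuadrant n) (EuclideanQuadrant n)}
    (he : ∀ w ∈ e.source, ContMDiffAt (model n) (model n) ∞ e w)
    (hinj : ∀ w ∈ e.source, Function.Injective (qderiv e w)) {y : EuclideanQuadrant n}
    (hy : y ∈ e.target) : ContMDiffAt (model n) (model n) ∞ e.symm y := by
  set s : Set (EuclideanSpace ℝ (Fin n)) := (model n).symm ⁻¹' e.source ∩ range (model n) with hs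
  set t : Set (EuclideanSpace ℝ (Fin n)) := (model n).symm ⁻¹' e.target ∩ range (model n) with ht
  have hsu : UniqueDiffOn ℝ s := (model n).uniqueDiffOn_preimage e.open_source
  have htu : UniqueDiffOn ℝ t := (model n).uniqueDiffOn_preimage e.open_target
  have hlc : ∀ w : EuclideanQuadrant n, (model n).symm w.1 = w := (model n).left_inv
  have hmem : ∀ {u : Set (EuclideanQuadrant n)}, IsOpen u → ∀ w ∈ u,
      (model n).symm ⁻¹' u ∩ range (model n) ∈ 𝓝[range (model n)] w.1 := fun hu w hw =>
    inter_mem (eventually_lift (hu.mem_nhds hw)) self_mem_nhdsWithin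
  have hcd : ContDiffOn ℝ ∞ (lift e) s := by
    rintro _ ⟨hx, w, rfl⟩
    have hx : (model n).symm w.1 ∈ e.source := hx
    rw [hlc] at hx
    exact (contMDiffAt_iff_lift.1 (he w hx)).mono inter_subset_right
  have hmaps : MapsTo (lift e.symm) t s := by
    rintro _ ⟨hx, w, rfl⟩
    have hx : (model n).symm w.1 ∈ e.target := hx
    rw [hlc] at hx
    refine ⟨?_, ⟨e.symm w, (lift_coe _ _).symm⟩⟩
    change (model n).symm (lift e.symm w.1) ∈ e.source
    rw [lift_coe, hlc]
    exact e.map_target hx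
  -- Derivatives of `lift e` are taken within `s` and those of the inverse within `t`; both sets
  -- have unique derivatives, so the corner structure causes no ambiguity in the bootstrap below.
  have hder : ∀ x ∈ t, ∃ A : EuclideanSpace ℝ (Fin n) ≃L[ℝ] EuclideanSpace ℝ (Fin n),
      fderivWithin ℝ (lift e) s (lift e.symm x) = A ∧
      HasFDerivWithinAt (lift e.symm)
        (A.symm : EuclideanSpace ℝ (Fin n) →L[ℝ] EuclideanSpace ℝ (Fin n)) t x := by
    rintro _ ⟨hx, w, rfl⟩
    have hx : (model n).symm w.1 ∈ e.target := hx
    rw [hlc] at hx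
    have hw' := e.map_target hx
    have e1 : fderivWithin ℝ (lift e) s (e.symm w).1 = qderiv e (e.symm w) :=
      ((hasFDerivWithinAt_lift (he _ hw')).mono inter_subset_right).fderivWithin
        (hsu _ ⟨by change (model n).symm (e.symm w).1 ∈ e.source; rwa [hlc], ⟨_, rfl⟩⟩)
    let A := (LinearEquiv.ofInjectiveEndo (qderiv e (e.symm w)).toLinearMap
      (hinj _ hw')).toContinuousLinearEquiv
    have hA : (A : EuclideanSpace ℝ (Fin n) →L[ℝ] EuclideanSpace ℝ (Fin n)) =
        qderiv e (e.symm w) := by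
      ext v; rfl
    refine ⟨A, ?_, ?_⟩
    · change fderivWithin ℝ (lift e) s (lift e.symm w.1) = _
      rw [lift_coe, e1, hA]
    · change HasFDerivWithinAt _ _ _ w.1
      refine HasFDerivWithinAt.mono (t := range (model n)) ?_ inter_subset_right
      refine HasFDerivWithinAt.of_local_left_inverse (f := lift e) (t := range (model n))
        ?_ ?_ ⟨w, rfl⟩ ?_
      · rw [lift_coe]
        refine (tendsto_val_nhdsWithin _).comp ((e.continuousAt_symm hx).tendsto.comp ?_)
        have := ((model n).continuousAt_symm (x := w.1)).tendsto.mono_left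
          (nhdsWithin_le_nhds (s := range (model n)))
        rwa [hlc] at this
      · rw [lift_coe, hA]
        exact hasFDerivWithinAt_lift (he _ hw')
      · filter_upwards [hmem e.open_target w hx] with x hx
        obtain ⟨hx, w', rfl⟩ := hx
        have hx : (model n).symm w'.1 ∈ e.target := hx
        rw [hlc] at hx
        change lift e (lift e.symm w'.1) = w'.1
        rw [lift_coe, lift_coe, e.right_inv hx]
  have key : ∀ k : ℕ, ContDiffOn ℝ k (lift e.symm) t := by
    intro k
    induction k with
    | zero =>
      refine contDiffOn_zero.2 fun x hx => ?_
      obtain ⟨A, -, hA⟩ := hder x hx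
      exact hA.continuousWithinAt
    | succ k ih =>
      have := (contDiffOn_succ_iff_fderivWithin (𝕜 := ℝ) (n := (k : ℕ∞ω)) (f := lift e.symm)
        htu).2 ⟨fun x hx => ?_, by simp, ?_⟩
      · exact_mod_cast this
      · obtain ⟨A, -, hA⟩ := hder x hx
        exact hA.differentiableWithinAt
      · have h1 : ContDiffOn ℝ k (fun x => ContinuousLinearMap.inverse
            (fderivWithin ℝ (lift e) s (lift e.symm x))) t := by
          intro x hx
          obtain ⟨A, hA, -⟩ := hder x hx
          have h2 : ContDiffOn ℝ k (fderivWithin ℝ (lift e) s) s :=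
            hcd.fderivWithin hsu (by exact_mod_cast le_top)
          have h3 := (h2.comp ih hmaps) x hx
          have h4 : ContDiffAt ℝ k ContinuousLinearMap.inverse
              (fderivWithin ℝ (lift e) s (lift e.symm x)) := by
            rw [hA]; exact contDiffAt_map_inverse A
          exact h4.comp_contDiffWithinAt x h3
        refine h1.congr fun x hx => ?_
        obtain ⟨A, hA, hA'⟩ := hder x hx
        rw [hA'.fderivWithin (htu x hx), hA, ContinuousLinearMap.inverse_equiv]
  rw [contMDiffAt_iff_lift]
  have h := contDiffOn_infty.2 key
  refine (h y.1 ⟨?_, y, rfl⟩).mono_of_mem_nhdsWithin (hmem e.open_target y hy)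
  change (model n).symm y.1 ∈ e.target
  rwa [hlc]

/-- Solving `h w = y` in a quadrant for a map `h` which is close to the identity and preserves
the faces. -/
lemma exists_preimage_of_close_to_id {h : EuclideanSpace ℝ (Fin n) → EuclideanSpace ℝ (Fin n)}
    {Z : Set (Fin n)} {z x y : EuclideanSpace ℝ (Fin n)} {r ρ : ℝ} (hz : ∀ k ∈ Z, z k = 0)
    (hh : ∀ u ∈ Metric.closedBall z r ∩ range (model n),
      ∀ v ∈ Metric.closedBall z r ∩ range (model n), ‖h v - h u - (v - u)‖ ≤ 1 / 2 * ‖v - u‖)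
    (hface : ∀ u ∈ Metric.closedBall z r ∩ range (model n), ∀ k ∈ Z, u k = 0 → h u k = 0)
    (hpos : ∀ u ∈ Metric.closedBall z r, ∀ k ∉ Z, 0 ≤ u k)
    (hρ : 0 ≤ ρ) (hx : x ∈ range (model n)) (hxr : Metric.closedBall x ρ ⊆ Metric.closedBall z r)
    (hy : ∀ k ∈ Z, 0 ≤ y k) (hxy : ‖h x - y‖ ≤ ρ / 4) :
    ∃ w ∈ Metric.closedBall x ρ ∩ range (model n), h w = y := by
  -- The factor `1 / 2` damps the usual iteration so that it stays in the quadrant. The contraction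
  -- constant becomes `1/2 + 1/2 · 1/2 = 3/4`, and `3ρ/4 + ρ/8 ≤ ρ` keeps the ball invariant.
  set F : EuclideanSpace ℝ (Fin n) → EuclideanSpace ℝ (Fin n) :=
    fun w => w - (1 / 2 : ℝ) • (h w - y) with hF
  set D := Metric.closedBall x ρ ∩ range (model n) with hD
  have hDS : D ⊆ Metric.closedBall z r ∩ range (model n) := inter_subset_inter_left _ hxr
  have hxD : x ∈ D := ⟨Metric.mem_closedBall_self hρ, hx⟩
  have hlip : ∀ u ∈ D, ∀ v ∈ D, ‖F v - F u‖ ≤ 3 / 4 * ‖v - u‖ := by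
    intro u hu v hv
    have e : F v - F u = (1 / 2 : ℝ) • (v - u) - (1 / 2 : ℝ) • (h v - h u - (v - u)) := by
      simp only [hF]; module
    have h1 := hh u (hDS hu) v (hDS hv)
    rw [e]
    refine (norm_sub_le _ _).trans ?_
    rw [norm_smul, norm_smul, Real.norm_of_nonneg (by norm_num)]
    linarith
  have hmaps : MapsTo F D D := by
    intro w hw
    have hball : F w ∈ Metric.closedBall x ρ := by
      have h1 := hlip x hxD w hw
      have h2 : ‖F x - x‖ ≤ ρ / 8 := by
        have : F x - x = -((1 / 2 : ℝ) • (h x - y)) := by simp only [hF]; module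
        rw [this, norm_neg, norm_smul, Real.norm_of_nonneg (by norm_num)]
        linarith
      have h3 : ‖w - x‖ ≤ ρ := by simpa [dist_eq_norm] using hw.1
      rw [mem_closedBall_iff_norm]
      calc ‖F w - x‖ = ‖(F w - F x) + (F x - x)‖ := by congr 1; abel
        _ ≤ ‖F w - F x‖ + ‖F x - x‖ := norm_add_le _ _
        _ ≤ ρ := by linarith
    refine ⟨hball, mem_range_model.2 fun k => ?_⟩
    by_cases hk : k ∈ Z
    -- Comparing `w` with its projection `w0` to the hyperface, where `h` has zero `k`-th
    -- coordinate, gives `h w k ≤ 3/2 · w k`. Hence `F w k ≥ w k / 4 + y k / 2 ≥ 0`. Since `z k =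
    -- 0`, the point `w0` is no farther from `z` than `w`.
    · have hwk : 0 ≤ w k := mem_range_model.1 hw.2 k
      set w0 : EuclideanSpace ℝ (Fin n) := w - EuclideanSpace.single k (w k) with hw0
      have hw0k : ∀ j, w0 j = if j = k then 0 else w j := by
        intro j
        by_cases hj : j = k
        · subst hj; simp [hw0]
        · simp [hw0, hj]
      have hw0S : w0 ∈ Metric.closedBall z r ∩ range (model n) := by
        refine ⟨?_, mem_range_model.2 fun j => ?_⟩
        · have h1 := (hDS hw).1
          rw [mem_closedBall_iff_norm] at h1 ⊢
          refine le_trans ?_ h1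
          rw [EuclideanSpace.norm_eq, EuclideanSpace.norm_eq]
          refine Real.sqrt_le_sqrt (Finset.sum_le_sum fun j _ => ?_)
          simp only [PiLp.sub_apply, hw0k]
          by_cases hj : j = k
          · subst hj; simp only [if_true, hz j hk]; simp; positivity
          · simp [hj]
        · rw [hw0k]
          split_ifs
          · exact le_rfl
          · exact mem_range_model.1 hw.2 j
      have h1 := hh w0 hw0S w (hDS hw)
      have h2 : w - w0 = EuclideanSpace.single k (w k) := by simp [hw0]
      rw [h2, PiLp.norm_single, Real.norm_of_nonneg hwk] at h1
      have h3 := (PiLp.norm_apply_le (h w - h w0 - EuclideanSpace.single k (w k)) k).trans h1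
      have h4 : h w0 k = 0 := hface w0 hw0S k hk (by simp [hw0k])
      simp only [PiLp.sub_apply, h4, sub_zero, PiLp.single_apply, if_true,
        Real.norm_eq_abs] at h3
      have h5 := (abs_le.1 h3).2
      have h6 := hy k hk
      have h7 : F w k = w k - 1 / 2 * (h w k - y k) := by
        simp [hF, PiLp.sub_apply, PiLp.smul_apply]
      rw [h7]
      linarith
    · exact hpos _ (hxr hball) k hk
  have hcomplete : IsComplete D := by
    refine (Metric.isClosed_closedBall.inter ?_).isComplete
    exact (model n).isClosed_range
  have hc : ContractingWith (3 / 4) (hmaps.restrict F D D) := by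
    refine ⟨by rw [← NNReal.coe_lt_coe]; norm_num, LipschitzWith.of_dist_le_mul fun u v => ?_⟩
    rw [Subtype.dist_eq, Subtype.dist_eq, dist_eq_norm, dist_eq_norm]
    simpa using hlip v.1 v.2 u.1 u.2
  obtain ⟨w, hw, hfix, -⟩ := hc.exists_fixedPoint' hcomplete hmaps hxD (edist_ne_top _ _)
  refine ⟨w, hw, ?_⟩
  have h1 : w - (1 / 2 : ℝ) • (h w - y) = w := hfix
  have h2 : (1 / 2 : ℝ) • (h w - y) = 0 := by simpa using h1
  exact sub_eq_zero.1 ((smul_eq_zero.1 h2).resolve_left (by norm_num))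

lemma apply_eq_sum_single (A : EuclideanSpace ℝ (Fin n) →L[ℝ] EuclideanSpace ℝ (Fin n))
    (v : EuclideanSpace ℝ (Fin n)) (k : Fin n) :
    A v k = ∑ l, v l * A (EuclideanSpace.single l 1) k := by
  have h : v = ∑ l, v l • EuclideanSpace.single l (1 : ℝ) := by
    ext j
    simp [Pi.single_apply]
  conv_lhs => rw [h]
  simp

lemma single_nonneg (l : Fin n) (i : Fin n) : 0 ≤ EuclideanSpace.single l (1 : ℝ) i := by
  rw [PiLp.single_apply]; split_ifs <;> norm_num

/-- The inverse function theorem on a quadrant for a map that fixes the smallest face through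
a point and preserves the hyperfaces through it. -/
theorem isLocalDiffeomorphAt_of_fixes_face {T : EuclideanQuadrant n → EuclideanQuadrant n}
    {z : EuclideanQuadrant n} (hT : ∀ᶠ w in 𝓝 z, ContMDiffAt (model n) (model n) ∞ T w)
    (hfix : ∀ᶠ w : EuclideanQuadrant n in 𝓝 z, (∀ k, z.1 k = 0 → w.1 k = 0) → T w = w)
    (hface : ∀ᶠ w : EuclideanQuadrant n in 𝓝 z, ∀ k, z.1 k = 0 → w.1 k = 0 → (T w).1 k = 0)
    (hpos : ∀ k, z.1 k = 0 → 0 < qderiv T z (EuclideanSpace.single k 1) k) :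
    IsLocalDiffeomorphAt (model n) (model n) ∞ T z := by
  have hTz := hT.self_of_nhds
  have hzfix : T z = z := hfix.self_of_nhds fun _ h => h
  have hlc : ∀ w : EuclideanQuadrant n, (model n).symm w.1 = w := (model n).left_inv
  -- The row of a vanishing coordinate `k` is diagonal: moving in a direction `l ≠ k` stays in the
  -- hyperface of `k`, which `T` preserves.
  have hLk : ∀ v k, z.1 k = 0 →
      qderiv T z v k = qderiv T z (EuclideanSpace.single k 1) k * v k := by
    intro v k hk
    rw [apply_eq_sum_single (qderiv T z), Finset.sum_eq_single k, mul_comm]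
    · intro l _ hl
      rw [qderiv_coord_eq (a := 0) hTz (fun i _ => single_nonneg l i) k, mul_zero]
      filter_upwards [hface] with u hu t htu
      rw [mul_zero, add_zero, hzfix, hk]
      refine hu k hk ?_
      rw [htu]
      simp [hk, hl.symm]
    · simp
  -- Directions along the face are fixed because `T` is the identity there. With the diagonal rows
  -- this makes the derivative block triangular with positive diagonal, hence injective.
  have hLl : ∀ l, z.1 l ≠ 0 → ∀ k, qderiv T z (EuclideanSpace.single l 1) k =
      EuclideanSpace.single l (1 : ℝ) k := by
    intro l hl k
    refine qderiv_coord_eq hTz (fun i _ => single_nonneg l i) k ?_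
    filter_upwards [hfix] with u hu t htu
    rw [hu, hzfix, htu]
    · simp
    · intro i hi
      have : i ≠ l := fun h => hl (h ▸ hi)
      rw [htu]
      simp [hi, this]
  have hinj : Function.Injective (qderiv T z) := by
    rw [injective_iff_map_eq_zero]
    intro v hv
    have h1 : ∀ k, z.1 k = 0 → v k = 0 := by
      intro k hk
      have h2 := hLk v k hk
      rw [hv] at h2
      exact (mul_eq_zero.1 h2.symm).resolve_left (hpos k hk).ne'
    ext k
    by_cases hk : z.1 k = 0
    · exact h1 k hk
    · have h2 := apply_eq_sum_single (qderiv T z) v k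
      rw [hv, Finset.sum_eq_single k] at h2
      · rw [hLl k hk] at h2
        simpa using h2.symm
      · intro l _ hl
        by_cases hl0 : z.1 l = 0
        · rw [h1 l hl0, zero_mul]
        · rw [hLl l hl0]; simp [hl.symm]
      · simp
  let A := (LinearEquiv.ofInjectiveEndo (qderiv T z).toLinearMap hinj).toContinuousLinearEquiv
  have hA : (A : EuclideanSpace ℝ (Fin n) →L[ℝ] EuclideanSpace ℝ (Fin n)) = qderiv T z := by
    ext v; rfl
  have hAk : ∀ v k, z.1 k = 0 →
      qderiv T z (EuclideanSpace.single k 1) k * A.symm v k = v k := by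
    intro v k hk
    rw [← hLk _ k hk, ← hA]
    simp
  -- After normalization the derivative at `z` is the identity. By `hAk`, `A.symm` rescales each
  -- vanishing coordinate by a positive factor, so `h` still preserves hyperfaces, and the signs of
  -- these coordinates survive.
  set h : EuclideanSpace ℝ (Fin n) → EuclideanSpace ℝ (Fin n) := fun x => A.symm (lift T x) with hh
  have hcont : ContinuousAt (fun w => ‖(A.symm : EuclideanSpace ℝ (Fin n) →L[ℝ] EuclideanSpace ℝ (Fin n)).comp (qderiv T w) -
      ContinuousLinearMap.id ℝ (EuclideanSpace ℝ (Fin n))‖) z := by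
    refine ContinuousAt.norm (ContinuousAt.sub ?_ continuousAt_const)
    exact continuousAt_const.clm_comp (continuousAt_qderiv hTz)
  have hsmall : ∀ᶠ w in 𝓝 z, ‖(A.symm : EuclideanSpace ℝ (Fin n) →L[ℝ] EuclideanSpace ℝ (Fin n)).comp (qderiv T w) -
      ContinuousLinearMap.id ℝ (EuclideanSpace ℝ (Fin n))‖ < 1 / 2 := by
    refine hcont.eventually_lt continuousAt_const ?_
    rw [← hA, ContinuousLinearEquiv.coe_symm_comp_coe]
    simp
  -- Near `z` only the coordinates vanishing at `z` constrain membership in the quadrant.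
  have hposn : ∀ᶠ x : EuclideanSpace ℝ (Fin n) in 𝓝 z.1, ∀ k, z.1 k ≠ 0 → 0 ≤ x k := by
    rw [eventually_all]
    intro k
    by_cases hk : z.1 k = 0
    · simp [hk]
    · have : 0 < z.1 k := lt_of_le_of_ne (z.2 k) (Ne.symm hk)
      filter_upwards [(PiLp.continuous_apply 2 (fun _ : Fin n => ℝ) k).continuousAt.eventually
        (lt_mem_nhds this)] with x hx _
      exact hx.le
  have hall : ∀ᶠ x in 𝓝[range (model n)] z.1, _ :=
    eventually_lift (hT.and (hsmall.and hface))
  rw [eventually_nhdsWithin_iff] at hall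
  obtain ⟨r, hr0, hr⟩ := Metric.nhds_basis_closedBall.eventually_iff.1 (hall.and hposn)
  set S := Metric.closedBall z.1 r ∩ range (model n) with hS
  have hSp : ∀ w : EuclideanQuadrant n, w.1 ∈ Metric.closedBall z.1 r → _ := fun w hw =>
    (hr hw).1 ⟨w, rfl⟩
  simp only [hlc] at hSp
  have hclose : ∀ u ∈ S, ∀ v ∈ S, ‖h v - h u - (v - u)‖ ≤ 1 / 2 * ‖v - u‖ := by
    intro u hu v hv
    have hconv : Convex ℝ S := (convex_closedBall _ _).inter (model n).convex_range
    refine hconv.norm_image_sub_le_of_norm_hasFDerivWithin_le'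
      (f' := fun x => (A.symm : EuclideanSpace ℝ (Fin n) →L[ℝ] EuclideanSpace ℝ (Fin n)).comp (qderiv T ((model n).symm x)))
      (φ := ContinuousLinearMap.id ℝ _) ?_ ?_ hu hv
    · rintro _ ⟨hx, w, rfl⟩
      have e : (model n).symm (model n w) = w := (model n).left_inv w
      rw [e]
      exact ((A.symm : EuclideanSpace ℝ (Fin n) →L[ℝ] EuclideanSpace ℝ (Fin n)).hasFDerivAt.comp_hasFDerivWithinAt _
        (hasFDerivWithinAt_lift (hSp w hx).1)).mono inter_subset_right
    · rintro _ ⟨hx, w, rfl⟩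
      have e : (model n).symm (model n w) = w := (model n).left_inv w
      rw [e]
      exact (hSp w hx).2.1.le
  have hhface : ∀ u ∈ S, ∀ k ∈ {k | z.1 k = 0}, u k = 0 → h u k = 0 := by
    rintro _ ⟨hx, w, rfl⟩ k hk hwk
    have h1 := hAk (lift T w.1) k hk
    rw [lift_coe, (hSp w hx).2.2 k hk hwk] at h1
    have h2 : A.symm (T w).1 k = 0 := (mul_eq_zero.1 h1).resolve_left (hpos k hk).ne'
    change A.symm (lift T w.1) k = 0
    rwa [lift_coe]
  set O : Set (EuclideanQuadrant n) := {w | w.1 ∈ Metric.ball z.1 r} with hO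
  have hOo : IsOpen O := Metric.isOpen_ball.preimage continuous_subtype_val
  have hOS : ∀ w ∈ O, w.1 ∈ S := fun w hw => ⟨Metric.ball_subset_closedBall hw, w, rfl⟩
  have hTinj : InjOn T O := by
    intro u hu v hv huv
    have h1 := hclose u.1 (hOS u hu) v.1 (hOS v hv)
    have h2 : h v.1 = h u.1 := by simp only [hh, lift_coe, huv]
    rw [h2, sub_self, zero_sub, norm_neg] at h1
    have h3 : ‖v.1 - u.1‖ = 0 := by linarith [norm_nonneg (v.1 - u.1)]
    exact (Subtype.ext (sub_eq_zero.1 (norm_eq_zero.1 h3))).symm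
  have hqinj : ∀ w ∈ O, Function.Injective (qderiv T w) := by
    intro w hw
    rw [injective_iff_map_eq_zero]
    intro v hv
    have h1 := ((A.symm : EuclideanSpace ℝ (Fin n) →L[ℝ] EuclideanSpace ℝ (Fin n)).comp (qderiv T w) -
      ContinuousLinearMap.id ℝ (EuclideanSpace ℝ (Fin n))).le_of_opNorm_le
      (hSp w (hOS w hw).1).2.1.le v
    have h2 : ((A.symm : EuclideanSpace ℝ (Fin n) →L[ℝ] EuclideanSpace ℝ (Fin n)).comp (qderiv T w) -
      ContinuousLinearMap.id ℝ (EuclideanSpace ℝ (Fin n))) v = -v := by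
      simp [hv]
    rw [h2, norm_neg] at h1
    exact norm_eq_zero.1 (by linarith [norm_nonneg v])
  -- Openness relative to the quadrant: every nearby target has a preimage inside the quadrant,
  -- found by the damped iteration.
  have hopen : ∀ w ∈ O, ∀ U ∈ 𝓝 w, T '' U ∈ 𝓝 (T w) := by
    intro w hw U hU
    obtain ⟨V, hV, hVU⟩ := (mem_nhds_induced Subtype.val w U).1 hU
    obtain ⟨ρ, hρ, hρV⟩ := Metric.nhds_basis_closedBall.mem_iff.1
      (inter_mem hV (Metric.isOpen_ball.mem_nhds hw))
    have hc : Tendsto (fun y : EuclideanQuadrant n => ‖h w.1 - A.symm y.1‖) (𝓝 (T w)) (𝓝 0) := by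
      refine Continuous.tendsto' ?_ _ _ ?_
      · exact (continuous_const.sub (A.symm.continuous.comp continuous_subtype_val)).norm
      · simp [hh]
    filter_upwards [hc.eventually (gt_mem_nhds (show (0 : ℝ) < ρ / 4 by linarith))] with y hy
    obtain ⟨u, ⟨hu1, u', rfl⟩, hu⟩ := exists_preimage_of_close_to_id (Z := {k | z.1 k = 0})
      (z := z.1) (x := w.1) (y := A.symm y.1) (r := r) (ρ := ρ) (h := h) (fun k hk => hk)
      hclose hhface (fun u hu k hk => (hr hu).2 k hk) hρ.le ⟨w, rfl⟩
      (fun u hu => Metric.ball_subset_closedBall (hρV hu).2)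
      (fun k hk => by
        have h1 := hAk y.1 k hk
        by_contra hneg
        have := mul_neg_of_pos_of_neg (hpos k hk) (not_le.1 hneg)
        linarith [y.2 k]) hy.le
    refine ⟨u', hVU (hρV hu1).1, ?_⟩
    have h1 : A.symm (lift T u'.1) = A.symm y.1 := hu
    rw [lift_coe] at h1
    exact Subtype.ext (A.symm.injective h1)
  have hTO : ∀ w ∈ O, ContMDiffAt (model n) (model n) ∞ T w := fun w hw => (hSp w (hOS w hw).1).1
  let e : OpenPartialHomeomorph (EuclideanQuadrant n) (EuclideanQuadrant n) :=
    OpenPartialHomeomorph.ofContinuousOpenRestrict (hTinj.toPartialEquiv T O)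
      (fun w hw => (hTO w hw).continuousAt.continuousWithinAt)
      (by
        refine IsOpenMap.of_nhds_le fun w U hU => ?_
        have hw : w.1 ∈ O := w.2
        have h1 : Subtype.val '' ((O.domRestrict T) ⁻¹' U) ∈ 𝓝 w.1 :=
          hOo.isOpenEmbedding_subtypeVal.image_mem_nhds.2 hU
        filter_upwards [hopen w hw _ h1] with y hy
        obtain ⟨_, ⟨u, hu, rfl⟩, rfl⟩ := hy
        exact hu) hOo
  exact ⟨{ e with
      contMDiffOn_toFun := fun w hw => (hTO w hw).contMDiffWithinAt
      contMDiffOn_invFun := fun y hy => (contMDiffAt_symm_of_injective_qderiv (e := e) hTO hqinj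
        hy).contMDiffWithinAt }, Metric.mem_ball_self hr0, fun w _ => rfl⟩

end InverseFunction

/-! ### Local diffeomorphisms -/

section LocalDiffeo

variable {E₁ H₁ X E₂ H₂ Y : Type*} [NormedAddCommGroup E₁] [NormedSpace ℝ E₁]
  [TopologicalSpace H₁] {I₁ : ModelWithCorners ℝ E₁ H₁} [TopologicalSpace X] [ChartedSpace H₁ X]
  [NormedAddCommGroup E₂] [NormedSpace ℝ E₂] [TopologicalSpace H₂]
  {I₂ : ModelWithCorners ℝ E₂ H₂} [TopologicalSpace Y] [ChartedSpace H₂ Y]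

lemma isLocalDiffeomorphAt_of_local_inverse {f : X → Y} {g : Y → X} {x : X}
    (hf : ∀ᶠ x' in 𝓝 x, ContMDiffAt I₁ I₂ ∞ f x')
    (hg : ∀ᶠ y in 𝓝 (f x), ContMDiffAt I₂ I₁ ∞ g y)
    (hgf : ∀ᶠ x' in 𝓝 x, g (f x') = x') (hfg : ∀ᶠ y in 𝓝 (f x), f (g y) = y) :
    IsLocalDiffeomorphAt I₁ I₂ ∞ f x := by
  obtain ⟨U, hU, hUo, hxU⟩ := eventually_nhds_iff.1 (hf.and hgf)
  obtain ⟨V, hV, hVo, hxV⟩ := eventually_nhds_iff.1 (hg.and hfg)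
  have hfc : ContinuousOn f U := fun x hx => (hU x hx).1.continuousAt.continuousWithinAt
  have hgc : ContinuousOn g V := fun x hx => (hV x hx).1.continuousAt.continuousWithinAt
  exact ⟨{
    toFun := f
    invFun := g
    source := U ∩ f ⁻¹' V
    target := V ∩ g ⁻¹' U
    map_source' := fun x hx => ⟨hx.2, by rw [mem_preimage, (hU x hx.1).2]; exact hx.1⟩
    map_target' := fun y hy => ⟨hy.2, by rw [mem_preimage, (hV y hy.1).2]; exact hy.1⟩
    left_inv' := fun x hx => (hU x hx.1).2
    right_inv' := fun y hy => (hV y hy.1).2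
    open_source := hfc.isOpen_inter_preimage hUo hVo
    open_target := hgc.isOpen_inter_preimage hVo hUo
    contMDiffOn_toFun := fun x hx => (hU x hx.1).1.contMDiffWithinAt
    contMDiffOn_invFun := fun y hy => (hV y hy.1).1.contMDiffWithinAt }, ⟨hxU, hxV⟩,
    fun _ _ => rfl⟩

lemma eventually_isLocalDiffeomorphAt {f : X → Y} {x : X}
    (h : IsLocalDiffeomorphAt I₁ I₂ ∞ f x) :
    ∀ᶠ x' in 𝓝 x, IsLocalDiffeomorphAt I₁ I₂ ∞ f x' := by
  obtain ⟨Φ, hx, h⟩ := h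
  filter_upwards [Φ.open_source.mem_nhds hx] with x' hx'
  exact ⟨Φ, hx', h⟩

lemma image_mem_nhds_of_isLocalDiffeomorphAt {f : X → Y} {x : X}
    (h : IsLocalDiffeomorphAt I₁ I₂ ∞ f x) {U : Set X} (hU : U ∈ 𝓝 x) : f '' U ∈ 𝓝 (f x) := by
  obtain ⟨Φ, hx, h⟩ := h
  have h1 := Φ.toOpenPartialHomeomorph.image_mem_nhds hx
    (inter_mem hU (Φ.open_source.mem_nhds hx))
  have e : ∀ y ∈ Φ.source, Φ.toOpenPartialHomeomorph y = f y := fun y hy => (h hy).symm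
  rw [e x hx] at h1
  filter_upwards [h1] with y hy
  obtain ⟨u, hu, rfl⟩ := hy
  exact ⟨u, hu.1, (e u hu.2).symm⟩

/-- A local diffeomorphism is open, so injectivity on `Ω` yields a homeomorphism onto an open image;
its inverse is smooth because it agrees locally with the local inverses. -/
lemma exists_partialDiffeomorph_of_injOn [Nonempty X] {f : X → Y} {Ω : Set X} (hΩ : IsOpen Ω)
    (hinj : InjOn f Ω) (hf : ∀ x ∈ Ω, IsLocalDiffeomorphAt I₁ I₂ ∞ f x) :
    ∃ Φ : PartialDiffeomorph I₁ I₂ X Y ∞, Φ.source = Ω ∧ ∀ x, Φ x = f x := by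
  let e : OpenPartialHomeomorph X Y :=
    OpenPartialHomeomorph.ofContinuousOpenRestrict (hinj.toPartialEquiv f Ω)
      (fun w hw => (hf w hw).contMDiffAt.continuousAt.continuousWithinAt)
      (by
        refine IsOpenMap.of_nhds_le fun w U hU => ?_
        have h1 : Subtype.val '' ((Ω.domRestrict f) ⁻¹' U) ∈ 𝓝 w.1 :=
          hΩ.isOpenEmbedding_subtypeVal.image_mem_nhds.2 hU
        filter_upwards [image_mem_nhds_of_isLocalDiffeomorphAt (hf w.1 w.2) h1] with y hy
        obtain ⟨_, ⟨u, hu, rfl⟩, rfl⟩ := hy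
        exact hu) hΩ
  have he : ∀ x, e x = f x := fun _ => rfl
  refine ⟨{ e with
      contMDiffOn_toFun := fun w hw => (hf w hw).contMDiffAt.contMDiffWithinAt
      contMDiffOn_invFun := ?_ }, rfl, he⟩
  rintro y (hy : y ∈ e.target)
  change ContMDiffWithinAt I₂ I₁ ∞ e.symm e.target y
  have hx := e.map_target hy
  obtain ⟨Φ, hxΦ, hΦ⟩ := hf (e.symm y) hx
  have hyx : Φ (e.symm y) = y := by rw [← hΦ hxΦ, ← he, e.right_inv hy]
  have hyΦ : y ∈ Φ.target := by
    have := Φ.map_source hxΦ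
    rwa [show Φ.toPartialEquiv (e.symm y) = y from hyx] at this
  have h1 : ContMDiffAt I₂ I₁ ∞ Φ.symm y :=
    (Φ.contMDiffOn_invFun y hyΦ).contMDiffAt (Φ.open_target.mem_nhds hyΦ)
  refine (h1.congr_of_eventuallyEq ?_).contMDiffWithinAt
  have h2 : Φ.symm y = e.symm y := by
    have := Φ.left_inv hxΦ
    rwa [show Φ.toPartialEquiv (e.symm y) = y from hyx] at this
  -- Once the local inverse takes values in `Ω`, injectivity forces it to equal `e.symm`.
  have h3 : ∀ᶠ y' in 𝓝 y, Φ.symm y' ∈ Ω :=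
    h1.continuousAt.eventually (hΩ.mem_nhds (h2 ▸ hx))
  filter_upwards [h3, Φ.open_target.mem_nhds hyΦ] with y' hy1 hy2
  have h4 : f (Φ.symm y') = y' := (hΦ (Φ.map_target hy2)).trans (Φ.right_inv hy2)
  have h5 : e.symm (e (Φ.symm y')) = Φ.symm y' := e.left_inv hy1
  rwa [he, h4] at h5

end LocalDiffeo

/-! ### Changes of coordinates permute the hyperfaces -/

section Permute

variable {n : ℕ}

/-- A nonnegative matrix with nonnegative inverse is monomial. Since `(AB)ₖₖ = 1`, some `i` has `Aₖᵢ
Bᵢₖ ≠ 0`. For `l ≠ i` the entry `(BA)ᵢₗ = 0` is a sum of nonnegative terms, among them `Bᵢₖ Aₖₗ`, so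
`Aₖₗ = 0`. -/
lemma exists_unique_pos_entry {A B : EuclideanSpace ℝ (Fin n) →L[ℝ] EuclideanSpace ℝ (Fin n)}
    {Z Z' : Set (Fin n)} (hAB : A.comp B = ContinuousLinearMap.id ℝ _)
    (hBA : B.comp A = ContinuousLinearMap.id ℝ _)
    (hA : ∀ k ∈ Z', ∀ l, 0 ≤ A (EuclideanSpace.single l 1) k)
    (hA0 : ∀ k ∈ Z', ∀ l ∉ Z, A (EuclideanSpace.single l 1) k = 0)
    (hB : ∀ k ∈ Z, ∀ l, 0 ≤ B (EuclideanSpace.single l 1) k)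
    (hB0 : ∀ k ∈ Z, ∀ l ∉ Z', B (EuclideanSpace.single l 1) k = 0) {k : Fin n} (hk : k ∈ Z') :
    ∃ i ∈ Z, 0 < A (EuclideanSpace.single i 1) k ∧ 0 < B (EuclideanSpace.single k 1) i ∧
      ∀ l ≠ i, A (EuclideanSpace.single l 1) k = 0 := by
  have h1 : ∀ k k', ∑ l, B (EuclideanSpace.single k' 1) l * A (EuclideanSpace.single l 1) k =
      EuclideanSpace.single k' (1 : ℝ) k := by
    intro k k'
    rw [← apply_eq_sum_single, ← ContinuousLinearMap.comp_apply, hAB]; rfl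
  have h2 : ∀ k k', ∑ l, A (EuclideanSpace.single k' 1) l * B (EuclideanSpace.single l 1) k =
      EuclideanSpace.single k' (1 : ℝ) k := by
    intro k k'
    rw [← apply_eq_sum_single, ← ContinuousLinearMap.comp_apply, hBA]; rfl
  have h3 := h1 k k
  rw [PiLp.single_apply, if_pos rfl] at h3
  obtain ⟨i, -, hi⟩ := Finset.exists_ne_zero_of_sum_ne_zero (h3.trans_ne one_ne_zero)
  have hiZ : i ∈ Z := by
    by_contra h
    exact hi (by rw [hA0 k hk i h, mul_zero])
  have hAi := (hA k hk i).lt_of_ne (right_ne_zero_of_mul hi).symm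
  have hBi := (hB i hiZ k).lt_of_ne (left_ne_zero_of_mul hi).symm
  refine ⟨i, hiZ, hAi, hBi, fun l hl => ?_⟩
  have h4 := h2 i l
  rw [PiLp.single_apply, if_neg hl.symm] at h4
  have h5 : ∀ m ∈ Finset.univ, 0 ≤ A (EuclideanSpace.single l 1) m *
      B (EuclideanSpace.single m 1) i := by
    intro m _
    by_cases hm : m ∈ Z'
    · exact mul_nonneg (hA m hm l) (hB i hiZ m)
    · rw [hB0 i hiZ m hm, mul_zero]
  have h6 := (Finset.sum_eq_zero_iff_of_nonneg h5).1 h4 k (Finset.mem_univ k)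
  exact (mul_eq_zero.1 h6).resolve_right hBi.ne'

/-! ### Smooth local inverses and the permutation of hyperfaces. -/

/-- `S` is a smooth local inverse of `T` near `w`. -/
structure IsLocalInverse (T S : EuclideanQuadrant n → EuclideanQuadrant n)
    (w : EuclideanQuadrant n) : Prop where
  smooth : ∀ᶠ v in 𝓝 w, ContMDiffAt (model n) (model n) ∞ T v
  smooth_inv : ∀ᶠ v in 𝓝 (T w), ContMDiffAt (model n) (model n) ∞ S v
  left_inv : ∀ᶠ v in 𝓝 w, S (T v) = v
  right_inv : ∀ᶠ v in 𝓝 (T w), T (S v) = v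

namespace IsLocalInverse

variable {T S : EuclideanQuadrant n → EuclideanQuadrant n} {w : EuclideanQuadrant n}

lemma symm (h : IsLocalInverse T S w) : IsLocalInverse S T (T w) :=
  ⟨h.smooth_inv, by rw [h.left_inv.self_of_nhds]; exact h.smooth, h.right_inv,
    by rw [h.left_inv.self_of_nhds]; exact h.left_inv⟩

lemma tendsto (h : IsLocalInverse T S w) : Tendsto T (𝓝 w) (𝓝 (T w)) :=
  h.smooth.self_of_nhds.continuousAt

lemma eventually (h : IsLocalInverse T S w) : ∀ᶠ v in 𝓝 w, IsLocalInverse T S v := by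
  filter_upwards [h.smooth.eventually_nhds, h.left_inv.eventually_nhds,
    h.tendsto.eventually h.smooth_inv.eventually_nhds,
    h.tendsto.eventually h.right_inv.eventually_nhds] with v h1 h2 h3 h4
  exact ⟨h1, h3, h2, h4⟩

lemma congr {T' : EuclideanQuadrant n → EuclideanQuadrant n} (h : IsLocalInverse T S w)
    (hT : ∀ᶠ v in 𝓝 w, T' v = T v) : IsLocalInverse T' S w := by
  have hw := hT.self_of_nhds
  have hS : Tendsto S (𝓝 (T w)) (𝓝 w) := by
    have := h.symm.tendsto
    rwa [h.left_inv.self_of_nhds] at this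
  refine ⟨?_, by rw [hw]; exact h.smooth_inv, ?_, ?_⟩
  · filter_upwards [hT.eventually_nhds, h.smooth] with v h1 h2
    exact h2.congr_of_eventuallyEq h1
  · filter_upwards [hT, h.left_inv] with v h1 h2
    rw [h1, h2]
  · rw [hw]
    filter_upwards [hS.eventually hT, h.right_inv] with v h1 h2
    rw [h1, h2]

lemma comp {T' S' : EuclideanQuadrant n → EuclideanQuadrant n} (h' : IsLocalInverse T' S' (T w))
    (h : IsLocalInverse T S w) :
    IsLocalInverse (fun v => T' (T v)) (fun v => S (S' v)) w := by
  have hS' : Tendsto S' (𝓝 (T' (T w))) (𝓝 (T w)) := by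
    have := h'.symm.tendsto
    rwa [h'.left_inv.self_of_nhds] at this
  constructor
  · filter_upwards [h.smooth, h.tendsto.eventually h'.smooth] with v h1 h2
    exact h2.comp v h1
  · filter_upwards [h'.smooth_inv, hS'.eventually h.smooth_inv] with v h1 h2
    exact h2.comp v h1
  · filter_upwards [h.left_inv, h.tendsto.eventually h'.left_inv] with v h1 h2
    rw [h2, h1]
  · filter_upwards [h'.right_inv, hS'.eventually h.right_inv] with v h1 h2
    rw [h2, h1]

lemma isLocalDiffeomorphAt (h : IsLocalInverse T S w) :
    IsLocalDiffeomorphAt (model n) (model n) ∞ T w :=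
  isLocalDiffeomorphAt_of_local_inverse h.smooth h.smooth_inv h.left_inv h.right_inv

/-- The rows of the two derivatives that belong to vanishing coordinates are nonnegative and involve
only vanishing coordinates, so the matrix lemma applies to them. -/
lemma exists_entry (h : IsLocalInverse T S w) {k : Fin n} (hk : (T w).1 k = 0) :
    ∃ i, w.1 i = 0 ∧ 0 < qderiv T w (EuclideanSpace.single i 1) k ∧
      0 < qderiv S (T w) (EuclideanSpace.single k 1) i ∧
      ∀ l ≠ i, qderiv T w (EuclideanSpace.single l 1) k = 0 := by
  have hT := h.smooth.self_of_nhds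
  have hS := h.smooth_inv.self_of_nhds
  have hST : S (T w) = w := h.left_inv.self_of_nhds
  have hTS : (qderiv T w).comp (qderiv S (T w)) = ContinuousLinearMap.id ℝ _ := by
    have := hasFDerivWithinAt_comp_id (S := T) (T := S) hS (by rwa [hST]) h.right_inv
    rwa [hST] at this
  refine exists_unique_pos_entry (Z := {i | w.1 i = 0}) (Z' := {k | (T w).1 k = 0}) hTS
    (hasFDerivWithinAt_comp_id hT hS h.left_inv) ?_ ?_ ?_ ?_ hk
  · exact fun k hk l => qderiv_coord_nonneg hT (fun i _ => single_nonneg l i) hk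
  · refine fun k hk l hl => qderiv_coord_eq_zero hT (fun i hi => ?_) hk
    have : i ≠ l := fun h => hl (h ▸ hi)
    simp [this]
  · exact fun k hk l => qderiv_coord_nonneg hS (fun i _ => single_nonneg l i)
      (by rw [hST]; exact hk)
  · refine fun k hk l hl => qderiv_coord_eq_zero hS (fun i hi => ?_) (by rw [hST]; exact hk)
    have : i ≠ l := fun h => hl (h ▸ hi)
    simp [this]

lemma continuousAt_entry {T : EuclideanQuadrant n → EuclideanQuadrant n}
    {w : EuclideanQuadrant n} (hT : ContMDiffAt (model n) (model n) ∞ T w) (i k : Fin n) :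
    ContinuousAt (fun v => qderiv T v (EuclideanSpace.single i 1) k) w :=
  (PiLp.continuous_apply 2 (fun _ : Fin n => ℝ) k).continuousAt.comp
    ((continuousAt_qderiv hT).clm_apply continuousAt_const)

/-- A local diffeomorphism of the quadrant maps hyperfaces to hyperfaces. -/
lemma exists_perm (h : IsLocalInverse T S w) :
    ∃ σ : Equiv.Perm (Fin n), ∀ᶠ v in 𝓝 w, ∀ k, (T v).1 k = 0 ↔ v.1 (σ k) = 0 := by
  have hST : S (T w) = w := h.left_inv.self_of_nhds
  choose! i hi0 hiA hiB hi using fun k (hk : (T w).1 k = 0) => h.exists_entry hk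
  -- The positive entries at `(k, i k)` persist near `w`. If the `k`-th coordinate of `T v`
  -- vanishes, row `k` at `v` has a single nonzero entry, in the column of a coordinate vanishing at
  -- `v`; this column must be `i k`. The converse uses `S` in the same way.
  have hnear : ∀ k, (T w).1 k = 0 → ∀ᶠ v in 𝓝 w, ((T v).1 k = 0 ↔ v.1 (i k) = 0) := by
    intro k hk
    have c1 := (continuousAt_entry h.smooth.self_of_nhds (i k) k).eventually
      (lt_mem_nhds (hiA k hk))
    have c2 := h.tendsto.eventually ((continuousAt_entry h.smooth_inv.self_of_nhds k
      (i k)).eventually (lt_mem_nhds (hiB k hk)))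
    filter_upwards [h.eventually, c1, c2] with v hv h1 h2
    have hSv : S (T v) = v := hv.left_inv.self_of_nhds
    constructor
    · intro h0
      obtain ⟨j, hj0, -, -, hj⟩ := hv.exists_entry h0
      by_cases hij : i k = j
      · rw [hij, hj0]
      · exact absurd (hj _ hij) h1.ne'
    · intro h0
      obtain ⟨j, hj0, -, -, hj⟩ := hv.symm.exists_entry (k := i k) (by rw [hSv, h0])
      by_cases hkj : k = j
      · rw [hkj, hj0]
      · exact absurd (hj _ hkj) h2.ne'
  have hinj : ∀ k k', (T w).1 k = 0 → (T w).1 k' = 0 → i k = i k' → k = k' := by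
    intro k k' hk hk' e
    obtain ⟨j, -, -, -, hj⟩ := h.symm.exists_entry (k := i k) (by rw [hST, hi0 k hk])
    have e1 : k = j := by
      by_contra hne
      exact (hiB k hk).ne' (hj k hne)
    have e2 : k' = j := by
      by_contra hne
      have := hiB k' hk'
      rw [← e] at this
      exact this.ne' (hj k' hne)
    rw [e1, e2]
  have hsurj : ∀ l, w.1 l = 0 → ∃ k, (T w).1 k = 0 ∧ i k = l := by
    intro l hl
    obtain ⟨k, hk0, -, hk, -⟩ := h.symm.exists_entry (k := l) (by rw [hST, hl])
    rw [hST] at hk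
    refine ⟨k, hk0, ?_⟩
    by_contra hne
    exact hk.ne' (hi k hk0 l (Ne.symm hne))
  let e : {k // (T w).1 k = 0} ≃ {l // w.1 l = 0} :=
    Equiv.ofBijective (fun k => ⟨i k.1, hi0 k.1 k.2⟩)
      ⟨fun a b hab => Subtype.ext (hinj _ _ a.2 b.2 (congrArg Subtype.val hab)),
        fun l => by
          obtain ⟨k, hk, hkl⟩ := hsurj l.1 l.2
          exact ⟨⟨k, hk⟩, Subtype.ext hkl⟩⟩
  -- Off the vanishing coordinates any extension to a permutation will do, since there both sides
  -- are nonzero near `w`.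
  refine ⟨e.extendSubtype, eventually_all.2 fun k => ?_⟩
  by_cases hk : (T w).1 k = 0
  · rw [Equiv.extendSubtype_apply_of_mem e k hk]
    exact hnear k hk
  · have h1 : w.1 (e.extendSubtype k) ≠ 0 := e.extendSubtype_not_mem k hk
    filter_upwards [((continuous_coord k).continuousAt.comp h.tendsto).eventually_ne hk,
      (continuous_coord _).continuousAt.eventually_ne h1] with v h2 h3
    exact iff_of_false h2 h3

end IsLocalInverse

lemma tendsto_symm {M : Type*} [TopologicalSpace M]
    {φ : OpenPartialHomeomorph M (EuclideanQuadrant n)} {p : M}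
    (hp : p ∈ φ.source) : Tendsto φ.symm (𝓝 (φ p)) (𝓝 p) := by
  have := φ.continuousAt_symm (φ.map_source hp)
  rwa [ContinuousAt, φ.left_inv hp] at this

variable {M : Type*} [TopologicalSpace M] [ChartedSpace (EuclideanQuadrant n) M]

lemma isLocalInverse_coordChange {φ ψ : OpenPartialHomeomorph M (EuclideanQuadrant n)}
    [IsManifold (model n) ∞ M] (hφ : φ ∈ IsManifold.maximalAtlas (model n) ∞ M)
    (hψ : ψ ∈ IsManifold.maximalAtlas (model n) ∞ M) {p : M} (hpφ : p ∈ φ.source)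
    (hpψ : p ∈ ψ.source) :
    IsLocalInverse (fun w => ψ (φ.symm w)) (fun w => φ (ψ.symm w)) (φ p) := by
  have hp : ψ (φ.symm (φ p)) = ψ p := by rw [φ.left_inv hpφ]
  have h1 := (tendsto_symm hpφ).eventually (ψ.open_source.mem_nhds hpψ)
  have h2 := (tendsto_symm hpψ).eventually (φ.open_source.mem_nhds hpφ)
  have h3 := φ.open_target.mem_nhds (φ.map_source hpφ)
  have h4 := ψ.open_target.mem_nhds (ψ.map_source hpψ)
  constructor
  · filter_upwards [h1, h3] with v hv1 hv3
    exact (contMDiffAt_of_mem_maximalAtlas hψ hv1).comp v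
      (contMDiffAt_symm_of_mem_maximalAtlas hφ hv3)
  · rw [hp]
    filter_upwards [h2, h4] with v hv1 hv3
    exact (contMDiffAt_of_mem_maximalAtlas hφ hv1).comp v
      (contMDiffAt_symm_of_mem_maximalAtlas hψ hv3)
  · filter_upwards [h1, h3] with v hv1 hv3
    simp only [ψ.left_inv hv1, φ.right_inv hv3]
  · rw [hp]
    filter_upwards [h2, h4] with v hv1 hv3
    simp only [φ.left_inv hv1, ψ.right_inv hv3]

/-- A change of charts permutes the local hyperfaces. -/
lemma exists_perm_hyperfaces [IsManifold (model n) ∞ M]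
    {φ ψ : OpenPartialHomeomorph M (EuclideanQuadrant n)}
    (hφ : φ ∈ IsManifold.maximalAtlas (model n) ∞ M)
    (hψ : ψ ∈ IsManifold.maximalAtlas (model n) ∞ M) {p : M} (hpφ : p ∈ φ.source)
    (hpψ : p ∈ ψ.source) :
    ∃ σ : Equiv.Perm (Fin n), ∀ᶠ q in 𝓝 p, ∀ k, (ψ q).1 k = 0 ↔ (φ q).1 (σ k) = 0 := by
  obtain ⟨σ, h⟩ := (isLocalInverse_coordChange hφ hψ hpφ hpψ).exists_perm
  refine ⟨σ, ?_⟩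
  filter_upwards [(φ.continuousAt hpφ).eventually h, φ.open_source.mem_nhds hpφ] with q hq hqs
  rwa [φ.left_inv hqs] at hq

end Permute

/-! ### Collar maps -/

section Collar

variable {n : ℕ}

/-- The permutation `σ` of the coordinates of the quadrant. -/
def permQuadrant (σ : Equiv.Perm (Fin n)) : EuclideanQuadrant n ≃ₜ EuclideanQuadrant n where
  toFun w := ⟨WithLp.toLp 2 fun k => w.1 (σ k), fun k => w.2 (σ k)⟩
  invFun w := ⟨WithLp.toLp 2 fun k => w.1 (σ.symm k), fun k => w.2 (σ.symm k)⟩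
  left_inv w := quadrant_ext fun k => by simp
  right_inv w := quadrant_ext fun k => by simp
  continuous_toFun := continuous_iff_continuousAt.2 fun w =>
    continuousAt_quadrant_iff.2 fun k => (continuous_coord (σ k)).continuousAt
  continuous_invFun := continuous_iff_continuousAt.2 fun w =>
    continuousAt_quadrant_iff.2 fun k => (continuous_coord (σ.symm k)).continuousAt

lemma contMDiff_permQuadrant (σ : Equiv.Perm (Fin n)) :
    ContMDiff (model n) (model n) ∞ (permQuadrant σ) := fun _ =>
  contMDiffAt_quadrant_iff.2 fun k => (contMDiff_coord (σ k)).contMDiffAt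

lemma contMDiff_permQuadrant_symm (σ : Equiv.Perm (Fin n)) :
    ContMDiff (model n) (model n) ∞ (permQuadrant σ).symm := fun _ =>
  contMDiffAt_quadrant_iff.2 fun k => (contMDiff_coord (σ.symm k)).contMDiffAt

section Topological

variable {M : Type*} [TopologicalSpace M]

/-- Near `p`, the coordinates of `φ` and `ψ` vanish at the same points. -/
def Matched (φ ψ : OpenPartialHomeomorph M (EuclideanQuadrant n)) (p : M) : Prop :=
  ∀ᶠ q in 𝓝 p, ∀ k, (φ q).1 k = 0 ↔ (ψ q).1 k = 0

lemma Matched.symm {φ ψ : OpenPartialHomeomorph M (EuclideanQuadrant n)} {p : M}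
    (h : Matched φ ψ p) : Matched ψ φ p := h.mono fun _ h k => (h k).symm

lemma Matched.hyperGerm_eq {φ ψ : OpenPartialHomeomorph M (EuclideanQuadrant n)} {p : M}
    (h : Matched φ ψ p) (k : Fin n) : hyperGerm φ p k = hyperGerm ψ p k :=
  nhdsWithin_eq_iff_eventuallyEq.2 (h.mono fun _ h => propext (h k))

/-- Translation of the point `q` by the weights `c` on the germs of hyperfaces at `q`, in the
chart `φ`. -/
def shift (φ : OpenPartialHomeomorph M (EuclideanQuadrant n)) (q : M) (c : Filter M → NNReal) :
    EuclideanQuadrant n :=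
  ⟨WithLp.toLp 2 fun i => if (φ q).1 i = 0 then (c (hyperGerm φ q i) : ℝ) else (φ q).1 i,
    fun i => by
      by_cases h : (φ q).1 i = 0
      · simp [h]
      · simpa [h] using (φ q).2 i⟩

lemma shift_apply (φ : OpenPartialHomeomorph M (EuclideanQuadrant n)) (q : M)
    (c : Filter M → NNReal) (i : Fin n) : (shift φ q c).1 i =
      if (φ q).1 i = 0 then (c (hyperGerm φ q i) : ℝ) else (φ q).1 i := rfl

/-- Coordinates in which the coordinates along the face `{i | i ∉ J}` are those of `φ`, and the
normal coordinates are those of `ψ`. -/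
def halfChange (φ ψ : OpenPartialHomeomorph M (EuclideanQuadrant n)) (J : Finset (Fin n))
    (w : EuclideanQuadrant n) : EuclideanQuadrant n :=
  ⟨WithLp.toLp 2 fun i => if i ∈ J then w.1 i else (φ (ψ.symm (zeroOut J w))).1 i, fun i => by
    by_cases h : i ∈ J
    · simpa [h] using w.2 i
    · simpa [h] using (φ _).2 i⟩

lemma halfChange_apply (φ ψ : OpenPartialHomeomorph M (EuclideanQuadrant n))
    (J : Finset (Fin n)) (w : EuclideanQuadrant n) (i : Fin n) :
    (halfChange φ ψ J w).1 i = if i ∈ J then w.1 i else (φ (ψ.symm (zeroOut J w))).1 i := rfl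

/-- A vector of normal coordinates, as a family of weights on germs of hyperfaces. -/
def weights (ψ : OpenPartialHomeomorph M (EuclideanQuadrant n)) (J : Finset (Fin n)) (q : M)
    (w : EuclideanQuadrant n) (H : Filter M) : NNReal :=
  open Classical in ∑ i ∈ J, if hyperGerm ψ q i = H then (w.1 i).toNNReal else 0

lemma weights_of_mem {ψ : OpenPartialHomeomorph M (EuclideanQuadrant n)} {J : Finset (Fin n)}
    {q : M} (hq : q ∈ ψ.source) (hJ : ∀ i ∈ J, (ψ q).1 i = 0) (w : EuclideanQuadrant n)
    {i : Fin n} (hi : i ∈ J) : (weights ψ J q w (hyperGerm ψ q i) : ℝ) = w.1 i := by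
  rw [weights, Finset.sum_eq_single i]
  · rw [if_pos rfl, Real.coe_toNNReal _ (w.2 i)]
  · intro k hk hki
    exact if_neg fun h => hki (hyperGerm_injOn hq (hJ k hk) (hJ i hi) h)
  · exact fun h => absurd hi h

lemma weights_of_notMem {ψ : OpenPartialHomeomorph M (EuclideanQuadrant n)} {J : Finset (Fin n)}
    {q : M} (hq : q ∈ ψ.source) (hJ : ∀ i ∈ J, (ψ q).1 i = 0) (w : EuclideanQuadrant n)
    {i : Fin n} (hi : i ∉ J) (hi0 : (ψ q).1 i = 0) : weights ψ J q w (hyperGerm ψ q i) = 0 := by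
  refine Finset.sum_eq_zero fun k hk => if_neg fun h => hi ?_
  rwa [← hyperGerm_injOn hq (hJ k hk) hi0 h]

lemma weights_le (ψ : OpenPartialHomeomorph M (EuclideanQuadrant n)) (J : Finset (Fin n)) (q : M)
    (w : EuclideanQuadrant n) (H : Filter M) : (weights ψ J q w H : ℝ) ≤ ∑ i ∈ J, w.1 i := by
  rw [weights, NNReal.coe_sum]
  refine Finset.sum_le_sum fun i _ => ?_
  by_cases h : hyperGerm ψ q i = H
  · rw [if_pos h, Real.coe_toNNReal _ (w.2 i)]
  · rw [if_neg h]; exact w.2 i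

lemma zeroOut_eq_self {J : Finset (Fin n)} {w : EuclideanQuadrant n} (h : ∀ i ∈ J, w.1 i = 0) :
    zeroOut J w = w := by
  refine quadrant_ext fun i => ?_
  rw [zeroOut_apply]
  split_ifs with hi
  · exact (h i hi).symm
  · rfl

/-- This links translations to bundle coordinates: if only the germs in `J` carry weight,
translating `q` in `φ` puts the weights in the slots of `J` and leaves the `φ`-coordinates of `q` in
the others. -/
lemma shift_eq_halfChange {φ ψ : OpenPartialHomeomorph M (EuclideanQuadrant n)} {q : M}
    {J : Finset (Fin n)} {c : Filter M → NNReal} {w : EuclideanQuadrant n} (hq : q ∈ ψ.source)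
    (hm : Matched φ ψ q) (hw : zeroOut J w = ψ q)
    (hc : ∀ i ∈ J, (c (hyperGerm ψ q i) : ℝ) = w.1 i)
    (hc0 : ∀ i ∉ J, (ψ q).1 i = 0 → c (hyperGerm ψ q i) = 0) :
    shift φ q c = halfChange φ ψ J w := by
  refine quadrant_ext fun i => ?_
  rw [shift_apply, halfChange_apply, hw, ψ.left_inv hq, hm.hyperGerm_eq]
  have hmi := hm.self_of_nhds i
  by_cases hi : i ∈ J
  · have h0 : (ψ q).1 i = 0 := by rw [← hw, zeroOut_apply, if_pos hi]
    rw [if_pos (hmi.2 h0), if_pos hi, hc i hi]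
  · rw [if_neg hi]
    split_ifs with h
    · rw [hc0 i hi (hmi.1 h), h]; rfl
    · rfl

/-- If the labels match, then the base point of `halfChange` in the chart `φ` is the same. -/
lemma zeroOut_halfChange {φ ψ : OpenPartialHomeomorph M (EuclideanQuadrant n)}
    {J : Finset (Fin n)} {w : EuclideanQuadrant n} (hw : zeroOut J w ∈ ψ.target)
    (hm : ∀ k, (φ (ψ.symm (zeroOut J w))).1 k = 0 ↔ (ψ (ψ.symm (zeroOut J w))).1 k = 0) :
    zeroOut J (halfChange φ ψ J w) = φ (ψ.symm (zeroOut J w)) := by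
  refine quadrant_ext fun i => ?_
  rw [zeroOut_apply, halfChange_apply]
  split_ifs with hi
  · rw [eq_comm, hm, ψ.right_inv hw, zeroOut_apply, if_pos hi]
  · rfl

lemma eventually_base {ψ : OpenPartialHomeomorph M (EuclideanQuadrant n)} {p : M}
    {J : Finset (Fin n)} {w : EuclideanQuadrant n} (hpψ : p ∈ ψ.source)
    (hw : zeroOut J w = ψ p) {P : M → Prop}
    (hP : ∀ᶠ q in 𝓝 p, P q) :
    ∀ᶠ v in 𝓝 w, zeroOut J v ∈ ψ.target ∧ P (ψ.symm (zeroOut J v)) := by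
  have hz : Tendsto (zeroOut J) (𝓝 w) (𝓝 (ψ p)) := hw ▸ (continuous_zeroOut J).tendsto w
  exact (hz.eventually (ψ.open_target.mem_nhds (ψ.map_source hpψ))).and
    (((tendsto_symm hpψ).comp hz).eventually hP)

lemma halfChange_left_inv {φ ψ : OpenPartialHomeomorph M (EuclideanQuadrant n)}
    {J : Finset (Fin n)} {w : EuclideanQuadrant n}
    (h1 : zeroOut J w ∈ ψ.target) (h2 : ψ.symm (zeroOut J w) ∈ φ.source)
    (hm : ∀ k, (φ (ψ.symm (zeroOut J w))).1 k = 0 ↔ (ψ (ψ.symm (zeroOut J w))).1 k = 0) :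
    halfChange ψ φ J (halfChange φ ψ J w) = w := by
  refine quadrant_ext fun i => ?_
  rw [halfChange_apply, zeroOut_halfChange h1 hm, φ.left_inv h2, ψ.right_inv h1, zeroOut_apply,
    halfChange_apply]
  split_ifs <;> rfl

lemma halfChange_base {φ ψ : OpenPartialHomeomorph M (EuclideanQuadrant n)} {J : Finset (Fin n)} {p : M}
    (hp : p ∈ ψ.source) (hm : Matched φ ψ p)
    (hJ : ∀ i ∈ J, (ψ p).1 i = 0) : halfChange φ ψ J (ψ p) = φ p := by
  refine quadrant_ext fun i => ?_
  rw [halfChange_apply, zeroOut_eq_self hJ, ψ.left_inv hp]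
  split_ifs with hi
  · rw [hJ i hi, (hm.self_of_nhds i).2 (hJ i hi)]
  · rfl
end Topological

variable {M : Type*} [TopologicalSpace M] [ChartedSpace (EuclideanQuadrant n) M]

section HalfChange

variable {φ ψ : OpenPartialHomeomorph M (EuclideanQuadrant n)} {p : M}
  {J : Finset (Fin n)} {w : EuclideanQuadrant n}

lemma contMDiffAt_halfChange (hφ : φ ∈ IsManifold.maximalAtlas (model n) ∞ M)
    (hψ : ψ ∈ IsManifold.maximalAtlas (model n) ∞ M)
    (h1 : zeroOut J w ∈ ψ.target) (h2 : ψ.symm (zeroOut J w) ∈ φ.source) :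
    ContMDiffAt (model n) (model n) ∞ (halfChange φ ψ J) w := by
  rw [contMDiffAt_quadrant_iff]
  intro i
  simp only [halfChange_apply]
  by_cases hi : i ∈ J
  · simpa only [hi, if_true] using (contMDiff_coord i).contMDiffAt
  · simp only [hi, if_false]
    have h3 : ContMDiffAt (model n) (model n) ∞ (fun w => ψ.symm (zeroOut J w)) w :=
      (contMDiffAt_symm_of_mem_maximalAtlas hψ h1).comp w (contMDiff_zeroOut J).contMDiffAt
    have h4 : ContMDiffAt (model n) (model n) ∞ (fun w => φ (ψ.symm (zeroOut J w))) w :=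
      (contMDiffAt_of_mem_maximalAtlas hφ h2).comp w h3
    exact (contMDiff_coord i).contMDiffAt.comp w h4

/-- Matching of the labels makes `zeroOut J` of the image the `φ`-coordinates of the same base
point. The base point can thus be recovered, and exchanging `φ` and `ψ` gives the inverse. -/
lemma isLocalInverse_halfChange [IsManifold (model n) ∞ M]
    (hφ : φ ∈ IsManifold.maximalAtlas (model n) ∞ M)
    (hψ : ψ ∈ IsManifold.maximalAtlas (model n) ∞ M) (hpφ : p ∈ φ.source) (hpψ : p ∈ ψ.source)
    (hm : Matched φ ψ p) (hw : zeroOut J w = ψ p) :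
    IsLocalInverse (halfChange φ ψ J) (halfChange ψ φ J) w := by
  have hw' : zeroOut J (halfChange φ ψ J w) = φ p := by
    have e : ψ.symm (zeroOut J w) = p := by rw [hw, ψ.left_inv hpψ]
    rw [zeroOut_halfChange, e]
    · rw [hw]; exact ψ.map_source hpψ
    · rw [e]; exact hm.self_of_nhds
  have h1 := eventually_base hpψ hw ((φ.open_source.eventually_mem hpφ).and hm)
  have h2 := eventually_base hpφ hw' ((ψ.open_source.eventually_mem hpψ).and hm.symm)
  exact ⟨h1.mono fun v hv => contMDiffAt_halfChange hφ hψ hv.1 hv.2.1,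
    h2.mono fun v hv => contMDiffAt_halfChange hψ hφ hv.1 hv.2.1,
    h1.mono fun v hv => halfChange_left_inv hv.1 hv.2.1 hv.2.2,
    h2.mono fun v hv => halfChange_left_inv hv.1 hv.2.1 hv.2.2⟩

end HalfChange

/-- Near `p` the collar map `E` is given by translations in the chart `φ`, for weights up to
`δ`. -/
structure LinAt (E : M → (Filter M → NNReal) → M)
    (φ : OpenPartialHomeomorph M (EuclideanQuadrant n)) (δ : ℝ) (p : M) : Prop where
  mem_maximalAtlas : φ ∈ IsManifold.maximalAtlas (model n) ∞ M
  mem_source : p ∈ φ.source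
  eq_shift : ∀ᶠ q in 𝓝 p, ∀ c : Filter M → NNReal, (∀ H, (c H : ℝ) ≤ δ) →
    shift φ q c ∈ φ.target ∧ E q c = φ.symm (shift φ q c)

variable (n) in
/-- The points near which the collar map `E` is given by translations in a chart. -/
def Good (E : M → (Filter M → NNReal) → M) : Set M :=
  {p | ∃ (φ : OpenPartialHomeomorph M (EuclideanQuadrant n)) (δ : ℝ), 0 < δ ∧ LinAt E φ δ p}

namespace LinAt

variable {E : M → (Filter M → NNReal) → M} {φ ψ : OpenPartialHomeomorph M (EuclideanQuadrant n)}
  {δ : ℝ} {p : M}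

lemma eventually (h : LinAt E φ δ p) : ∀ᶠ q in 𝓝 p, LinAt E φ δ q := by
  filter_upwards [h.eq_shift.eventually_nhds, φ.open_source.mem_nhds h.mem_source] with q h1 h2
  exact ⟨h.mem_maximalAtlas, h2, h1⟩

lemma mono {δ' : ℝ} (h : LinAt E φ δ p) (hδ : δ' ≤ δ) : LinAt E φ δ' p :=
  ⟨h.mem_maximalAtlas, h.mem_source,
    h.eq_shift.mono fun _ h c hc => h c fun H => (hc H).trans hδ⟩

lemma congr {E' : M → (Filter M → NNReal) → M} (h : LinAt E φ δ p)
    (hE : ∀ᶠ q in 𝓝 p, E' q = E q) : LinAt E' φ δ p :=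
  ⟨h.mem_maximalAtlas, h.mem_source, by
    filter_upwards [h.eq_shift, hE] with q h1 h2 c hc
    rw [h2]
    exact h1 c hc⟩

/-- Weights are attached to germs and not to indices, so translations do not notice a renumbering of
the coordinates. -/
lemma perm [IsManifold (model n) ∞ M] (h : LinAt E φ δ p) (σ : Equiv.Perm (Fin n)) :
    LinAt E (φ.transHomeomorph (permQuadrant σ)) δ p := by
  refine ⟨?_, h.mem_source, ?_⟩
  · refine OpenPartialHomeomorph.mem_maximalAtlas_of_contMDiffOn _ ?_ ?_
    · exact (contMDiff_permQuadrant σ).comp_contMDiffOn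
        (contMDiffOn_of_mem_maximalAtlas h.mem_maximalAtlas)
    · exact (contMDiffOn_symm_of_mem_maximalAtlas h.mem_maximalAtlas).comp
        (contMDiff_permQuadrant_symm σ).contMDiffOn fun _ hx => hx
  · refine h.eq_shift.mono fun q hq c hc => ?_
    have e : (permQuadrant σ).symm (shift (φ.transHomeomorph (permQuadrant σ)) q c) =
        shift φ q c := by
      rw [Homeomorph.symm_apply_eq]
      rfl
    obtain ⟨h1, h2⟩ := hq c hc
    refine ⟨?_, ?_⟩
    · change (permQuadrant σ).symm _ ∈ φ.target
      rwa [e]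
    · change _ = φ.symm ((permQuadrant σ).symm _)
      rw [e, h2]

/-- The linearizing chart may be assumed to number its hyperfaces like any given chart. -/
lemma exists_matched [IsManifold (model n) ∞ M] (h : LinAt E φ δ p)
    (hψ : ψ ∈ IsManifold.maximalAtlas (model n) ∞ M) (hp : p ∈ ψ.source) :
    ∃ φ' : OpenPartialHomeomorph M (EuclideanQuadrant n), LinAt E φ' δ p ∧ Matched φ' ψ p := by
  obtain ⟨σ, hσ⟩ := exists_perm_hyperfaces h.mem_maximalAtlas hψ h.mem_source hp
  exact ⟨_, h.perm σ, hσ.mono fun q hq k => (hq k).symm⟩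

end LinAt

lemma isOpen_good (E : M → (Filter M → NNReal) → M) : IsOpen (Good n E) := by
  rw [isOpen_iff_mem_nhds]
  rintro p ⟨φ, δ, hδ, h⟩
  filter_upwards [h.eventually] with q hq
  exact ⟨φ, δ, hδ, hq⟩

/-- The collar of the face `{ψᵢ = 0, i ∈ J}` given by `E`, in the chart `ψ`. -/
def collar (E : M → (Filter M → NNReal) → M)
    (ψ : OpenPartialHomeomorph M (EuclideanQuadrant n)) (J : Finset (Fin n))
    (w : EuclideanQuadrant n) : EuclideanQuadrant n :=
  ψ (E (ψ.symm (zeroOut J w)) (weights ψ J (ψ.symm (zeroOut J w)) w))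

section CollarLemmas

variable {E : M → (Filter M → NNReal) → M}
  {φ ψ : OpenPartialHomeomorph M (EuclideanQuadrant n)} {δ : ℝ} {p : M} {J : Finset (Fin n)}

/-- The coordinates in `J` vanish at `ψ p`, so near it the weights are below `δ` and `E` is a
translation in `φ`. The collar in `ψ` is thus `halfChange` followed by a change of charts. -/
lemma eventually_collar_eq (h : LinAt E φ δ p) (hδ : 0 < δ) (hp : p ∈ ψ.source)
    (hm : Matched φ ψ p) (hJ : ∀ i ∈ J, (ψ p).1 i = 0) :
    ∀ᶠ w in 𝓝 (ψ p), collar E ψ J w = ψ (φ.symm (halfChange φ ψ J w)) := by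
  have hw : zeroOut J (ψ p) = ψ p := zeroOut_eq_self hJ
  have hsmall : ∀ᶠ w : EuclideanQuadrant n in 𝓝 (ψ p), ∑ i ∈ J, w.1 i < δ := by
    refine Tendsto.eventually_lt_const (v := ∑ i ∈ J, (ψ p).1 i) ?_
      ((continuous_finsetSum J fun i _ => continuous_coord i).tendsto _)
    rwa [Finset.sum_eq_zero hJ]
  filter_upwards [eventually_base hp hw (h.eq_shift.and
    (hm.eventually_nhds.and (ψ.open_source.mem_nhds hp))), hsmall] with w hw1 hw2
  obtain ⟨h1, h2, h3, h4⟩ := hw1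
  have hbase := ψ.right_inv h1
  have hJ' : ∀ i ∈ J, (ψ (ψ.symm (zeroOut J w))).1 i = 0 := fun i hi => by
    rw [hbase, zeroOut_apply, if_pos hi]
  have hE := (h2 (weights ψ J (ψ.symm (zeroOut J w)) w)
    fun H => (weights_le _ _ _ _ H).trans hw2.le).2
  rw [collar, hE, shift_eq_halfChange (w := w) (J := J) h4 h3 hbase.symm
    (fun i hi => weights_of_mem h4 hJ' w hi) fun i hi hi0 => weights_of_notMem h4 hJ' w hi hi0]

lemma isLocalInverse_collar [IsManifold (model n) ∞ M] (h : LinAt E φ δ p) (hδ : 0 < δ)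
    (hψ : ψ ∈ IsManifold.maximalAtlas (model n) ∞ M) (hp : p ∈ ψ.source)
    (hm : Matched φ ψ p) (hJ : ∀ i ∈ J, (ψ p).1 i = 0) :
    ∃ S, IsLocalInverse (collar E ψ J) S (ψ p) := by
  have hw : zeroOut J (ψ p) = ψ p := zeroOut_eq_self hJ
  have h1 := isLocalInverse_halfChange (J := J) h.mem_maximalAtlas hψ h.mem_source hp hm hw
  have h2 := isLocalInverse_coordChange h.mem_maximalAtlas hψ h.mem_source hp
  have e := halfChange_base hp hm hJ
  rw [← e] at h2
  exact ⟨_, (h2.comp h1).congr (eventually_collar_eq h hδ hp hm hJ)⟩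

/-- The collar maps preserve the hyperfaces. -/
lemma eventually_collar_coord_eq_zero [IsManifold (model n) ∞ M] (h : LinAt E φ δ p) (hδ : 0 < δ)
    (hψ : ψ ∈ IsManifold.maximalAtlas (model n) ∞ M) (hp : p ∈ ψ.source)
    (hm : Matched φ ψ p) (hJ : ∀ i ∈ J, (ψ p).1 i = 0) :
    ∀ᶠ w in 𝓝 (ψ p), ∀ i ∈ J, w.1 i = 0 → (collar E ψ J w).1 i = 0 := by
  have hw : zeroOut J (ψ p) = ψ p := zeroOut_eq_self hJ
  have h1 := isLocalInverse_halfChange (J := J) h.mem_maximalAtlas hψ h.mem_source hp hm hw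
  have e := halfChange_base hp hm hJ
  have h2 : Tendsto (halfChange φ ψ J) (𝓝 (ψ p)) (𝓝 (φ p)) := e ▸ h1.tendsto
  have h3 := ((tendsto_symm h.mem_source).comp h2).eventually hm
  filter_upwards [eventually_collar_eq h hδ hp hm hJ, h3,
    h2.eventually (φ.open_target.mem_nhds (φ.map_source h.mem_source))] with w e1 e2 e3 i hi hi0
  simp only [Function.comp] at e2
  rw [e1, ← e2, φ.right_inv e3, halfChange_apply, if_pos hi, hi0]

lemma eventually_collar_fixes (h : LinAt E φ δ p) (hδ : 0 < δ) (hp : p ∈ ψ.source)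
    (hm : Matched φ ψ p) (hJ : ∀ i ∈ J, (ψ p).1 i = 0) :
    ∀ᶠ w : EuclideanQuadrant n in 𝓝 (ψ p), (∀ i ∈ J, w.1 i = 0) → collar E ψ J w = w := by
  have h1 := (tendsto_symm hp).eventually (hm.and (φ.open_source.mem_nhds h.mem_source))
  filter_upwards [eventually_collar_eq h hδ hp hm hJ, h1,
    ψ.open_target.mem_nhds (ψ.map_source hp)] with w e1 e2 e3 hw
  have e : halfChange φ ψ J w = φ (ψ.symm w) := by
    refine quadrant_ext fun i => ?_
    rw [halfChange_apply, zeroOut_eq_self hw]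
    split_ifs with hi
    · rw [eq_comm, hw i hi, e2.1, ψ.right_inv e3, hw i hi]
    · rfl
  rw [e1, e, φ.left_inv e2.2, ψ.right_inv e3]

end CollarLemmas

end Collar

/-! ### Extension of collar maps -/

section Extend

variable {n : ℕ}

lemma exists_box {w : EuclideanQuadrant n} {U : Set (EuclideanQuadrant n)} (hU : U ∈ 𝓝 w) :
    ∃ η > 0, ∀ v : EuclideanQuadrant n, (∀ i, |v.1 i - w.1 i| < η) → v ∈ U := by
  have hind : IsInducing fun (v : EuclideanQuadrant n) i => v.1 i :=
    (PiLp.homeomorph 2 (fun _ : Fin n => ℝ)).isInducing.comp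
      (model n).isClosedEmbedding.isInducing
  rw [hind.nhds_eq_comap, mem_comap] at hU
  obtain ⟨V, hV, hVU⟩ := hU
  obtain ⟨η, hη, h⟩ := Metric.mem_nhds_iff.1 hV
  refine ⟨η, hη, fun v hv => hVU (h ?_)⟩
  rw [Metric.mem_ball, dist_pi_lt_iff hη]
  exact fun i => hv i

/-- A translation alters only coordinates that are zero at `q`. Half of the box size bounds the
distance from `q` to `p`, the other half the weight. -/
lemma exists_eventually_shift_mem {M : Type*} [TopologicalSpace M]
    {φ : OpenPartialHomeomorph M (EuclideanQuadrant n)} {p : M}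
    (hp : p ∈ φ.source) {U : Set (EuclideanQuadrant n)} (hU : U ∈ 𝓝 (φ p)) :
    ∃ δ > 0, ∀ᶠ q in 𝓝 p, ∀ c : Filter M → NNReal, (∀ H, (c H : ℝ) ≤ δ) →
      shift φ q c ∈ U := by
  obtain ⟨η, hη, h⟩ := exists_box hU
  have h1 : ∀ᶠ q in 𝓝 p, ∀ i, |(φ q).1 i - (φ p).1 i| < η / 2 := by
    rw [eventually_all]
    intro i
    have : ContinuousAt (fun q => (φ q).1 i) p :=
      (continuous_coord i).continuousAt.comp (φ.continuousAt hp)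
    exact this.eventually (Metric.ball_mem_nhds _ (half_pos hη))
  refine ⟨η / 2, half_pos hη, h1.mono fun q hq c hc => h _ fun i => ?_⟩
  have h2 := hq i
  rw [shift_apply]
  split_ifs with h0
  · rw [h0] at h2
    have h3 := hc (hyperGerm φ q i)
    have h4 : (0 : ℝ) ≤ c (hyperGerm φ q i) := NNReal.coe_nonneg _
    rw [abs_lt] at h2 ⊢
    constructor <;> linarith
  · linarith

variable {M : Type*} [TopologicalSpace M]

/-- The interpolation, in the chart `ψ`, between the collar given by `E` and the collar given by
translations. -/
def blend (χ : M → ℝ) (E : M → (Filter M → NNReal) → M)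
    (ψ : OpenPartialHomeomorph M (EuclideanQuadrant n)) (J : Finset (Fin n))
    (w : EuclideanQuadrant n) : EuclideanQuadrant n :=
  (model n).symm ((1 - χ (ψ.symm (zeroOut J w))) • w.1 +
    χ (ψ.symm (zeroOut J w)) • (collar E ψ J w).1)

section Blend

variable {χ : M → ℝ} {E : M → (Filter M → NNReal) → M}
  {ψ : OpenPartialHomeomorph M (EuclideanQuadrant n)} {J : Finset (Fin n)}

/-- The quadrant is convex, so the retraction `(model n).symm` in the definition does nothing. -/
lemma blend_apply (hχ : ∀ q, χ q ∈ Icc (0 : ℝ) 1) (w : EuclideanQuadrant n) (i : Fin n) :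
    (blend χ E ψ J w).1 i = (1 - χ (ψ.symm (zeroOut J w))) * w.1 i +
      χ (ψ.symm (zeroOut J w)) * (collar E ψ J w).1 i := by
  have h := hχ (ψ.symm (zeroOut J w))
  change max _ (0 : ℝ) = _
  refine max_eq_left (add_nonneg (mul_nonneg (by linarith [h.2]) (w.2 i))
    (mul_nonneg h.1 ((collar E ψ J w).2 i)))

lemma blend_eq_collar (hχ : ∀ q, χ q ∈ Icc (0 : ℝ) 1) {w : EuclideanQuadrant n}
    (h : χ (ψ.symm (zeroOut J w)) = 1) : blend χ E ψ J w = collar E ψ J w :=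
  quadrant_ext fun i => by rw [blend_apply hχ, h]; ring

lemma blend_eq_self (hχ : ∀ q, χ q ∈ Icc (0 : ℝ) 1) {w : EuclideanQuadrant n}
    (h : χ (ψ.symm (zeroOut J w)) = 0) : blend χ E ψ J w = w :=
  quadrant_ext fun i => by rw [blend_apply hχ, h]; ring

end Blend

lemma isLocalInverse_id (w : EuclideanQuadrant n) : IsLocalInverse id id w :=
  ⟨Eventually.of_forall fun _ => contMDiffAt_id, Eventually.of_forall fun _ => contMDiffAt_id,
    Eventually.of_forall fun _ => rfl, Eventually.of_forall fun _ => rfl⟩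

variable [ChartedSpace (EuclideanQuadrant n) M] {p : M}
  {χ : M → ℝ} {E : M → (Filter M → NNReal) → M}
  {ψ : OpenPartialHomeomorph M (EuclideanQuadrant n)} {J : Finset (Fin n)}

/-- The identity and the collar both satisfy the hypotheses of the inverse function theorem on the
quadrant, and these are preserved by convex combinations. -/
lemma isLocalDiffeomorphAt_blend_of_linAt [IsManifold (model n) ∞ M]
    (hχs : ContMDiff (model n) 𝓘(ℝ, ℝ) ∞ χ)
    (hχ : ∀ q, χ q ∈ Icc (0 : ℝ) 1) (hψ : ψ ∈ IsManifold.maximalAtlas (model n) ∞ M)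
    (hp : p ∈ ψ.source) (hJ : ∀ i, (ψ p).1 i = 0 ↔ i ∈ J)
    {φ : OpenPartialHomeomorph M (EuclideanQuadrant n)} {δ : ℝ} (h : LinAt E φ δ p) (hδ : 0 < δ)
    (hm : Matched φ ψ p) :
    blend χ E ψ J (ψ p) = ψ p ∧
      IsLocalDiffeomorphAt (model n) (model n) ∞ (blend χ E ψ J) (ψ p) := by
  have hJ' : ∀ i ∈ J, (ψ p).1 i = 0 := fun i hi => (hJ i).2 hi
  have hw : zeroOut J (ψ p) = ψ p := zeroOut_eq_self hJ'
  obtain ⟨S, hS⟩ := isLocalInverse_collar h hδ hψ hp hm hJ'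
  have hfix := eventually_collar_fixes h hδ hp hm hJ'
  have hface := eventually_collar_coord_eq_zero h hδ hψ hp hm hJ'
  have hz : collar E ψ J (ψ p) = ψ p := hfix.self_of_nhds hJ'
  have hbz : blend χ E ψ J (ψ p) = ψ p := by
    refine quadrant_ext fun i => ?_
    rw [blend_apply hχ, hz]; ring
  have hcs := hS.smooth.self_of_nhds
  have hbs : ∀ᶠ w in 𝓝 (ψ p), ContMDiffAt (model n) (model n) ∞ (blend χ E ψ J) w := by
    filter_upwards [hS.smooth, eventually_base hp hw (P := fun _ => True) (by simp)] with w h1 h2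
    have h3 : ContMDiffAt (model n) 𝓘(ℝ, ℝ) ∞ (fun w => χ (ψ.symm (zeroOut J w))) w :=
      hχs.contMDiffAt.comp w ((contMDiffAt_symm_of_mem_maximalAtlas hψ h2.1).comp w
        (contMDiff_zeroOut J).contMDiffAt)
    rw [contMDiffAt_quadrant_iff]
    intro i
    simp only [blend_apply hχ]
    exact ((contMDiffAt_const.sub h3).mul (contMDiff_coord i).contMDiffAt).add
      (h3.mul (contMDiffAt_quadrant_iff.1 h1 i))
  refine ⟨hbz, isLocalDiffeomorphAt_of_fixes_face hbs ?_ ?_ ?_⟩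
  · filter_upwards [hfix] with w hw0 hwJ
    refine quadrant_ext fun i => ?_
    rw [blend_apply hχ, hw0 fun i hi => hwJ i (hJ' i hi)]
    ring
  · filter_upwards [hface] with w hw0 k hk hwk
    rw [blend_apply hχ, hw0 k ((hJ k).1 hk) hwk, hwk]
    ring
  · intro k hk
    have hkJ := (hJ k).1 hk
    -- Row `k` has a positive entry. It is on the diagonal, since moving in another direction stays
    -- in the hyperface of `k`, which the collar preserves.
    have hpos : 0 < qderiv (collar E ψ J) (ψ p) (EuclideanSpace.single k 1) k := by
      obtain ⟨i, -, hi, -⟩ := hS.exists_entry (k := k) (by rw [hz, hk])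
      by_cases hik : i = k
      · rwa [hik] at hi
      · exfalso
        refine hi.ne' (qderiv_coord_eq hcs (fun j _ => single_nonneg i j) k ?_)
        filter_upwards [hface] with u hu t htu
        rw [hz, hk, mul_zero, add_zero]
        refine hu k hkJ ?_
        rw [htu]
        simp [hk, Ne.symm hik]
    have hmem : ∀ᶠ t in 𝓝[>] (0 : ℝ), (ψ p).1 + t • EuclideanSpace.single k (1 : ℝ) ∈
      range (model n) := eventually_add_smul_mem fun i _ => single_nonneg k i
    have t1 := ((PiLp.continuous_apply 2 (fun _ : Fin n => ℝ) k).tendsto _).comp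
      (tendsto_slope_lift hcs hmem)
    have t2 := ((PiLp.continuous_apply 2 (fun _ : Fin n => ℝ) k).tendsto _).comp
      (tendsto_slope_lift hbs.self_of_nhds hmem)
    have t3 : Tendsto (fun _ : ℝ => (1 : ℝ)) (𝓝[>] 0) (𝓝 1) := tendsto_const_nhds
    -- The cutoff is evaluated at the base point, which is constant in normal directions; no
    -- derivative of `χ` appears.
    have e : qderiv (blend χ E ψ J) (ψ p) (EuclideanSpace.single k 1) k =
        (1 - χ p) * 1 + χ p * qderiv (collar E ψ J) (ψ p) (EuclideanSpace.single k 1) k := by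
      refine tendsto_nhds_unique t2 ?_
      refine (((t3.const_mul (1 - χ p)).add (t1.const_mul (χ p)))).congr' ?_
      filter_upwards [hmem, self_mem_nhdsWithin] with t ht ht0
      have ht0 : 0 < t := ht0
      obtain ⟨u, hu⟩ := ht
      have hu : u.1 = (ψ p).1 + t • EuclideanSpace.single k (1 : ℝ) := hu
      have hzu : zeroOut J u = ψ p := by
        refine quadrant_ext fun i => ?_
        rw [zeroOut_apply, hu]
        split_ifs with hi
        · exact (hJ' i hi).symm
        · have : i ≠ k := fun h => hi (h ▸ hkJ)
          simp [this]
      have huk : u.1 k = t := by rw [hu]; simp [hk]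
      simp only [Function.comp, PiLp.smul_apply, PiLp.sub_apply, smul_eq_mul]
      rw [← hu, lift_coe, lift_coe, hz, hbz, hk, blend_apply hχ, hzu, ψ.left_inv hp, huk]
      field_simp
      ring
    rw [e]
    have := hχ p
    rcases eq_or_lt_of_le this.1 with h0 | h0
    · rw [← h0]; norm_num
    · have := mul_pos h0 hpos
      linarith [(hχ p).2]

/-- Where `E` is not known to be a translation, the cutoff vanishes nearby and the blend is the
identity. -/
lemma isLocalDiffeomorphAt_blend [IsManifold (model n) ∞ M]
    (hχs : ContMDiff (model n) 𝓘(ℝ, ℝ) ∞ χ)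
    (hχ : ∀ q, χ q ∈ Icc (0 : ℝ) 1) (hχ0 : ∀ q ∉ Good n E, ∀ᶠ q' in 𝓝 q, χ q' = 0)
    (hψ : ψ ∈ IsManifold.maximalAtlas (model n) ∞ M)
    (hp : p ∈ ψ.source) (hJ : ∀ i, (ψ p).1 i = 0 ↔ i ∈ J) :
    blend χ E ψ J (ψ p) = ψ p ∧
      IsLocalDiffeomorphAt (model n) (model n) ∞ (blend χ E ψ J) (ψ p) := by
  by_cases hg : p ∈ Good n E
  · obtain ⟨φ, δ, hδ, h⟩ := hg
    obtain ⟨φ', h', hm⟩ := h.exists_matched hψ hp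
    exact isLocalDiffeomorphAt_blend_of_linAt hχs hχ hψ hp hJ h' hδ hm
  · have hw : zeroOut J (ψ p) = ψ p := zeroOut_eq_self fun i hi => (hJ i).2 hi
    have h1 : ∀ᶠ w in 𝓝 (ψ p), blend χ E ψ J w = id w :=
      (eventually_base hp hw (hχ0 p hg)).mono fun w hw => blend_eq_self hχ hw.2
    exact ⟨h1.self_of_nhds, ((isLocalInverse_id _).congr h1).isLocalDiffeomorphAt⟩

/-- If a chart `ψ'` straightens the collar given by `E`, then near a point of codimension `|J|`
the collar map is given by translations in that chart. -/
lemma exists_eventually_eq_shift {φ ψ' : OpenPartialHomeomorph M (EuclideanQuadrant n)} {δ : ℝ}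
    (hp : p ∈ ψ.source) (hp' : p ∈ ψ'.source) (hψp : ψ' p = ψ p)
    (hJ : ∀ i, (ψ p).1 i = 0 ↔ i ∈ J) (h : LinAt E φ δ p) (hδ : 0 < δ) (hm : Matched φ ψ p)
    (hψ' : ∀ᶠ w in 𝓝 (ψ p), ψ'.symm w = ψ.symm (collar E ψ J w)) :
    ∃ δ' > 0, ∀ᶠ q in 𝓝 p, ∀ c : Filter M → NNReal, (∀ H, (c H : ℝ) ≤ δ') →
      E q c = ψ'.symm (shift ψ' q c) := by
  have hJ' : ∀ i ∈ J, (ψ p).1 i = 0 := fun i hi => (hJ i).2 hi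
  have hw : zeroOut J (ψ p) = ψ p := zeroOut_eq_self hJ'
  have hR : halfChange φ ψ J (ψ p) = φ p := by
    refine quadrant_ext fun i => ?_
    rw [halfChange_apply, hw, ψ.left_inv hp]
    split_ifs with hi
    · rw [hJ' i hi, (hm.self_of_nhds i).2 (hJ' i hi)]
    · rfl
  have hRt : Tendsto (halfChange φ ψ J) (𝓝 (ψ p)) (𝓝 (φ p)) := by
    have := (continuousAt_quadrant_iff (f := halfChange φ ψ J) (x := ψ p)).2 fun i => by
      simp only [halfChange_apply]
      by_cases hi : i ∈ J
      · simpa only [hi, if_true] using (continuous_coord i).continuousAt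
      · simp only [hi, if_false]
        refine (continuous_coord i).continuousAt.comp ?_
        have hz : Tendsto (zeroOut J) (𝓝 (ψ p)) (𝓝 (ψ p)) := by
          have := (continuous_zeroOut J).tendsto (ψ p)
          rwa [hw] at this
        have h2 := (φ.continuousAt h.mem_source).tendsto.comp ((tendsto_symm hp).comp hz)
        rw [ContinuousAt, hw, ψ.left_inv hp]
        exact h2
    rwa [ContinuousAt, hR] at this
  have hEq : ∀ᶠ w in 𝓝 (ψ p), halfChange φ ψ J w ∈ φ.target ∧
      ψ'.symm w = φ.symm (halfChange φ ψ J w) := by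
    filter_upwards [hψ', eventually_collar_eq h hδ hp hm hJ',
      hRt.eventually (φ.open_target.mem_nhds (φ.map_source h.mem_source)),
      ((tendsto_symm h.mem_source).comp hRt).eventually (ψ.open_source.mem_nhds hp)]
      with w h1 h2 h3 h4
    exact ⟨h3, by rw [h1, h2]; exact ψ.left_inv h4⟩
  rw [← hψp] at hEq
  have hψ'c : Tendsto ψ' (𝓝 p) (𝓝 (ψ' p)) := ψ'.continuousAt hp'
  -- So `φ` and `ψ'` have the same coordinates in `J`, and the other coordinates of `φ` depend only
  -- on those of `ψ'` off `J`. Translations in the slots of `J` therefore correspond under this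
  -- change of charts.
  have hbase : ∀ᶠ q in 𝓝 p, φ q = halfChange φ ψ J (ψ' q) := by
    filter_upwards [hψ'c.eventually hEq, ψ'.open_source.mem_nhds hp'] with q h1 h2
    rw [ψ'.left_inv h2] at h1
    conv_lhs => rw [h1.2]
    exact φ.right_inv h1.1
  obtain ⟨δ', hδ', hsh⟩ := exists_eventually_shift_mem hp' hEq
  -- Since `J` contains every coordinate vanishing at `p`, near `p` a translation changes no
  -- coordinate off `J`.
  have hne : ∀ᶠ q in 𝓝 p, ∀ i ∉ J, (ψ' q).1 i ≠ 0 ∧ (φ q).1 i ≠ 0 := by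
    rw [eventually_all]
    intro i
    by_cases hi : i ∈ J
    · simp [hi]
    · have h1 : (ψ' p).1 i ≠ 0 := by rw [hψp, Ne, hJ]; exact hi
      have h2 : (φ p).1 i ≠ 0 := by rw [Ne, hm.self_of_nhds, hJ]; exact hi
      filter_upwards [((continuous_coord i).continuousAt.comp hψ'c).eventually_ne h1,
        ((continuous_coord i).continuousAt.comp (φ.continuousAt h.mem_source)).eventually_ne h2]
        with q h3 h4 _
      exact ⟨h3, h4⟩
  refine ⟨min δ δ', lt_min hδ hδ', ?_⟩
  filter_upwards [h.eq_shift, hsh, hbase.eventually_nhds, hne] with q h1 h2 h3 h4 c hc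
  rw [(h1 c fun H => (hc H).trans (min_le_left _ _)).2,
    (h2 c fun H => (hc H).trans (min_le_right _ _)).2]
  congr 1
  have hq : φ q = halfChange φ ψ J (ψ' q) := h3.self_of_nhds
  have hzero : zeroOut J (shift ψ' q c) = zeroOut J (ψ' q) := by
    refine quadrant_ext fun i => ?_
    rw [zeroOut_apply, zeroOut_apply]
    split_ifs with hi
    · rfl
    · rw [shift_apply, if_neg (h4 i hi).1]
  refine quadrant_ext fun i => ?_
  rw [shift_apply, halfChange_apply, hzero]
  split_ifs with h5 h6 h6
  · have e1 : (ψ' q).1 i = 0 := by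
      rw [hq, halfChange_apply, if_pos h6] at h5
      exact h5
    have e2 : hyperGerm φ q i = hyperGerm ψ' q i :=
      nhdsWithin_eq_iff_eventuallyEq.2 (h3.mono fun q' hq' => propext (by
        change (φ q').1 i = 0 ↔ (ψ' q').1 i = 0
        rw [hq', halfChange_apply, if_pos h6]))
    rw [shift_apply, if_pos e1, e2]
  · exact absurd h5 (h4 i h6).2
  · have e1 : (φ q).1 i = (ψ' q).1 i := by rw [hq, halfChange_apply, if_pos h6]
    rw [shift_apply, if_neg (e1 ▸ h5), e1]
  · rw [hq, halfChange_apply, if_neg h6]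

/-- Extension of a collar map to a neighborhood of a part of a face in a chart. -/
theorem exists_extend [IsManifold (model n) ∞ M] [T2Space M] [CompactSpace M]
    {A B : Set M} (hA : IsClosed A)
    (hAE : A ⊆ Good n E) (hψ : ψ ∈ IsManifold.maximalAtlas (model n) ∞ M) (hB : IsClosed B)
    (hBψ : B ⊆ ψ.source) (hBJ : ∀ b ∈ B, ∀ i ∈ J, (ψ b).1 i = 0)
    (hBA : ∀ b ∈ B, b ∉ A → ∀ i, (ψ b).1 i = 0 → i ∈ J) :
    ∃ E' : M → (Filter M → NNReal) → M, A ∪ B ⊆ Good n E' := by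
  classical
  -- The old collar is kept on `N`. The cutoff is one near `closure N` and zero near the points
  -- where `E` is not good. Off `N` the vanishing coordinates on `B` are exactly those in `J`.
  obtain ⟨N, hN, hAN, hNE⟩ := normal_exists_closure_subset hA (isOpen_good E) hAE
  obtain ⟨χ, hχ0, hχ1, hχ⟩ := exists_contMDiffMap_zero_one_nhds_of_isClosed (n := (⊤ : ℕ∞))
    (model n) (isOpen_good E).isClosed_compl (isClosed_closure (s := N))
    (disjoint_left.2 fun x h1 h2 => h1 (hNE h2))
  have hχs : ContMDiff (model n) 𝓘(ℝ, ℝ) ∞ χ := χ.contMDiff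
  rw [eventually_nhdsSet_iff_forall] at hχ0 hχ1
  set g := blend χ E ψ J with hg
  have hBc : IsCompact (B \ N) := (hB.sdiff hN).isCompact
  have hBN : ∀ b ∈ B \ N, b ∈ ψ.source ∧ ∀ i, (ψ b).1 i = 0 ↔ i ∈ J := fun b hb =>
    ⟨hBψ hb.1, fun i => ⟨hBA b hb.1 (fun h => hb.2 (hAN h)) i, hBJ b hb.1 i⟩⟩
  have hgd : ∀ b ∈ B \ N, g (ψ b) = ψ b ∧
      IsLocalDiffeomorphAt (model n) (model n) ∞ g (ψ b) := fun b hb =>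
    isLocalDiffeomorphAt_blend hχs hχ hχ0 hψ (hBN b hb).1 (hBN b hb).2
  -- `g` fixes this compact set pointwise and is locally injective at its points, hence injective on
  -- a neighborhood of it.
  have hinj : InjOn g (ψ '' (B \ N)) := by
    rintro _ ⟨b, hb, rfl⟩ _ ⟨b', hb', rfl⟩ h
    rwa [(hgd b hb).1, (hgd b' hb').1] at h
  have : T2Space (EuclideanQuadrant n) := (model n).isClosedEmbedding.isEmbedding.t2Space
  obtain ⟨O, hO, hBO, hOinj⟩ := hinj.exists_isOpen_superset
    (hBc.image_of_continuousOn (ψ.continuousOn.mono fun b hb => (hBN b hb).1))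
    (by
      rintro _ ⟨b, hb, rfl⟩
      exact (hgd b hb).2.contMDiffAt.continuousAt)
    (by
      rintro _ ⟨b, hb, rfl⟩
      obtain ⟨Φ, h1, h2⟩ := (hgd b hb).2
      exact ⟨Φ.source, Φ.open_source.mem_nhds h1, Φ.injOn.congr h2.symm⟩)
  set Ω := O ∩ {w | IsLocalDiffeomorphAt (model n) (model n) ∞ g w} with hΩ
  have hΩo : IsOpen Ω := hO.inter (isOpen_iff_eventually.2 fun w hw =>
    eventually_isLocalDiffeomorphAt hw)
  obtain ⟨Γ, hΓs, hΓ⟩ := exists_partialDiffeomorph_of_injOn hΩo (hOinj.mono inter_subset_left)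
    fun w hw => hw.2
  -- Translations in this chart, seen in `ψ`, are given by the blended collar `g`.
  set ψ' : OpenPartialHomeomorph M (EuclideanQuadrant n) :=
    ψ.trans Γ.toOpenPartialHomeomorph.symm with hψ'
  have hψ'a : ψ' ∈ IsManifold.maximalAtlas (model n) ∞ M := by
    refine OpenPartialHomeomorph.mem_maximalAtlas_of_contMDiffOn _ ?_ ?_
    · exact Γ.contMDiffOn_invFun.comp ((contMDiffOn_of_mem_maximalAtlas hψ).mono fun q hq => hq.1)
        fun q hq => hq.2
    · exact (contMDiffOn_symm_of_mem_maximalAtlas hψ).comp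
        (Γ.contMDiffOn_toFun.mono fun q hq => hq.1) fun q hq => hq.2
  have hb' : ∀ b ∈ B \ N, b ∈ ψ'.source ∧ ψ' b = ψ b := by
    intro b hb
    have h1 : ψ b ∈ Γ.source := by
      rw [hΓs]
      exact ⟨hBO ⟨b, hb, rfl⟩, (hgd b hb).2⟩
    have h2 : Γ (ψ b) = ψ b := by rw [hΓ, (hgd b hb).1]
    have h3 : ψ b ∈ Γ.target := by
      have := Γ.map_source h1
      rwa [show Γ.toPartialEquiv (ψ b) = ψ b from h2] at this
    refine ⟨⟨(hBN b hb).1, h3⟩, ?_⟩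
    have := Γ.left_inv h1
    rwa [show Γ.toPartialEquiv (ψ b) = ψ b from h2] at this
  have hψ's : ∀ w, ψ'.symm w = ψ.symm (g w) := fun w => by
    rw [← hΓ w]; rfl
  set E' : M → (Filter M → NNReal) → M := fun q c =>
    if q ∈ N then E q c else ψ'.symm (shift ψ' q c) with hE'
  have hN' : N ⊆ Good n E' := by
    intro a ha
    obtain ⟨φ, δ, hδ, h⟩ := hNE (subset_closure ha)
    refine ⟨φ, δ, hδ, h.congr ?_⟩
    filter_upwards [hN.mem_nhds ha] with q hq
    exact funext fun c => if_pos hq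
  refine ⟨E', union_subset (hAN.trans hN') fun b hb => ?_⟩
  by_cases hbN : b ∈ N
  · exact hN' hbN
  have hbB : b ∈ B \ N := ⟨hb, hbN⟩
  obtain ⟨hbs', hbψ⟩ := hb' b hbB
  obtain ⟨δ₁, hδ₁, h1⟩ := exists_eventually_shift_mem hbs'
    (ψ'.open_target.mem_nhds (ψ'.map_source hbs'))
  -- The two recipes for `E'` meet only at `closure N`, near which the cutoff is one, so `ψ'`
  -- straightens `E` itself and they agree.
  have h2 : ∃ δ₂ > 0, ∀ᶠ q in 𝓝 b, q ∈ N → ∀ c : Filter M → NNReal, (∀ H, (c H : ℝ) ≤ δ₂) →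
      E q c = ψ'.symm (shift ψ' q c) := by
    by_cases hbc : b ∈ closure N
    · obtain ⟨φ, δ, hδ, h⟩ := hNE hbc
      obtain ⟨φ', h', hm⟩ := h.exists_matched hψ (hBN b hbB).1
      obtain ⟨δ₂, hδ₂, h3⟩ := exists_eventually_eq_shift (hBN b hbB).1 hbs' hbψ (hBN b hbB).2 h'
        hδ hm (by
          have hw : zeroOut J (ψ b) = ψ b := zeroOut_eq_self fun i hi => ((hBN b hbB).2 i).2 hi
          filter_upwards [eventually_base (hBN b hbB).1 hw (hχ1 b hbc)] with w hw
          rw [hψ's, hg, blend_eq_collar hχ hw.2])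
      exact ⟨δ₂, hδ₂, h3.mono fun q hq _ => hq⟩
    · refine ⟨1, one_pos, ?_⟩
      filter_upwards [isClosed_closure.isOpen_compl.mem_nhds hbc] with q hq hqN
      exact absurd (subset_closure hqN) hq
  obtain ⟨δ₂, hδ₂, h2⟩ := h2
  refine ⟨ψ', min δ₁ δ₂, lt_min hδ₁ hδ₂, hψ'a, hbs', ?_⟩
  filter_upwards [h1, h2] with q hq1 hq2 c hc
  refine ⟨hq1 c fun H => (hc H).trans (min_le_left _ _), ?_⟩
  simp only [hE']
  split_ifs with hqN
  · exact hq2 hqN c fun H => (hc H).trans (min_le_right _ _)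
  · rfl

end Extend

/-! ### Existence of collar maps -/

section Existence

variable {n : ℕ} {M : Type*} [TopologicalSpace M] [ChartedSpace (EuclideanQuadrant n) M]
  [IsManifold (model n) ∞ M] [T2Space M] [CompactSpace M]

/-- Induction over upward closed families of index sets treats the deepest faces first; the index
set `∅` finally gives all of `K`. -/
lemma exists_extend_chart {E : M → (Filter M → NNReal) → M} {A K : Set M} (hA : IsClosed A)
    (hAE : A ⊆ Good n E) {ψ : OpenPartialHomeomorph M (EuclideanQuadrant n)}
    (hψ : ψ ∈ IsManifold.maximalAtlas (model n) ∞ M) (hK : IsClosed K) (hKψ : K ⊆ ψ.source) :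
    ∃ E' : M → (Filter M → NNReal) → M, A ∪ K ⊆ Good n E' := by
  classical
  have hclosed : ∀ J : Finset (Fin n), IsClosed {b ∈ K | ∀ i ∈ J, (ψ b).1 i = 0} := by
    intro J
    refine (ψ.continuousOn.mono hKψ).preimage_isClosed_of_isClosed hK
      (t := {w : EuclideanQuadrant n | ∀ i ∈ J, w.1 i = 0}) ?_
    simp only [ofPred_forall]
    exact isClosed_iInter fun i => isClosed_iInter fun _ =>
      isClosed_eq (continuous_coord i) continuous_const
  suffices h : ∀ 𝒥 : Finset (Finset (Fin n)), (∀ J ∈ 𝒥, ∀ J', J ⊆ J' → J' ∈ 𝒥) →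
      ∃ E' : M → (Filter M → NNReal) → M,
        A ∪ ⋃ J ∈ 𝒥, {b ∈ K | ∀ i ∈ J, (ψ b).1 i = 0} ⊆ Good n E' by
    obtain ⟨E', hE'⟩ := h Finset.univ (by simp)
    refine ⟨E', (union_subset_union_right A fun b hb => ?_).trans hE'⟩
    exact mem_biUnion (Finset.mem_coe.2 (Finset.mem_univ ∅)) ⟨hb, by simp⟩
  intro 𝒥
  induction 𝒥 using Finset.strongInduction with
  | H 𝒥 ih =>
    intro hup
    rcases 𝒥.eq_empty_or_nonempty with rfl | hne
    · exact ⟨E, by simpa using hAE⟩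
    -- Minimality keeps the rest of the family upward closed. A point of the face of `J` where a
    -- further coordinate `i` vanishes lies in the face of `insert i J`, which is already treated.
    obtain ⟨J, hJ⟩ := 𝒥.exists_minimal hne
    obtain ⟨E₁, hE₁⟩ := ih _ (Finset.erase_ssubset hJ.1) fun I hI I' hII' => by
      rw [Finset.mem_erase] at hI ⊢
      refine ⟨?_, hup I hI.2 I' hII'⟩
      rintro rfl
      exact hI.1 (hII'.antisymm (hJ.2 hI.2 hII'))
    obtain ⟨E₂, hE₂⟩ := exists_extend (J := J) (hA.union
      (isClosed_biUnion_finset fun I (_ : I ∈ 𝒥.erase J) => hclosed I)) hE₁ hψ (hclosed J)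
      (fun b hb => hKψ hb.1) (fun b hb => hb.2) (fun b hb hbA i hi => by
        by_contra hiJ
        refine hbA (Or.inr (mem_biUnion (x := insert i J) ?_ ⟨hb.1, ?_⟩))
        · rw [SetLike.mem_coe, Finset.mem_erase]
          refine ⟨fun h => hiJ (h ▸ Finset.mem_insert_self i J), ?_⟩
          exact hup J hJ.1 _ (Finset.subset_insert i J)
        · intro k hk
          rcases Finset.mem_insert.1 hk with rfl | hk
          · exact hi
          · exact hb.2 k hk)
    refine ⟨E₂, Subset.trans ?_ hE₂⟩
    rintro b (hb | hb)
    · exact Or.inl (Or.inl hb)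
    · obtain ⟨I, hI, hbI⟩ := mem_iUnion₂.1 hb
      by_cases hIJ : I = J
      · exact Or.inr (hIJ ▸ hbI)
      · exact Or.inl (Or.inr (mem_biUnion (Finset.mem_coe.2 (Finset.mem_erase.2 ⟨hIJ, hI⟩)) hbI))

variable (n M) in
/-- A compact manifold with corners has a collar map that is given near each point by
translations in some chart, for weights up to a uniform size. -/
theorem exists_collar : ∃ (E : M → (Filter M → NNReal) → M) (ε : ℝ), 0 < ε ∧
    ∀ p, ∃ φ : OpenPartialHomeomorph M (EuclideanQuadrant n), LinAt E φ ε p := by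
  classical
  have hreg : ∀ p : M, ∃ K ∈ 𝓝 p, IsClosed K ∧ K ⊆ (chartAt (EuclideanQuadrant n) p).source :=
    fun p => exists_mem_nhds_isClosed_subset (chart_source_mem_nhds _ p)
  choose K hKp hK hKs using hreg
  have hfin : ∀ s : Finset M, ∃ E : M → (Filter M → NNReal) → M, (⋃ p ∈ s, K p) ⊆ Good n E := by
    intro s
    induction s using Finset.induction_on with
    -- The initial values are arbitrary, as nothing is required of them over the empty set.
    | empty => exact ⟨fun q _ => q, by simp⟩
    | insert p s _ ih =>
      obtain ⟨E, hE⟩ := ih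
      obtain ⟨E', hE'⟩ := exists_extend_chart (isClosed_biUnion_finset fun q _ => hK q) hE
        (IsManifold.chart_mem_maximalAtlas p) (hK p) (hKs p)
      refine ⟨E', ?_⟩
      rw [Finset.set_biUnion_insert, union_comm]
      exact hE'
  obtain ⟨t, -, ht⟩ := isCompact_univ.elim_nhds_subcover K fun p _ => hKp p
  obtain ⟨E, hE⟩ := hfin t
  have hgood : ∀ p : M, ∃ (φ : OpenPartialHomeomorph M (EuclideanQuadrant n)) (δ : ℝ),
      0 < δ ∧ LinAt E φ δ p := fun p => hE (ht (mem_univ p))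
  choose φ δ hδ hlin using hgood
  -- A chart that linearizes `E` at `p` does so nearby with the same `δ p`; the minimum over a
  -- finite subcover is the uniform size.
  obtain ⟨s, -, hs⟩ := isCompact_univ.elim_nhds_subcover (fun p => {q | LinAt E (φ p) (δ p) q})
    fun p _ => (hlin p).eventually
  have hmin : ∀ s : Finset M, ∃ ε : ℝ, 0 < ε ∧ ∀ p ∈ s, ε ≤ δ p := by
    intro s
    induction s using Finset.induction_on with
    | empty => exact ⟨1, one_pos, by simp⟩
    | insert p s _ ih =>
      obtain ⟨ε, hε, h⟩ := ih
      refine ⟨min ε (δ p), lt_min hε (hδ p), fun q hq => ?_⟩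
      rcases Finset.mem_insert.1 hq with rfl | hq
      · exact min_le_right _ _
      · exact (min_le_left _ _).trans (h q hq)
  obtain ⟨ε, hε, hεs⟩ := hmin s
  refine ⟨E, ε, hε, fun p => ?_⟩
  obtain ⟨q, hq, hpq⟩ := mem_iUnion₂.1 (hs (mem_univ p))
  exact ⟨φ q, LinAt.mono hpq (hεs q hq)⟩

end Existence

/-! ### Local agreement of local diffeomorphisms; charts as local diffeomorphisms. -/

section LocalDiffeo

variable {E₁ H₁ X E₂ H₂ Y : Type*} [NormedAddCommGroup E₁] [NormedSpace ℝ E₁]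
  [TopologicalSpace H₁] {I₁ : ModelWithCorners ℝ E₁ H₁} [TopologicalSpace X] [ChartedSpace H₁ X]
  [NormedAddCommGroup E₂] [NormedSpace ℝ E₂] [TopologicalSpace H₂]
  {I₂ : ModelWithCorners ℝ E₂ H₂} [TopologicalSpace Y] [ChartedSpace H₂ Y]

lemma isLocalDiffeomorphAt_congr {f g : X → Y} {x : X} (h : IsLocalDiffeomorphAt I₁ I₂ ∞ f x)
    (hfg : ∀ᶠ x' in 𝓝 x, g x' = f x') : IsLocalDiffeomorphAt I₁ I₂ ∞ g x := by
  obtain ⟨U, hU, hUo, hxU⟩ := eventually_nhds_iff.1 hfg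
  obtain ⟨Φ, hx, hΦ⟩ := h
  have h1 := Φ.toOpenPartialHomeomorph.restr_source' U hUo
  refine ⟨{ Φ.toOpenPartialHomeomorph.restr U with
    contMDiffOn_toFun := Φ.contMDiffOn_toFun.mono fun y hy => hy.1
    contMDiffOn_invFun := Φ.contMDiffOn_invFun.mono fun y hy => hy.1 }, ?_, ?_⟩
  · exact h1.ge ⟨hx, hxU⟩
  · rintro y hy
    have hy : y ∈ Φ.source ∩ U := h1.le hy
    exact (hU y hy.2).trans (hΦ hy.1)

lemma isLocalDiffeomorphAt_of_mem_maximalAtlas {e : OpenPartialHomeomorph X H₁}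
    (he : e ∈ IsManifold.maximalAtlas I₁ ∞ X) {x : X} (hx : x ∈ e.source) :
    IsLocalDiffeomorphAt I₁ I₁ ∞ e x :=
  ⟨{ e with
    contMDiffOn_toFun := contMDiffOn_of_mem_maximalAtlas he
    contMDiffOn_invFun := contMDiffOn_symm_of_mem_maximalAtlas he }, hx, fun _ _ => rfl⟩

lemma isLocalDiffeomorphAt_symm_of_mem_maximalAtlas {e : OpenPartialHomeomorph X H₁}
    (he : e ∈ IsManifold.maximalAtlas I₁ ∞ X) {w : H₁} (hw : w ∈ e.target) :
    IsLocalDiffeomorphAt I₁ I₁ ∞ e.symm w :=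
  ⟨{ e.symm with
    contMDiffOn_toFun := contMDiffOn_symm_of_mem_maximalAtlas he
    contMDiffOn_invFun := contMDiffOn_of_mem_maximalAtlas he }, hw, fun _ _ => rfl⟩

end LocalDiffeo

/-! ### Charts of the normal bundle -/

section Bundle

variable {n : ℕ} {M : Type*} [TopologicalSpace M] [ChartedSpace (EuclideanQuadrant n) M]
  {F : OpenFace n M} {ψ : OpenPartialHomeomorph M (EuclideanQuadrant n)} {J : Finset (Fin n)}

/-- The chart of the normal bundle given by `ψ` and `J`, as a partial homeomorphism. -/
def bundleHomeo (hψ : ψ ∈ atlas (EuclideanQuadrant n) M) (J : Finset (Fin n))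
    (u : NormalBundle F) : OpenPartialHomeomorph (NormalBundle F) (EuclideanQuadrant n) :=
  (bundleCore F).openPartialHomeomorph (bundleChart ψ J u) ⟨ψ, J, u, hψ, rfl⟩

lemma bundleHomeo_mem_maximalAtlas [IsManifold (model n) ∞ M]
    (hψ : ψ ∈ atlas (EuclideanQuadrant n) M) (u : NormalBundle F) :
    bundleHomeo hψ J u ∈ IsManifold.maximalAtlas (model n) ∞ (NormalBundle F) := by
  refine IsManifold.subset_maximalAtlas ?_
  exact mem_iUnion₂.2 ⟨bundleChart ψ J u, ⟨ψ, J, u, hψ, rfl⟩, rfl⟩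

lemma isOpen_chartSource (hψ : ψ ∈ atlas (EuclideanQuadrant n) M) :
    IsOpen (chartSource F ψ J) := by
  rcases isEmpty_or_nonempty (NormalBundle F) with h | ⟨⟨u⟩⟩
  · rw [eq_empty_of_isEmpty (chartSource F ψ J)]; exact isOpen_empty
  · exact (bundleHomeo hψ J u).open_source

lemma exists_mem_chartSource (v : NormalBundle F) :
    ∃ (ψ : OpenPartialHomeomorph M (EuclideanQuadrant n)) (J : Finset (Fin n)),
      v ∈ chartSource F ψ J := by
  obtain ⟨ψ, J, h⟩ := v.point.exists_chart
  exact ⟨ψ, J, h⟩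

lemma continuousAt_chartFun {v : NormalBundle F} (hv : v ∈ chartSource F ψ J) :
    ContinuousAt (chartFun (F := F) ψ J) v :=
  (bundleHomeo hv.1.mem_atlas J v).continuousAt hv

lemma eventually_mem_chartSource {v : NormalBundle F} (hv : v ∈ chartSource F ψ J) :
    ∀ᶠ v' in 𝓝 v, v' ∈ chartSource F ψ J :=
  (isOpen_chartSource hv.1.mem_atlas).mem_nhds hv

lemma continuous_immersion : Continuous fun v : NormalBundle F => v.point.immersion := by
  rw [continuous_iff_continuousAt]
  intro v
  obtain ⟨ψ, J, hv⟩ := exists_mem_chartSource v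
  have h1 : Tendsto (fun v' => ψ.symm (zeroOut J (chartFun ψ J v'))) (𝓝 v)
      (𝓝 v.point.immersion) := by
    have h2 := ((continuous_zeroOut J).continuousAt (x := chartFun ψ J v)).tendsto.comp
      (continuousAt_chartFun hv)
    rw [zeroOut_chartFun hv] at h2
    exact (tendsto_symm hv.1.mem_source).comp h2
  refine h1.congr' ?_
  filter_upwards [eventually_mem_chartSource hv] with v' hv'
  exact (immersion_eq hv').symm

lemma coord_hyperGerm {v : NormalBundle F} {i : Fin n} (hi : i ∈ J) :
    v.coord (hyperGerm ψ v.point.immersion i) = (chartFun ψ J v).1 i := by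
  rw [chartFun_apply, if_pos hi]

lemma coord_hyperGerm_eq_zero {v : NormalBundle F} (hv : v ∈ chartSource F ψ J) {i : Fin n}
    (hi : i ∉ J) (h0 : (ψ v.point.immersion).1 i = 0) :
    v.coord (hyperGerm ψ v.point.immersion i) = 0 := by
  refine v.coord_eq_zero _ fun h => hi ?_
  rw [hv.2] at h
  obtain ⟨k, hk, hki⟩ := h
  rw [← hyperGerm_injOn hv.1.mem_source (hv.1.vanish k hk) h0 hki]
  exact hk

lemma norm_eq {v : NormalBundle F} (hv : v ∈ chartSource F ψ J) :
    v.norm = Real.sqrt (∑ i ∈ J, (chartFun ψ J v).1 i ^ 2) := by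
  classical
  have hinj : Set.InjOn (hyperGerm ψ v.point.immersion) J := fun i hi k hk h =>
    hyperGerm_injOn hv.1.mem_source (hv.1.vanish i hi) (hv.1.vanish k hk) h
  rw [NormalBundle.norm, finsum_eq_sum_of_support_subset
    (s := J.image (hyperGerm ψ v.point.immersion)), Finset.sum_image hinj]
  · congr 1
    refine Finset.sum_congr rfl fun i hi => ?_
    rw [coord_hyperGerm hi]
  · intro H hH
    by_contra hn
    refine hH ?_
    rw [Finset.coe_image, ← hv.2] at hn
    change v.coord H ^ 2 = 0
    rw [v.coord_eq_zero H hn]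
    norm_num

lemma coord_le_norm (v : NormalBundle F) (H : Filter M) : v.coord H ≤ v.norm := by
  obtain ⟨ψ, J, hv⟩ := exists_mem_chartSource v
  by_cases hH : H ∈ v.point.hypers
  · rw [hv.2] at hH
    obtain ⟨i, hi, rfl⟩ := hH
    rw [coord_hyperGerm hi, norm_eq hv]
    exact Real.le_sqrt_of_sq_le (Finset.single_le_sum (f := fun i => (chartFun ψ J v).1 i ^ 2)
      (fun i _ => sq_nonneg _) hi)
  · rw [v.coord_eq_zero H hH]
    exact Real.sqrt_nonneg _

lemma continuous_norm : Continuous (NormalBundle.norm (F := F)) := by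
  rw [continuous_iff_continuousAt]
  intro v
  obtain ⟨ψ, J, hv⟩ := exists_mem_chartSource v
  have h : ContinuousAt (fun v' => Real.sqrt (∑ i ∈ J, (chartFun (F := F) ψ J v').1 i ^ 2)) v := by
    refine Real.continuous_sqrt.continuousAt.comp (tendsto_finsetSum _ fun i _ => ?_)
    exact ((continuousAt_quadrant_iff.1 (continuousAt_chartFun hv) i).tendsto.pow 2)
  refine h.congr ?_
  filter_upwards [eventually_mem_chartSource hv] with v' hv'
  exact (norm_eq hv').symm

lemma norm_zero (z : ClosedFace F) : (NormalBundle.zero z).norm = 0 := by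
  simp [NormalBundle.norm, NormalBundle.zero]

lemma chartFun_zero {z : ClosedFace F} (hz : NormalBundle.zero z ∈ chartSource F ψ J) :
    chartFun ψ J (NormalBundle.zero z) = ψ z.immersion := by
  refine quadrant_ext fun i => ?_
  rw [chartFun_apply]
  split_ifs with hi
  · exact (hz.1.vanish i hi).symm
  · rfl

lemma project_mem_chartSource {v : NormalBundle F} (hv : v ∈ chartSource F ψ J)
    (S : Set (Filter M)) : v.project S ∈ chartSource F ψ J := hv

/-- Distinct indices in `J` have distinct germs, so projecting along the germs of `K` touches
exactly the slots of `K`. -/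
lemma chartFun_project {v : NormalBundle F} (hv : v ∈ chartSource F ψ J) {K : Finset (Fin n)}
    (hK : K ⊆ J) :
    chartFun ψ J (v.project (hyperGerm ψ v.point.immersion '' K)) =
      zeroOut K (chartFun ψ J v) := by
  refine quadrant_ext fun i => ?_
  rw [zeroOut_apply, chartFun_apply, chartFun_apply]
  by_cases hi : i ∈ J
  · rw [if_pos hi, if_pos hi]
    by_cases hiK : i ∈ K
    · rw [if_pos hiK]
      exact if_pos ⟨i, hiK, rfl⟩
    · rw [if_neg hiK]
      refine if_neg ?_
      rintro ⟨k, hk, hki⟩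
      refine hiK ?_
      rw [← hyperGerm_injOn hv.1.mem_source (hv.1.vanish k (hK hk)) (hv.1.vanish i hi) hki]
      exact hk
  · rw [if_neg hi, if_neg hi, if_neg fun h => hi (hK h)]
    rfl

/-- If the germs that cut out the sheet `z` are germs of coordinate hyperfaces of `ψ`, then `ψ`
is adapted to the sheet. -/
lemma isAdapted_of_hypers_eq (hψ : ψ ∈ atlas (EuclideanQuadrant n) M) {z : ClosedFace F}
    (hz : z.immersion ∈ ψ.source) (hJ : ∀ i ∈ J, (ψ z.immersion).1 i = 0)
    (h : z.hypers = hyperGerm ψ z.immersion '' J) : IsAdapted F ψ J z.immersion := by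
  obtain ⟨ψ', J', hJ', hz'⟩ := z.exists_chart
  have hinj : Set.InjOn (hyperGerm ψ z.immersion) J := fun i hi k hk h =>
    hyperGerm_injOn hz (hJ i hi) (hJ k hk) h
  have hinj' : Set.InjOn (hyperGerm ψ' z.immersion) J' := fun i hi k hk h =>
    hyperGerm_injOn hJ'.mem_source (hJ'.vanish i hi) (hJ'.vanish k hk) h
  have himg : hyperGerm ψ z.immersion '' J = hyperGerm ψ' z.immersion '' J' := h.symm.trans hz'
  refine ⟨hψ, hz, ?_, hJ, ?_⟩
  · have h1 := congrArg Set.ncard himg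
    rw [hinj.ncard_image, hinj'.ncard_image, Set.ncard_coe_finset,
      Set.ncard_coe_finset] at h1
    rw [h1, hJ'.card_eq]
  · have h1 : ∀ᶠ y in 𝓝 z.immersion, ∀ i ∈ J', (∀ k ∈ J, (ψ y).1 k = 0) → (ψ' y).1 i = 0 := by
      rw [Filter.eventually_all_finset]
      intro i hi
      obtain ⟨k, hk, hki⟩ := himg.symm ▸ mem_image_of_mem (hyperGerm ψ' z.immersion)
        (Finset.mem_coe.2 hi)
      filter_upwards [(nhdsWithin_eq_iff_eventuallyEq.1 hki).mem_iff] with y hy hyJ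
      exact hy.1 (hyJ k hk)
    filter_upwards [h1, hJ'.nearby] with y hy hy' hyJ
    exact hy' fun i hi => hy i hi hyJ

variable [IsManifold (model n) ∞ M]

/-- Any chart computes the depth because changes of charts permute the vanishing coordinates. -/
lemma depth_eq {q : M} (hψ : ψ ∈ IsManifold.maximalAtlas (model n) ∞ M) (hq : q ∈ ψ.source) :
    depth n q = (Finset.univ.filter fun i => (ψ q).1 i = 0).card := by
  obtain ⟨σ, h⟩ := exists_perm_hyperfaces (IsManifold.chart_mem_maximalAtlas q) hψ
    (mem_chart_source _ q) hq
  have h0 := h.self_of_nhds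
  rw [depth, ← Set.ncard_coe_finset]
  refine (Set.ncard_congr (fun k _ => σ k) ?_ (fun _ _ _ _ h => σ.injective h) ?_).symm
  · intro k hk
    simpa [h0] using hk
  · intro l hl
    exact ⟨σ.symm l, by simpa [h0] using hl, by simp⟩

/-- At a point of the open face, the sheet of the closed face is cut out by all the local
hyperfaces. -/
lemma hypers_eq_of_depth {z : ClosedFace F} (hz : depth n z.immersion = F.codim)
    (hψ : ψ ∈ IsManifold.maximalAtlas (model n) ∞ M) (hq : z.immersion ∈ ψ.source) :
    z.hypers = hyperGerm ψ z.immersion '' {i | (ψ z.immersion).1 i = 0} := by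
  obtain ⟨ψ', J', hJ', hz'⟩ := z.exists_chart
  have hψ' := IsManifold.subset_maximalAtlas (I := model n) (n := ∞) hJ'.mem_atlas
  obtain ⟨σ, h⟩ := exists_perm_hyperfaces hψ' hψ hJ'.mem_source hq
  have hJ0 : J' = Finset.univ.filter fun i => (ψ' z.immersion).1 i = 0 := by
    refine Finset.eq_of_subset_of_card_le (fun i hi => by simpa using hJ'.vanish i hi) ?_
    rw [← depth_eq hψ' hJ'.mem_source, hz, hJ'.card_eq]
  have hg : ∀ k, hyperGerm ψ z.immersion k = hyperGerm ψ' z.immersion (σ k) := fun k =>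
    nhdsWithin_eq_iff_eventuallyEq.2 (h.mono fun _ h => propext (h k))
  have h0 := h.self_of_nhds
  rw [hz', hJ0]
  ext H
  constructor
  · rintro ⟨i, hi, rfl⟩
    refine ⟨σ.symm i, ?_, ?_⟩
    · simpa [h0] using hi
    · rw [hg, Equiv.apply_symm_apply]
  · rintro ⟨k, hk, rfl⟩
    exact ⟨σ k, by simpa [h0] using hk, (hg k).symm⟩

/-- Along the closed face the coordinates in `J` stay zero. Over a point of depth `F.codim` no
others vanish, and this persists nearby. -/
lemma eventually_depth_eq {v : NormalBundle F} (hv : depth n v.point.immersion = F.codim) :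
    ∀ᶠ v' in 𝓝 v, depth n v'.point.immersion = F.codim := by
  obtain ⟨ψ, J, hvs⟩ := exists_mem_chartSource v
  have hψ := IsManifold.subset_maximalAtlas (I := model n) (n := ∞) hvs.1.mem_atlas
  have hJ : ∀ {v' : NormalBundle F}, v' ∈ chartSource F ψ J →
      (J = Finset.univ.filter fun i => (ψ v'.point.immersion).1 i = 0) →
      depth n v'.point.immersion = F.codim := fun h h' => by
    rw [depth_eq hψ h.1.mem_source, ← h', h.1.card_eq]
  have hJ0 : J = Finset.univ.filter fun i => (ψ v.point.immersion).1 i = 0 := by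
    refine Finset.eq_of_subset_of_card_le (fun i hi => by simpa using hvs.1.vanish i hi) ?_
    rw [← depth_eq hψ hvs.1.mem_source, hv, hvs.1.card_eq]
  have hne : ∀ᶠ v' : NormalBundle F in 𝓝 v, ∀ i ∉ J, (ψ v'.point.immersion).1 i ≠ 0 := by
    rw [eventually_all]
    intro i
    by_cases hi : i ∈ J
    · simp [hi]
    · have h1 : (ψ v.point.immersion).1 i ≠ 0 := fun h => hi (by rw [hJ0]; simpa using h)
      have h2 : ContinuousAt (fun v' : NormalBundle F => (ψ v'.point.immersion).1 i) v :=
        (continuous_coord i).continuousAt.comp (ContinuousAt.comp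
          (f := fun v' : NormalBundle F => v'.point.immersion)
          (ψ.continuousAt hvs.1.mem_source) continuous_immersion.continuousAt)
      exact (h2.eventually_ne h1).mono fun _ h _ => h
  filter_upwards [eventually_mem_chartSource hvs, hne] with v' h1 h2
  refine hJ h1 (Finset.Subset.antisymm (fun i hi => by simpa using h1.1.vanish i hi) ?_)
  intro i hi
  by_contra hiJ
  exact h2 i hiJ (by simpa using hi)

end Bundle

/-! ### The maps on the normal bundles given by a collar map -/

section CollarMap

variable {n : ℕ} {M : Type*} [TopologicalSpace M] [ChartedSpace (EuclideanQuadrant n) M]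
  {F : OpenFace n M} {ψ φ : OpenPartialHomeomorph M (EuclideanQuadrant n)} {J : Finset (Fin n)}
  {E : M → (Filter M → NNReal) → M} {ε : ℝ}

/-- The map on the normal bundle given by a collar map. -/
def collarMap (E : M → (Filter M → NNReal) → M) (F : OpenFace n M) (v : NormalBundle F) : M :=
  E v.point.immersion fun H => (v.coord H).toNNReal

lemma LinAt.apply_zero {p : M} (h : LinAt E φ ε p) (hε : 0 < ε) : E p (fun _ => 0) = p := by
  rw [(h.eq_shift.self_of_nhds (fun _ => 0) fun _ => by simpa using hε.le).2]
  have : shift φ p (fun _ => 0) = φ p := by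
    refine quadrant_ext fun i => ?_
    rw [shift_apply]
    split_ifs with hi
    · simp [hi]
    · rfl
  rw [this, φ.left_inv h.mem_source]

lemma collarMap_zero (hε : 0 < ε) {z : ClosedFace F} (h : LinAt E φ ε z.immersion) :
    collarMap E F (NormalBundle.zero z) = z.immersion := by
  have e : (fun H => ((NormalBundle.zero z).coord H).toNNReal) = fun _ : Filter M => 0 :=
    funext fun H => Real.toNNReal_zero
  rw [collarMap, e]
  exact h.apply_zero hε

lemma shift_coord_eq_halfChange {v : NormalBundle F} (hv : v ∈ chartSource F ψ J)
    (hm : Matched φ ψ v.point.immersion) :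
    shift φ v.point.immersion (fun H => (v.coord H).toNNReal) =
      halfChange φ ψ J (chartFun ψ J v) := by
  refine shift_eq_halfChange hv.1.mem_source hm (zeroOut_chartFun hv) (fun i hi => ?_)
    fun i hi h0 => ?_
  · rw [Real.coe_toNNReal _ (v.coord_nonneg _), coord_hyperGerm hi]
  · simp only [coord_hyperGerm_eq_zero hv hi h0, Real.toNNReal_zero]

/-- The map given by a collar map in the coordinates on the normal bundle. -/
lemma eventually_collarMap_eq {v : NormalBundle F} (hv : v ∈ chartSource F ψ J)
    (h : LinAt E φ ε v.point.immersion) (hm : Matched φ ψ v.point.immersion)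
    (hε : v.norm < ε) :
    ∀ᶠ v' in 𝓝 v, v' ∈ chartSource F ψ J ∧ halfChange φ ψ J (chartFun ψ J v') ∈ φ.target ∧
      collarMap E F v' = φ.symm (halfChange φ ψ J (chartFun ψ J v')) := by
  have hc := (continuous_immersion (F := F)).tendsto v
  filter_upwards [eventually_mem_chartSource hv, hc.eventually h.eq_shift,
    hc.eventually hm.eventually_nhds, continuous_norm.continuousAt.eventually (gt_mem_nhds hε)]
    with v' h1 h2 h3 h4
  have h5 := h2 (fun H => (v'.coord H).toNNReal) fun H => by
    rw [Real.coe_toNNReal _ (v'.coord_nonneg _)]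
    exact (coord_le_norm v' H).trans (le_of_lt h4)
  rw [shift_coord_eq_halfChange h1 h3] at h5
  exact ⟨h1, h5.1, h5.2⟩

lemma depth_eq_of_mem_carrier {x : M} (hx : x ∈ F.carrier) : depth n x = F.codim := by
  obtain ⟨x₀, -, h⟩ := F.isComponent
  rw [h] at hx
  exact connectedComponentIn_subset {y | depth n y = F.codim} x₀ hx

variable [IsManifold (model n) ∞ M]

/-- The map is a composition of a bundle chart, `halfChange` and the inverse of a linearizing chart.
-/
lemma isLocalDiffeomorphAt_collarMap {v : NormalBundle F} (h : LinAt E φ ε v.point.immersion)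
    (hε : v.norm < ε) : IsLocalDiffeomorphAt (model n) (model n) ∞ (collarMap E F) v := by
  obtain ⟨ψ, J, hv⟩ := exists_mem_chartSource v
  have hψ := IsManifold.subset_maximalAtlas (I := model n) (n := ∞) hv.1.mem_atlas
  obtain ⟨φ', h', hm⟩ := h.exists_matched hψ hv.1.mem_source
  have hev := eventually_collarMap_eq hv h' hm hε
  refine isLocalDiffeomorphAt_congr ?_ (hev.mono fun _ h => h.2.2)
  have d1 := isLocalDiffeomorphAt_of_mem_maximalAtlas
    (bundleHomeo_mem_maximalAtlas hv.1.mem_atlas v (J := J)) hv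
  have d2 := (isLocalInverse_halfChange h'.mem_maximalAtlas hψ h'.mem_source hv.1.mem_source hm
    (zeroOut_chartFun hv)).isLocalDiffeomorphAt
  have d3 := isLocalDiffeomorphAt_symm_of_mem_maximalAtlas h'.mem_maximalAtlas
    hev.self_of_nhds.2.1
  have d4 := d2.comp (K := model n) (g := φ'.symm) (hg := d3)
  exact d1.comp (K := model n) (g := φ'.symm ∘ halfChange φ' ψ J) (hg := d4)

/-- Near a point of the open face, the map is injective on the part of the normal bundle over
the open face. -/
lemma eventually_injective_collarMap {p : M} (h : LinAt E φ ε p) (hp : depth n p = F.codim) :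
    ∃ U ∈ 𝓝 p, InjOn (collarMap E F)
      {v | v.point.immersion ∈ U ∧ depth n v.point.immersion = F.codim ∧ v.norm ≤ ε} := by
  -- Near `p` no new coordinates can vanish, so equal depth forces the same vanishing set. The
  -- translated coordinates then separate: those outside this set determine the base point, those
  -- inside it the weights.
  have hZ : ∀ᶠ q in 𝓝 p, depth n q = F.codim → ∀ i, (φ q).1 i = 0 ↔ (φ p).1 i = 0 := by
    have hne : ∀ᶠ q in 𝓝 p, ∀ i, (φ p).1 i ≠ 0 → (φ q).1 i ≠ 0 := by
      rw [eventually_all]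
      intro i
      by_cases hi : (φ p).1 i = 0
      · simp [hi]
      · exact (((continuous_coord i).continuousAt.comp
          (φ.continuousAt h.mem_source)).eventually_ne hi).mono fun _ h _ => h
    filter_upwards [hne, φ.open_source.mem_nhds h.mem_source] with q h1 h2 h3
    have hsub : (Finset.univ.filter fun i => (φ q).1 i = 0) ⊆
        Finset.univ.filter fun i => (φ p).1 i = 0 := by
      intro i hi
      by_contra hn
      exact h1 i (by simpa using hn) (by simpa using hi)
    have hcard := Finset.eq_of_subset_of_card_le hsub (by
      rw [← depth_eq h.mem_maximalAtlas h2, ← depth_eq h.mem_maximalAtlas h.mem_source, h3, hp])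
    intro i
    simpa using Finset.ext_iff.1 hcard i
  refine ⟨_, (hZ.and h.eventually), ?_⟩
  rintro v ⟨⟨hv1, hv2⟩, hvd, hvε⟩ v' ⟨⟨hv1', hv2'⟩, hvd', hvε'⟩ hvv
  have hs := hv2.eq_shift.self_of_nhds (fun H => (v.coord H).toNNReal) fun H => by
    rw [Real.coe_toNNReal _ (v.coord_nonneg _)]
    exact (coord_le_norm v H).trans hvε
  have hs' := hv2'.eq_shift.self_of_nhds (fun H => (v'.coord H).toNNReal) fun H => by
    rw [Real.coe_toNNReal _ (v'.coord_nonneg _)]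
    exact (coord_le_norm v' H).trans hvε'
  have heq : shift φ v.point.immersion (fun H => (v.coord H).toNNReal) =
      shift φ v'.point.immersion (fun H => (v'.coord H).toNNReal) := by
    refine φ.symm.injOn hs.1 hs'.1 ?_
    rw [← hs.2, ← hs'.2]
    exact hvv
  have hcoord := fun i => congrArg (fun w : EuclideanQuadrant n => w.1 i) heq
  simp only [shift_apply] at hcoord
  have hb : v.point.immersion = v'.point.immersion := by
    refine φ.injOn hv2.mem_source hv2'.mem_source (quadrant_ext fun i => ?_)
    have h1 := hcoord i
    by_cases hi : (φ p).1 i = 0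
    · rw [(hv1 hvd i).2 hi, (hv1' hvd' i).2 hi]
    · rwa [if_neg fun h => hi ((hv1 hvd i).1 h), if_neg fun h => hi ((hv1' hvd' i).1 h)] at h1
  have hh : v.point.hypers = v'.point.hypers := by
    rw [hypers_eq_of_depth hvd h.mem_maximalAtlas hv2.mem_source,
      hypers_eq_of_depth hvd' h.mem_maximalAtlas hv2'.mem_source, hb]
  refine NormalBundle.ext' hb hh (funext fun H => ?_)
  by_cases hH : H ∈ v.point.hypers
  · rw [hypers_eq_of_depth hvd h.mem_maximalAtlas hv2.mem_source] at hH
    obtain ⟨i, hi, rfl⟩ := hH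
    have hi : (φ v.point.immersion).1 i = 0 := hi
    have h1 := hcoord i
    rw [if_pos hi, if_pos (hb ▸ hi), Real.coe_toNNReal _ (v.coord_nonneg _),
      Real.coe_toNNReal _ (v'.coord_nonneg _)] at h1
    rw [h1, hb]
  · rw [v.coord_eq_zero H hH, v'.coord_eq_zero H (hh ▸ hH)]

/-- The closed face of a nonempty open face is not empty. -/
lemma nonempty_normalBundle (F : OpenFace n M) : Nonempty (NormalBundle F) := by
  obtain ⟨x, hx, hF⟩ := F.isComponent
  set ψ := chartAt (EuclideanQuadrant n) x with hψ
  have hψm : ψ ∈ IsManifold.maximalAtlas (model n) ∞ M := IsManifold.chart_mem_maximalAtlas x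
  have hxψ : x ∈ ψ.source := mem_chart_source _ x
  set J := Finset.univ.filter fun i => (ψ x).1 i = 0 with hJ
  have hmem : ∀ i, i ∈ J ↔ (ψ x).1 i = 0 := fun i => by simp [hJ]
  have hne : ∀ᶠ w in 𝓝 (ψ x), w ∈ ψ.target ∧ ∀ i, i ∉ J → w.1 i ≠ 0 := by
    refine (ψ.open_target.eventually_mem (ψ.map_source hxψ)).and (eventually_all.2 fun i => ?_)
    by_cases hi : i ∈ J
    · simp [hi]
    · exact ((continuous_coord i).continuousAt.eventually_ne
        fun h => hi ((hmem i).2 h)).mono fun _ h _ => h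
  obtain ⟨η, hη, hbox⟩ := exists_box hne
  -- The slice of a small box where the coordinates in `J` vanish is the image under `g` of a
  -- product of points and intervals. It is therefore connected, has constant depth and contains
  -- `x`, hence lies in the component; so `ψ` and `J` are adapted at `x`.
  let g : (Fin n → ℝ) → EuclideanQuadrant n := fun u =>
    ⟨WithLp.toLp 2 fun i => max (u i) 0, fun i => le_max_right _ _⟩
  have hg : Continuous g := Continuous.subtype_mk ((PiLp.continuous_toLp 2 _).comp
    (continuous_pi fun i => (continuous_apply i).max continuous_const)) _
  let s : Fin n → Set ℝ := fun i => if i ∈ J then {0} else Metric.ball ((ψ x).1 i) η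
  have hs : IsPreconnected (univ.pi s) := isPreconnected_univ_pi fun i => by
    by_cases hi : i ∈ J
    · simpa only [s, hi, if_true] using isPreconnected_singleton
    · simpa only [s, hi, if_false] using (convex_ball _ _).isPreconnected
  have hgs : ∀ u ∈ univ.pi s, g u ∈ ψ.target ∧ ∀ i, i ∈ J ↔ (g u).1 i = 0 := by
    intro u hu
    have h1 := hbox (g u) fun i => by
      have hui := hu i (mem_univ i)
      change |max (u i) 0 - _| < η
      by_cases hi : i ∈ J
      · simp only [s, hi, if_true, mem_singleton_iff] at hui
        simpa [hui, (hmem i).1 hi] using hη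
      · simp only [s, hi, if_false, Metric.mem_ball, Real.dist_eq] at hui
        have h2 := abs_max_sub_max_le_abs (u i) ((ψ x).1 i) 0
        rw [max_eq_left ((ψ x).2 i)] at h2
        exact h2.trans_lt hui
    refine ⟨h1.1, fun i => ⟨fun hi => ?_, fun h => by_contra fun hi => h1.2 i hi h⟩⟩
    have hui := hu i (mem_univ i)
    simp only [s, hi, if_true, mem_singleton_iff] at hui
    change max (u i) 0 = 0
    rw [hui, max_self]
  have hT : IsPreconnected ((fun u => ψ.symm (g u)) '' univ.pi s) :=
    hs.image _ fun u hu => ((ψ.continuousAt_symm (hgs u hu).1).comp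
      (f := g) hg.continuousAt).continuousWithinAt
  have hin : ∀ y ∈ ψ.source, (∀ i, |(ψ y).1 i - (ψ x).1 i| < η) → (∀ i ∈ J, (ψ y).1 i = 0) →
      y ∈ (fun u => ψ.symm (g u)) '' univ.pi s := by
    intro y hy hyη hyJ
    refine ⟨fun i => (ψ y).1 i, fun i _ => ?_, ?_⟩
    · by_cases hi : i ∈ J
      · simp only [s, hi, if_true, mem_singleton_iff, hyJ i hi]
      · simpa only [s, hi, if_false, Metric.mem_ball, Real.dist_eq] using hyη i
    · have : g (fun i => (ψ y).1 i) = ψ y := quadrant_ext fun i => max_eq_left ((ψ y).2 i)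
      simp only [this, ψ.left_inv hy]
  have hsub : (fun u => ψ.symm (g u)) '' univ.pi s ⊆ F.carrier := by
    rw [hF]
    refine hT.subset_connectedComponentIn
      (hin x hxψ (fun i => by simpa using hη) fun i hi => (hmem i).1 hi) ?_
    rintro _ ⟨u, hu, rfl⟩
    change depth n (ψ.symm (g u)) = F.codim
    rw [depth_eq hψm (ψ.map_target (hgs u hu).1), ψ.right_inv (hgs u hu).1, ← hx,
      depth_eq hψm hxψ]
    congr 1
    ext i
    rw [← hJ, (hgs u hu).2 i]
    simp
  have had : IsAdapted F ψ J x := by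
    refine ⟨chart_mem_atlas _ x, hxψ, ?_, fun i hi => (hmem i).1 hi, ?_⟩
    · rw [← hx, depth_eq hψm hxψ]
    · have h1 : ∀ᶠ y in 𝓝 x, ∀ i, |(ψ y).1 i - (ψ x).1 i| < η := eventually_all.2 fun i =>
        ((continuous_coord i).continuousAt.comp (ψ.continuousAt hxψ)).eventually
          (Metric.ball_mem_nhds _ hη)
      filter_upwards [h1, ψ.open_source.mem_nhds hxψ] with y h1 h2 h3 _
      exact hsub (hin y h2 h1 h3)
  exact ⟨NormalBundle.zero ⟨x, hyperGerm ψ x '' J, ψ, J, had, rfl⟩⟩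

/-- The map restricts to a diffeomorphism on a neighborhood of the open face. -/
lemma exists_partialDiffeomorph_collarMap [T2Space M] [CompactSpace M]
    (hE : ∀ p, ∃ φ : OpenPartialHomeomorph M (EuclideanQuadrant n), LinAt E φ ε p) {ε' : ℝ}
    (hε' : 0 < ε') (hεε' : ε' < ε) :
    ∃ Φ : PartialDiffeomorph (model n) (model n) (NormalBundle F) M ∞,
      (∀ z : ClosedFace F, depth n z.immersion = F.codim → NormalBundle.zero z ∈ Φ.source) ∧
      (∀ v ∈ Φ.source, v.norm ≤ ε') ∧ EqOn (collarMap E F) Φ Φ.source := by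
  have := Manifold.metrizableSpace (model n) M
  let _ := TopologicalSpace.metrizableSpaceMetric M
  have hloc : ∀ p : M, ∃ r > 0, depth n p = F.codim → InjOn (collarMap E F)
      {v | dist v.point.immersion p < r ∧ depth n v.point.immersion = F.codim ∧ v.norm ≤ ε} := by
    intro p
    by_cases hp : depth n p = F.codim
    · obtain ⟨φ, h⟩ := hE p
      obtain ⟨U, hU, hinj⟩ := eventually_injective_collarMap h hp
      obtain ⟨r, hr, hrU⟩ := Metric.mem_nhds_iff.1 hU
      refine ⟨r, hr, fun _ => hinj.mono ?_⟩
      rintro v ⟨h1, h2⟩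
      exact ⟨hrU h1, h2⟩
    · exact ⟨1, one_pos, fun h => absurd h hp⟩
  choose r hr hinj using hloc
  -- Both the base point and its image are kept within a quarter of the injectivity radius at `p`.
  set V : M → Set (NormalBundle F) := fun p => {v | depth n v.point.immersion = F.codim ∧
    v.norm < ε' ∧ dist v.point.immersion p < r p / 4 ∧ dist (collarMap E F v) p < r p / 4} with hV
  have hld : ∀ v : NormalBundle F, v.norm < ε' →
      IsLocalDiffeomorphAt (model n) (model n) ∞ (collarMap E F) v := fun v hv =>
    isLocalDiffeomorphAt_collarMap (hE v.point.immersion).choose_spec (hv.trans hεε')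
  have hVo : ∀ p, IsOpen (V p) := by
    intro p
    rw [isOpen_iff_mem_nhds]
    rintro v ⟨h1, h2, h3, h4⟩
    have c1 : ContinuousAt (fun v : NormalBundle F => dist v.point.immersion p) v :=
      (continuous_immersion.dist continuous_const).continuousAt
    have c2 : ContinuousAt (fun v : NormalBundle F => dist (collarMap E F v) p) v :=
      (hld v h2).contMDiffAt.continuousAt.dist continuousAt_const
    filter_upwards [eventually_depth_eq h1, continuous_norm.continuousAt.eventually
      (gt_mem_nhds h2), c1.eventually (gt_mem_nhds h3), c2.eventually (gt_mem_nhds h4)]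
      with v' e1 e2 e3 e4
    exact ⟨e1, e2, e3, e4⟩
  set Ω := ⋃ p ∈ {p : M | depth n p = F.codim}, V p with hΩ
  have hΩo : IsOpen Ω := isOpen_biUnion fun p _ => hVo p
  have hΩinj : InjOn (collarMap E F) Ω := by
    -- With a common image, the base point of `v'` is within `r p' / 4 + r p' / 4 + r p / 4 < r p`
    -- of `p`, so local injectivity at the center with the larger radius decides.
    have key : ∀ p p' v v', depth n p = F.codim → v ∈ V p → v' ∈ V p' → r p' ≤ r p →
        collarMap E F v = collarMap E F v' → v = v' := by
      rintro p p' v v' hp ⟨h1, h2, h3, h4⟩ ⟨h1', h2', h3', h4'⟩ hrr he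
      refine hinj p hp ⟨?_, h1, (h2.trans hεε').le⟩ ⟨?_, h1', (h2'.trans hεε').le⟩ he
      · linarith [hr p]
      · have t1 := dist_triangle v'.point.immersion p' p
        have t2 := dist_triangle_left p' p (collarMap E F v')
        rw [he] at h4
        linarith [hr p]
    intro v hv v' hv' he
    obtain ⟨p, hp, hvp⟩ := mem_iUnion₂.1 hv
    obtain ⟨p', hp', hvp'⟩ := mem_iUnion₂.1 hv'
    rcases le_total (r p') (r p) with h | h
    · exact key p p' v v' hp hvp hvp' h he
    · exact (key p' p v' v hp' hvp' hvp h he.symm).symm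
  have hΩε : ∀ v ∈ Ω, v.norm < ε' := fun v hv => by
    obtain ⟨p, -, hvp⟩ := mem_iUnion₂.1 hv
    exact hvp.2.1
  have := nonempty_normalBundle F
  obtain ⟨Φ, hΦs, hΦ⟩ := exists_partialDiffeomorph_of_injOn hΩo hΩinj
    fun v hv => hld v (hΩε v hv)
  refine ⟨Φ, fun z hz => ?_, fun v hv => (hΩε v (hΦs ▸ hv)).le, fun v _ => (hΦ v).symm⟩
  rw [hΦs]
  refine mem_biUnion (x := z.immersion) hz ⟨hz, ?_, ?_, ?_⟩
  · rwa [norm_zero]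
  · change dist z.immersion z.immersion < _
    rw [dist_self]
    linarith [hr z.immersion]
  · rw [collarMap_zero (hε'.trans hεε') (hE z.immersion).choose_spec, dist_self]
    linarith [hr z.immersion]

end CollarMap

/-! ### Compatibility of the maps on the normal bundles -/

section Compatibility

variable {n : ℕ} {M : Type*} [TopologicalSpace M] [ChartedSpace (EuclideanQuadrant n) M]
  [IsManifold (model n) ∞ M] {F G : OpenFace n M}
  {ψ φ : OpenPartialHomeomorph M (EuclideanQuadrant n)} {J K : Finset (Fin n)}
  {E : M → (Filter M → NNReal) → M} {ε : ℝ}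

/-- A local inverse of the map on the normal bundle, in coordinates. -/
lemma eventually_chartFun_symm {x : ClosedFace G} (hx : NormalBundle.zero x ∈ chartSource G ψ J)
    (h : LinAt E φ ε x.immersion) (hm : Matched φ ψ x.immersion) (hε : 0 < ε)
    {Φ : PartialDiffeomorph (model n) (model n) (NormalBundle G) M ∞}
    (hΦ : NormalBundle.zero x ∈ Φ.source) (hEΦ : EqOn (collarMap E G) Φ Φ.source) :
    ∀ᶠ y in 𝓝 (φ x.immersion), Φ.symm (φ.symm y) ∈ chartSource G ψ J ∧
      chartFun ψ J (Φ.symm (φ.symm y)) = halfChange ψ φ J y := by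
  have hψ := IsManifold.subset_maximalAtlas (I := model n) (n := ∞) hx.1.mem_atlas
  set e := bundleHomeo hx.1.mem_atlas J (NormalBundle.zero x) with he
  have hJ : ∀ i ∈ J, (ψ x.immersion).1 i = 0 := hx.1.vanish
  have hex : e (NormalBundle.zero x) = ψ x.immersion := chartFun_zero hx
  have hli := isLocalInverse_halfChange (J := J) h.mem_maximalAtlas hψ h.mem_source
    hx.1.mem_source hm (w := ψ x.immersion) (zeroOut_eq_self hJ)
  have hb : halfChange φ ψ J (ψ x.immersion) = φ x.immersion :=
    halfChange_base hx.1.mem_source hm hJ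
  have hright := hli.right_inv
  have ht := hli.symm.tendsto
  rw [hb] at hright ht
  have hb' : halfChange ψ φ J (φ x.immersion) = e (NormalBundle.zero x) := by
    rw [hex, ← hb]
    exact hli.left_inv.self_of_nhds
  rw [hb'] at ht
  have hS : Tendsto (fun y => e.symm (halfChange ψ φ J y)) (𝓝 (φ x.immersion))
      (𝓝 (NormalBundle.zero x)) := (e.tendsto_symm hx).comp ht
  filter_upwards [hright, ht.eventually (e.open_target.mem_nhds (e.map_source hx)),
    hS.eventually (Φ.open_source.mem_nhds hΦ),
    hS.eventually (eventually_collarMap_eq hx h hm (by rwa [norm_zero]))] with y h1 h2 h3 h4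
  have h5 : chartFun ψ J (e.symm (halfChange ψ φ J y)) = halfChange ψ φ J y := e.right_inv h2
  have h6 : φ.symm y = Φ (e.symm (halfChange ψ φ J y)) := by
    rw [← hEΦ h3, h4.2.2, h5, h1]
  have h6 : Φ.symm (φ.symm y) = e.symm (halfChange ψ φ J y) := by
    rw [h6]
    exact Φ.left_inv h3
  rw [h6]
  exact ⟨h4.1, h5⟩

/-- The maps on the normal bundles of two faces given by a collar map are compatible. -/
lemma eventually_project_symm_collarMap {x : ClosedFace G} {z : ClosedFace F}
    (hx : IsAdapted G ψ J x.immersion) (hxJ : x.hypers = hyperGerm ψ x.immersion '' J)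
    (hzx : z.immersion = x.immersion) (hKJ : K ⊆ J)
    (hzK : z.hypers = hyperGerm ψ x.immersion '' K)
    (hE : LinAt E φ ε x.immersion) (hε : 0 < ε)
    {Φ : PartialDiffeomorph (model n) (model n) (NormalBundle G) M ∞}
    (hΦ : NormalBundle.zero x ∈ Φ.source) (hEΦ : EqOn (collarMap E G) Φ Φ.source) :
    ∀ᶠ v in 𝓝 (NormalBundle.zero z),
      (Φ.symm (collarMap E F v)).project
          (hyperGerm ψ (Φ.symm (collarMap E F v)).point.immersion '' K) =
        Φ.symm (collarMap E F (NormalBundle.zero v.point)) := by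
  have hψ := IsManifold.subset_maximalAtlas (I := model n) (n := ∞) hx.mem_atlas
  obtain ⟨φ, h, hm⟩ := hE.exists_matched hψ hx.mem_source
  have hx0 : NormalBundle.zero x ∈ chartSource G ψ J := ⟨hx, hxJ⟩
  have hkey := eventually_chartFun_symm hx0 h hm hε hΦ hEΦ
  rw [← hzx] at h hm hkey hzK
  have hz0 : NormalBundle.zero z ∈ chartSource F ψ K :=
    ⟨isAdapted_of_hypers_eq hx.mem_atlas (hzx ▸ hx.mem_source)
      (fun i hi => hzx ▸ hx.vanish i (hKJ hi)) hzK, hzK⟩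
  have hc : Tendsto (fun v : NormalBundle F => v.point.immersion) (𝓝 (NormalBundle.zero z))
      (𝓝 z.immersion) := continuous_immersion.tendsto _
  have hli := isLocalInverse_halfChange (J := K) h.mem_maximalAtlas hψ h.mem_source
    hz0.1.mem_source hm (zeroOut_eq_self hz0.1.vanish)
  have ht := hli.tendsto
  have hb : halfChange φ ψ K (ψ z.immersion) = φ z.immersion :=
    halfChange_base hz0.1.mem_source hm hz0.1.vanish
  rw [hb] at ht
  have hcf : Tendsto (chartFun ψ K) (𝓝 (NormalBundle.zero z)) (𝓝 (ψ z.immersion)) := by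
    have := continuousAt_chartFun hz0
    rwa [ContinuousAt, chartFun_zero hz0] at this
  filter_upwards [eventually_collarMap_eq hz0 h hm (by rwa [norm_zero]),
    hc.eventually (hm.and h.eventually), (ht.comp hcf).eventually hkey,
    ((φ.continuousAt h.mem_source).tendsto.comp hc).eventually hkey]
    with v ⟨hv, _, hv'⟩ ⟨hmv, hEv⟩ ⟨ha, ha'⟩ ⟨hb, hb'⟩
  simp only [Function.comp] at ha ha' hb hb'
  rw [φ.left_inv hEv.mem_source] at hb hb'
  rw [collarMap_zero hε hEv, hv']
  refine (chartFun_bijOn G ψ J).injOn (project_mem_chartSource ha _) hb ?_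
  rw [chartFun_project ha hKJ, ha', hb']
  -- In the chart `φ`, the image of `v` differs from its base point only in the slots of `K`, where
  -- the base point has zeros. In these coordinates the inverse of the map of `G` keeps the slots of
  -- `J` and computes the others from the coordinates off `J`. So erasing the slots of `K` after the
  -- inverse gives the image of the base point.
  set y' := halfChange φ ψ K (chartFun ψ K v) with hy'
  have hy : ∀ i ∉ K, y'.1 i = (φ v.point.immersion).1 i := fun i hi => by
    rw [hy', halfChange_apply, if_neg hi, zeroOut_chartFun hv, ψ.left_inv hv.1.mem_source]
  have hyK : ∀ i ∈ K, (φ v.point.immersion).1 i = 0 := fun i hi =>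
    (hmv i).2 (hv.1.vanish i hi)
  have hJ : zeroOut J y' = zeroOut J (φ v.point.immersion) := quadrant_ext fun i => by
    rw [zeroOut_apply, zeroOut_apply]
    split_ifs with hi
    · rfl
    · exact hy i fun h => hi (hKJ h)
  refine quadrant_ext fun i => ?_
  rw [zeroOut_apply, halfChange_apply ψ φ J y', halfChange_apply ψ φ J (φ _), hJ]
  by_cases hiK : i ∈ K
  · rw [if_pos hiK, if_pos (hKJ hiK), hyK i hiK]
  · rw [if_neg hiK, hy i hiK]

end Compatibility

end Corners

end

theorem mainTheorem4 (n : ℕ) {M : Type*} [TopologicalSpace M] [T2Space M] [CompactSpace M]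
    [ConnectedSpace M] [ChartedSpace (EuclideanQuadrant n) M]
    [IsManifold (Corners.model n) ∞ M] :
    ∃ ε₀ : ℝ, 0 < ε₀ ∧ ∀ ε : ℝ, 0 < ε → ε ≤ ε₀ →
      ∃ f : ∀ F : Corners.OpenFace n M, Corners.NormalBundle F → M,
        -- the maps are smooth for `|ρ| ≤ ε`
        (∀ F : Corners.OpenFace n M, 0 < F.codim → ∀ v : Corners.NormalBundle F, v.norm ≤ ε →
          ContMDiffAt (Corners.model n) (Corners.model n) ∞ (f F) v) ∧
        -- 1: on the zero section they are the immersions of the closed faces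
        (∀ F : Corners.OpenFace n M, 0 < F.codim → ∀ z : Corners.ClosedFace F,
          f F (Corners.NormalBundle.zero z) = z.immersion) ∧
        -- 2: they are local diffeomorphisms
        (∀ F : Corners.OpenFace n M, 0 < F.codim → ∀ v : Corners.NormalBundle F, v.norm ≤ ε →
          IsLocalDiffeomorphAt (Corners.model n) (Corners.model n) ∞ (f F) v) ∧
        -- 3: they restrict to diffeomorphisms on neighborhoods of the open faces
        (∀ F : Corners.OpenFace n M, 0 < F.codim →
          ∃ Φ : PartialDiffeomorph (Corners.model n) (Corners.model n)
              (Corners.NormalBundle F) M ∞,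
            (∀ z : Corners.ClosedFace F, z.immersion ∈ F.carrier →
              Corners.NormalBundle.zero z ∈ Φ.source) ∧
            (∀ v ∈ Φ.source, v.norm ≤ ε) ∧
            EqOn (f F) Φ Φ.source) ∧
        -- 4: compatibility of the maps of `F ≻ G` near a point `x` of the closed face of `G`:
        -- `z` is the corresponding point of the closed face of `F`, where the sheet of `F` is
        -- cut out by the defining functions `ψᵢ`, `i ∈ K ⊆ J`; `Φ` is `f G` near `x`
        (∀ F G : Corners.OpenFace n M, 0 < F.codim → Corners.Adjacent F G →
          ∀ (x : Corners.ClosedFace G) (z : Corners.ClosedFace F)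
            (ψ : OpenPartialHomeomorph M (EuclideanQuadrant n)) (J K : Finset (Fin n)),
            Corners.IsAdapted G ψ J x.immersion →
            x.hypers = Corners.hyperGerm ψ x.immersion '' J →
            z.immersion = x.immersion →
            K ⊆ J →
            z.hypers = Corners.hyperGerm ψ x.immersion '' K →
            ∀ Φ : PartialDiffeomorph (Corners.model n) (Corners.model n)
                (Corners.NormalBundle G) M ∞,
              Corners.NormalBundle.zero x ∈ Φ.source → EqOn (f G) Φ Φ.source →
              ∀ᶠ v in 𝓝 (Corners.NormalBundle.zero z),
                (Φ.symm (f F v)).project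
                    (Corners.hyperGerm ψ (Φ.symm (f F v)).point.immersion '' K) =
                  Φ.symm (f F (Corners.NormalBundle.zero v.point))) := by
  obtain ⟨E, ε₁, hε₁, hE⟩ := Corners.exists_collar n M
  -- Halving makes `ε < ε₁` strict, so the vectors with `|ρ| = ε` still have neighborhoods on which
  -- the translation formula holds.
  refine ⟨ε₁ / 2, half_pos hε₁, fun ε hε hεε => ?_⟩
  have hlt : ε < ε₁ := hεε.trans_lt (half_lt_self hε₁)
  have hloc : ∀ (F : Corners.OpenFace n M) (v : Corners.NormalBundle F), v.norm ≤ ε →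
      IsLocalDiffeomorphAt (Corners.model n) (Corners.model n) ∞ (Corners.collarMap E F) v :=
    fun F v hv => Corners.isLocalDiffeomorphAt_collarMap (hE v.point.immersion).choose_spec
      (hv.trans_lt hlt)
  refine ⟨Corners.collarMap E, fun F _ v hv => (hloc F v hv).contMDiffAt,
    fun F _ z => Corners.collarMap_zero hε₁ (hE z.immersion).choose_spec,
    fun F _ v hv => hloc F v hv, fun F _ => ?_, ?_⟩
  · obtain ⟨Φ, h1, h2, h3⟩ := Corners.exists_partialDiffeomorph_collarMap (F := F) hE hε hlt
    exact ⟨Φ, fun z hz => h1 z (Corners.depth_eq_of_mem_carrier hz), h2, h3⟩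
  · intro F G _ _ x z ψ J K hx hxJ hzx hKJ hzK Φ hΦ hEΦ
    exact Corners.eventually_project_symm_collarMap hx hxJ hzx hKJ hzK
      (hE x.immersion).choose_spec hε₁ hΦ hEΦ
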